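/- Let $d\ge 1$, $1/2\le H<1$, $u_0\in C_b(\mathbb R^d)$, and let $f:\mathbb R^d\to\mathbb R$ be a uniformly locally integrable function (i.e. $\sup_x\int_{|y-x|<1}|f(y)|\,dy<\infty$, which is automatic if $f\ge 0$ is locally integrable) which is the Fourier transform, in the sense of tempered distributions, of a tempered measure $\mu$. Let $\mathcal{HP}$ be the completion of the linear span of the indicators $1_{[0,t]\times A}$ ($t\ge0$, $A\subset\mathbb R^d$ bounded Borel) with respect to the inner product $$\langle 1_{[0,t]\times A},1_{[0,s]\times B}\rangle=H(2H-1)\int_0^t\!\int_0^s\!\int_A\!\int_B|u-v|^{2H-2}f(x-y)\,dy\,dx\,dv\,du\quad (H>1/2),$$ respectively $(t\wedge s)\int_A\int_B f(x-y)\,dy\,dx$ if $H=1/2$. A function $g$ on $(\mathbb R_+\times\mathbb R^d)^n$ belongs to $\mathcal{HP}^{\otimes n}$ if some $G\in\mathcal{HP}^{\otimes n}$ has, with every product of $n$ indicators $1_{[0,t_i]\times A_i}$, the inner product given by the corresponding (absolutely convergent) integral of $g$; $G$ is then unique and is identified with $g$; otherwise $\|g\|_{\mathcal{HP}^{\otimes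 n}}=\infty$. Let $W=\{W(h);h\in\mathcal{HP}\}$ be a centered Gaussian process on a probability space with $E[W(h)W(g)]=\langle h,g\rangle_{\mathcal{HP}}$, let $I_n$ be the $n$-th multiple Wiener integral with respect to $W$ (so $I_n(h^{\otimes n})=\mathrm{He}_n(W(h))$ for $\|h\|=1$, $\mathrm{He}_n$ the monic Hermite polynomial), and $\mathcal F_t=\sigma(W(1_{[0,s]\times A});s\le t,\ A \text{ bounded Borel})$. A process $Y=\{Y_{s,y}\}$ of square-integrable variables with $Y_{s,y}=\sum_{n\ge0}I_n(g_n(\cdot,s,y))$, $g_n(\cdot,s,y)\in\mathcal{HP}^{\otimes n}$ symmetric, is integrable with respect to $W$ if the symmetrization $\tilde g_n$ of $g_n$ in all $n+1$ variables belongs to $\mathcal{HP}^{\otimes(n+1)}$ (in the sense above) for every $n\ge0$ and $\sum_n I_{n+1}(\tilde g_n)$ converges in $L^2(\Omega)$; the sum is the Skorohod integral $\delta(Y)$. Let $p_t(x)=(2\pi t)^{-d/2}e^{-|x|^2/(2t)}$ for $t>0$, $p_tu_0(x)=\int p_t(x-y)u_0(y)\,dy$, and $p_0u_0=u_0$. A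 solution of $\partial_t u=\frac12\Delta u+u\dot W$, $u_{0,x}=u_0(x)$, is a square-integrable $(\mathcal F_t)$-adapted process $u=\{u_{t,x};t\ge0,x\in\mathbb R^d\}$ such that for all $(t,x)\in\mathbb R_+\times\mathbb R^d$ the process $Y^{t,x}_{s,y}=1_{[0,t]}(s)p_{t-s}(x-y)u_{s,y}$ (with $p_0:=0$ here) is integrable with respect to $W$ and $u_{t,x}=p_tu_0(x)+\delta(Y^{t,x})$ a.s. Define, for $n\ge 0$, $$f_n(t_1,x_1,\dots,t_n,x_n,t,x)=\frac1{n!}\prod_{j=1}^n p_{t_{\rho(j+1)}-t_{\rho(j)}}(x_{\rho(j+1)}-x_{\rho(j)})\;p_{t_{\rho(1)}}u_0(x_{\rho(1)}),$$ where $\rho$ is the permutation of $\{1,\dots,n\}$ with $0<t_{\rho(1)}<\dots<t_{\rho(n)}<t$ and $t_{\rho(n+1)}=t$, $x_{\rho(n+1)}=x$ (and $f_n=0$ if there is no such $\rho$; $f_0=p_tu_0(x)$). Then the equation possesses a solution if and only if $$\sum_{n=0}^\infty n!\,\|f_n(\cdot,t,x)\|^2_{\mathcal{HP}^{\otimes n}}<\infty\qquad\text{for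 all }(t,x)\in\mathbb R_+\times\mathbb R^d .$$ In this case the solution is unique (any two solutions agree a.s. at each $(t,x)$), and for all $(t,x)$ one has $u_{t,x}=\sum_{n=0}^\infty I_n(f_n(\cdot,t,x))$ in $L^2(\Omega)$ and $$E|u_{t,x}|^2=\sum_{n=0}^\infty n!\,\|f_n(\cdot,t,x)\|^2_{\mathcal{HP}^{\otimes n}} .$$ -/

import Mathlib

open MeasureTheory ProbabilityTheory
open scoped ENNReal NNReal Nat SchwartzMap BoundedContinuousFunction

noncomputable section

namespace StochHeat

/-! ### The Hilbert space generated by a positive semidefinite kernel -/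

/-- `k` is a (real) symmetric positive semidefinite kernel on the index set `I`. -/
def IsPSDKernel {I : Type*} (k : I → I → ℝ) : Prop :=
  (∀ a b, k a b = k b a) ∧
    ∀ c : I →₀ ℝ, 0 ≤ c.sum fun a x => c.sum fun b y => x * (y * k a b)

/-- Finite formal linear combinations of the elements of `I`, on which the kernel `k` defines a
semi-inner product. -/
def PreHilb {I : Type*} (_k : I → I → ℝ) : Type _ := I →₀ ℝ

section PreHilb

variable {I : Type*} (k : I → I → ℝ)

instance : AddCommGroup (PreHilb k) := inferInstanceAs (AddCommGroup (I →₀ ℝ))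

instance : Module ℝ (PreHilb k) := inferInstanceAs (Module ℝ (I →₀ ℝ))

open Classical in
/-- The semi-inner product `⟨∑ c_a a, ∑ d_b b⟩ = ∑ c_a d_b k(a,b)`. The case distinction only makes
this total: the kernels that occur below are positive semidefinite. -/
def preInner (c d : I →₀ ℝ) : ℝ :=
  if IsPSDKernel k then c.sum fun a x => d.sum fun b y => x * (y * k a b) else 0

lemma preInner_comm (c d : I →₀ ℝ) : preInner k c d = preInner k d c := by
  unfold preInner
  split_ifs with h
  · simp only [Finsupp.sum]
    rw [Finset.sum_comm]
    refine Finset.sum_congr rfl fun b _ => Finset.sum_congr rfl fun a _ => ?_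
    rw [h.1 a b]; ring
  · rfl

lemma preInner_add (c c' d : I →₀ ℝ) :
    preInner k (c + c') d = preInner k c d + preInner k c' d := by
  classical
  unfold preInner
  split_ifs with h
  · rw [Finsupp.sum_add_index']
    · intro a; simp
    · intro a x y; simp [add_mul, Finsupp.sum, Finset.sum_add_distrib]
  · simp

lemma preInner_smul (r : ℝ) (c d : I →₀ ℝ) :
    preInner k (r • c) d = r * preInner k c d := by
  unfold preInner
  split_ifs with h
  · rw [Finsupp.sum_smul_index (by intro a; simp)]
    simp [Finsupp.sum, Finset.mul_sum, mul_assoc]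
  · simp

/-- The semi-inner product axioms. -/
@[reducible] def preCore : PreInnerProductSpace.Core ℝ (PreHilb k) where
  inner c d := preInner k c d
  conj_inner_symm c d := by simpa using preInner_comm k d c
  re_inner_nonneg c := by
    change 0 ≤ preInner k c c
    unfold preInner
    split_ifs with h
    · exact h.2 c
    · exact le_rfl
  add_left c c' d := preInner_add k c c' d
  smul_left c d r := preInner_smul k r c d

instance : SeminormedAddCommGroup (PreHilb k) :=
  @InnerProductSpace.Core.toSeminormedAddCommGroup ℝ (PreHilb k) _ _ _ (preCore k)

instance : InnerProductSpace ℝ (PreHilb k) := InnerProductSpace.ofCore (preCore k)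

/-- The Hilbert space generated by the kernel `k`: the completion of the formal linear combinations
of elements of `I` with respect to `⟨a, b⟩ = k(a,b)`. -/
abbrev KernelHilb : Type _ := UniformSpace.Completion (PreHilb k)

/-- The formal linear combination consisting of the single element `a` with coefficient `1`. -/
def preGen (a : I) : PreHilb k := Finsupp.single a (1 : ℝ)

/-- The generator of `KernelHilb k` attached to `a`. -/
def gen (a : I) : KernelHilb k := (preGen k a : UniformSpace.Completion (PreHilb k))

lemma inner_gen (hk : IsPSDKernel k) (a b : I) : inner ℝ (gen k a) (gen k b) = k a b := by
  unfold gen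
  rw [UniformSpace.Completion.inner_coe]
  change preInner k (Finsupp.single a 1) (Finsupp.single b 1) = _
  simp [preInner, hk]

end PreHilb

/-! ### Hilbert tensor powers -/

/-- The kernel `⟨h₁ ⊗ ⋯ ⊗ hₙ, g₁ ⊗ ⋯ ⊗ gₙ⟩ = ∏ ⟨hᵢ, gᵢ⟩` on elementary tensors. -/
def tensorKernel (V : Type*) [NormedAddCommGroup V] [InnerProductSpace ℝ V] (n : ℕ) :
    (Fin n → V) → (Fin n → V) → ℝ :=
  fun h g => ∏ i, inner ℝ (h i) (g i)

/-- The Hilbert space tensor power `V^{⊗n}`. -/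
abbrev TensorPow (V : Type*) [NormedAddCommGroup V] [InnerProductSpace ℝ V] (n : ℕ) : Type _ :=
  KernelHilb (tensorKernel V n)

/-- The elementary tensor `h₁ ⊗ ⋯ ⊗ hₙ`. -/
def tens {V : Type*} [NormedAddCommGroup V] [InnerProductSpace ℝ V] {n : ℕ} (h : Fin n → V) :
    TensorPow V n :=
  gen (tensorKernel V n) h

/-- `G` is a symmetric tensor, i.e. it is invariant under permutations of the `n` factors. -/
def IsSymmTensor {V : Type*} [NormedAddCommGroup V] [InnerProductSpace ℝ V] {n : ℕ}
    (G : TensorPow V n) : Prop :=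
  ∀ (σ : Equiv.Perm (Fin n)) (h : Fin n → V),
    inner ℝ (tens (h ∘ σ)) G = inner ℝ (tens h) G

/-! ### The noise -/

/-- `ℝ^d` with the Euclidean norm. -/
abbrev Sp (d : ℕ) : Type := EuclideanSpace ℝ (Fin d)

/-- The function `f` is the Fourier transform of the tempered measure `μ`, in the sense of tempered
distributions: `∫ f ψ dx = ∫ (∫ e^{-i ξ·x} ψ(x) dx) μ(dξ)`. Moreover `f` is uniformly locally
integrable. -/
structure IsSpatialKernel {d : ℕ} (f : Sp d → ℝ) (μ : Measure (Sp d)) : Prop where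
  locallyIntegrable : LocallyIntegrable f volume
  uniform : ∃ C : ℝ≥0, ∀ x, ∫⁻ y in Metric.ball x 1, ‖f y‖ₑ ≤ C
  tempered : μ.HasTemperateGrowth
  fourier : ∀ ψ : 𝓢(Sp d, ℂ),
    ∫ x, (f x : ℂ) * ψ x = ∫ ξ, (∫ x, Complex.exp (-Complex.I * (inner ℝ ξ x : ℝ)) * ψ x) ∂μ

/-- A pair `(t, A)`, which stands for the indicator function `1_{[0,t] × A}`, where `t ≥ 0` and `A`
is a bounded Borel set. -/
structure Rect (d : ℕ) where
  time : ℝ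
  time_nonneg : 0 ≤ time
  set : Set (Sp d)
  measurableSet : MeasurableSet set
  bounded : Bornology.IsBounded set

/-- The covariance `⟨1_{[0,t] × A}, 1_{[0,s] × B}⟩`, fractional in time with Hurst index `H > 1/2`,
or white in time if `H = 1/2`. -/
def rectCov {d : ℕ} (H : ℝ) (f : Sp d → ℝ) (a b : Rect d) : ℝ :=
  if H = 1 / 2 then min a.time b.time * ∫ x in a.set, ∫ y in b.set, f (x - y)
  else H * (2 * H - 1) * ∫ u in (0 : ℝ)..a.time, ∫ v in (0 : ℝ)..b.time,
    ∫ x in a.set, ∫ y in b.set, |u - v| ^ (2 * H - 2) * f (x - y)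

/-- The Hilbert space `HP`. -/
abbrev HP {d : ℕ} (H : ℝ) (f : Sp d → ℝ) : Type := KernelHilb (rectCov H f)

/-- `1_{[0,t] × A}` as an element of `HP`. -/
def ind {d : ℕ} (H : ℝ) (f : Sp d → ℝ) (a : Rect d) : HP H f := gen (rectCov H f) a

/-- The potential of `1_{[0,T] × A}` at `(s,y)`; the `HP`-inner product of a function `g` on
`ℝ₊ × ℝ^d` with `1_{[0,T] × A}` is `∫ g(s,y) pot(s,y) ds dy`. -/
def pot {d : ℕ} (H : ℝ) (f : Sp d → ℝ) (a : Rect d) (z : ℝ × Sp d) : ℝ :=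
  if H = 1 / 2 then (Set.Icc 0 a.time).indicator (fun _ => ∫ x in a.set, f (z.2 - x)) z.1
  else H * (2 * H - 1) * ∫ r in (0 : ℝ)..a.time, ∫ x in a.set,
    |z.1 - r| ^ (2 * H - 2) * f (z.2 - x)

/-- The function `g` on `(ℝ₊ × ℝ^d)^n` is (represents) the element `G` of `HP^{⊗n}`: the
`HP^{⊗n}`-inner products of `G` with the indicators of products of rectangles, which are total in
`HP^{⊗n}`, are given by the corresponding absolutely convergent integrals of `g`. -/
def Represents {d : ℕ} (H : ℝ) (f : Sp d → ℝ) {n : ℕ} (g : (Fin n → ℝ × Sp d) → ℝ)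
    (G : TensorPow (HP H f) n) : Prop :=
  ∀ a : Fin n → Rect d,
    IntegrableOn (fun z => g z * ∏ i, pot H f (a i) (z i)) {z | ∀ i, 0 ≤ (z i).1} ∧
    inner ℝ (tens fun i => ind H f (a i)) G =
      ∫ z in {z : Fin n → ℝ × Sp d | ∀ i, 0 ≤ (z i).1}, g z * ∏ i, pot H f (a i) (z i)

open Classical in
/-- The element of `HP^{⊗n}` represented by the function `g` (zero if there is none). -/
def toTensor {d : ℕ} (H : ℝ) (f : Sp d → ℝ) {n : ℕ} (g : (Fin n → ℝ × Sp d) → ℝ) :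
    TensorPow (HP H f) n :=
  if h : ∃ G, Represents H f g G then h.choose else 0

open Classical in
/-- `‖g‖²` in `HP^{⊗n}`, which is `∞` if the function `g` does not belong to `HP^{⊗n}`. -/
def tensorNormSq {d : ℕ} (H : ℝ) (f : Sp d → ℝ) {n : ℕ} (g : (Fin n → ℝ × Sp d) → ℝ) : ℝ≥0∞ :=
  if ∃ G, Represents H f g G then ‖toTensor H f g‖ₑ ^ 2 else ∞

/-- `W = {W(h); h ∈ V}` is a centered Gaussian process with `E[W(h) W(g)] = ⟨h, g⟩`. -/
structure IsIsonormal {V : Type*} [NormedAddCommGroup V] [InnerProductSpace ℝ V]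
    {Ω : Type*} [MeasurableSpace Ω] (P : Measure Ω) (W : V → Ω → ℝ) : Prop where
  measurable : ∀ h, Measurable (W h)
  gaussian : IsGaussianProcess W P
  centered : ∀ h, ∫ ω, W h ω ∂P = 0
  covariance : ∀ h g, ∫ ω, W h ω * W g ω ∂P = inner ℝ h g

/-! ### Multiple Wiener integrals -/

section Wiener

variable {V : Type*} [NormedAddCommGroup V] [InnerProductSpace ℝ V]
  {Ω : Type*} [MeasurableSpace Ω]

open Classical in
/-- The class in `L²(Ω)` of a square integrable random variable (zero if not square integrable). -/
def toL2 (P : Measure Ω) (X : Ω → ℝ) : Lp ℝ 2 P :=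
  if h : MemLp X 2 P then h.toLp X else 0

/-- `I_n(h^{⊗n}) = ‖h‖^n He_n(W(h) / ‖h‖)`, where `He_n` is the monic Hermite polynomial. -/
def wienerDiag (W : V → Ω → ℝ) (n : ℕ) (h : V) (ω : Ω) : ℝ :=
  ‖h‖ ^ n * Polynomial.aeval (W h ω / ‖h‖) (Polynomial.hermite n)

/-- `I_n(h₁ ⊗ ⋯ ⊗ hₙ)`, by polarization:
`(2ⁿ n!)⁻¹ ∑_{ε ∈ {±1}ⁿ} ε₁ ⋯ εₙ I_n((ε₁ h₁ + ⋯ + εₙ hₙ)^{⊗n})`. -/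
def wienerElem (W : V → Ω → ℝ) {n : ℕ} (h : Fin n → V) (ω : Ω) : ℝ :=
  ((2 : ℝ) ^ n * (n ! : ℝ))⁻¹ * ∑ ε : Fin n → ℤˣ,
    (∏ i, ((ε i : ℤ) : ℝ)) * wienerDiag W n (∑ i, ((ε i : ℤ) : ℝ) • h i) ω

/-- The multiple Wiener integral `I_n : V^{⊗n} → L²(Ω)`: the extension of `wienerElem` by linearity
and continuity. -/
def wienerInt (P : Measure Ω) (W : V → Ω → ℝ) (n : ℕ) : TensorPow V n → Lp ℝ 2 P :=
  UniformSpace.Completion.extension fun c : PreHilb (tensorKernel V n) =>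
    Finsupp.sum (show (Fin n → V) →₀ ℝ from c) fun h x => x • toL2 P (wienerElem W h)

end Wiener

/-! ### The Skorohod integral -/

section Skorohod

variable {d : ℕ} (H : ℝ) (f : Sp d → ℝ) {Ω : Type*} [MeasurableSpace Ω]

/-- `G` is the symmetrization in all `n + 1` variables of the (generalized) function
`(z₁, …, zₙ, (s,y)) ↦ g(s,y)(z₁, …, zₙ)`, each `g(s,y)` being symmetric; that is
`G(z₀, …, zₙ) = (n+1)⁻¹ ∑ᵢ g(zᵢ)(z₀, …, zᵢ₋₁, zᵢ₊₁, …, zₙ)`, as elements of `HP^{⊗(n+1)}`. -/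
def IsSymmetrization {n : ℕ} (g : ℝ → Sp d → TensorPow (HP H f) n)
    (G : TensorPow (HP H f) (n + 1)) : Prop :=
  ∀ a : Fin (n + 1) → Rect d,
    (∀ i, IntegrableOn (fun z : ℝ × Sp d =>
      inner ℝ (tens fun j => ind H f (a (i.succAbove j))) (g z.1 z.2) * pot H f (a i) z)
        {z | 0 ≤ z.1}) ∧
    inner ℝ (tens fun i => ind H f (a i)) G =
      ((n : ℝ) + 1)⁻¹ * ∑ i, ∫ z in {z : ℝ × Sp d | 0 ≤ z.1},
        inner ℝ (tens fun j => ind H f (a (i.succAbove j))) (g z.1 z.2) * pot H f (a i) z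

/-- The process `Y = {Y_{s,y}; s ≥ 0, y ∈ ℝ^d}` is integrable with respect to `W` and its Skorohod
integral is `Z`: with the chaos expansions `Y_{s,y} = ∑ I_n(g_n(·,s,y))` (symmetric kernels), the
symmetrizations `G_n` of `g_n` in all `n + 1` variables belong to `HP^{⊗(n+1)}`, and
`Z = ∑ I_{n+1}(G_n)` in `L²(Ω)`. -/
def HasSkorohodIntegral (P : Measure Ω) (W : HP H f → Ω → ℝ) (Y : ℝ → Sp d → Ω → ℝ)
    (Z : Lp ℝ 2 P) : Prop :=
  ∃ (g : ∀ n : ℕ, ℝ → Sp d → TensorPow (HP H f) n) (G : ∀ n : ℕ, TensorPow (HP H f) (n + 1)),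
    (∀ s y, 0 ≤ s →
      MemLp (Y s y) 2 P ∧
      (∀ n, IsSymmTensor (g n s y)) ∧
      HasSum (fun n => wienerInt P W n (g n s y)) (toL2 P (Y s y))) ∧
    (∀ n, IsSymmetrization H f (g n) (G n)) ∧
    HasSum (fun n => wienerInt P W (n + 1) (G n)) Z

end Skorohod

/-! ### The stochastic heat equation -/

/-- The heat kernel `p_t(x) = (2πt)^{-d/2} exp(-|x|²/(2t))`, `t > 0` (zero for `t ≤ 0`). -/
def heatKernel {d : ℕ} (t : ℝ) (x : Sp d) : ℝ :=
  if 0 < t then (2 * Real.pi * t) ^ (-(d : ℝ) / 2) * Real.exp (-‖x‖ ^ 2 / (2 * t)) else 0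

/-- `p_t ψ(x) = ∫ p_t(x-y) ψ(y) dy` for `t > 0`, and `p_0 ψ = ψ`. -/
def heatSemigroup {d : ℕ} (t : ℝ) (ψ : Sp d → ℝ) (x : Sp d) : ℝ :=
  if t = 0 then ψ x else ∫ y, heatKernel t (x - y) * ψ y

open Classical in
/-- `f_n(t₁,x₁,…,tₙ,xₙ,t,x) = (n!)⁻¹ ∏ⱼ p_{t_{ρ(j+1)} - t_{ρ(j)}}(x_{ρ(j+1)} - x_{ρ(j)})
p_{t_{ρ(1)}} u₀(x_{ρ(1)})`, where `ρ` is the permutation with `0 < t_{ρ(1)} < ⋯ < t_{ρ(n)} < t` and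
`t_{ρ(n+1)} = t`, `x_{ρ(n+1)} = x`; it is `0` if there is no such `ρ`. (At most one `ρ` contributes
to the sum; with indices from `0`, `τ` and `ξ` are the reordered times and points.) -/
def chaosKernel {d : ℕ} (u₀ : Sp d → ℝ) (n : ℕ) (t : ℝ) (x : Sp d) (z : Fin n → ℝ × Sp d) : ℝ :=
  (n ! : ℝ)⁻¹ * ∑ ρ : Equiv.Perm (Fin n),
    let τ : Fin (n + 1) → ℝ := Fin.snoc (fun j => (z (ρ j)).1) t
    let ξ : Fin (n + 1) → Sp d := Fin.snoc (fun j => (z (ρ j)).2) x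
    if (∀ j, 0 < (z j).1) ∧ StrictMono τ then
      (∏ j : Fin n, heatKernel (τ j.succ - τ j.castSucc) (ξ j.succ - ξ j.castSucc)) *
        heatSemigroup (τ 0) u₀ (ξ 0)
    else 0

section Equation

variable {d : ℕ} (H : ℝ) (f : Sp d → ℝ) {Ω : Type*} [MeasurableSpace Ω]

/-- `F_t = σ(W(1_{[0,s] × A}); s ∈ [0,t], A bounded Borel)`. -/
@[reducible] def noiseFiltration (W : HP H f → Ω → ℝ) (t : ℝ) : MeasurableSpace Ω :=
  ⨆ (a : Rect d) (_ : a.time ≤ t), MeasurableSpace.comap (W (ind H f a)) inferInstance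

open Classical in
/-- `Y^{t,x}_{s,y} = 1_{[0,t]}(s) p_{t-s}(x-y) u_{s,y}`. -/
def mildIntegrand (u : ℝ → Sp d → Ω → ℝ) (t : ℝ) (x : Sp d) (s : ℝ) (y : Sp d) (ω : Ω) : ℝ :=
  if s ∈ Set.Icc 0 t then heatKernel (t - s) (x - y) * u s y ω else 0

/-- `u = {u_{t,x}; t ≥ 0, x ∈ ℝ^d}` is a (mild, Skorohod) solution of
`∂u/∂t = ½ Δu + u Ẇ`, `u_{0,x} = u₀(x)`. Values of `u` at negative times play no role. -/
structure IsMildSolution (P : Measure Ω) (W : HP H f → Ω → ℝ) (u₀ : Sp d → ℝ)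
    (u : ℝ → Sp d → Ω → ℝ) : Prop where
  adapted : ∀ t x, 0 ≤ t → Measurable[noiseFiltration H f W t] (u t x)
  squareIntegrable : ∀ t x, 0 ≤ t → MemLp (u t x) 2 P
  equation : ∀ t x, 0 ≤ t → ∃ Z : Lp ℝ 2 P,
    HasSkorohodIntegral H f P W (mildIntegrand u t x) Z ∧
      ∀ᵐ ω ∂P, u t x ω = heatSemigroup t u₀ x + Z ω

end Equation

end StochHeat

end

open StochHeat

noncomputable section

namespace StochHeat

/-! ### Positive semidefinite kernels -/

section Kernels

variable {I J : Type*}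

/-! The mild equation is a triangular recursion for chaos kernels. If `u` is a solution, the zeroth
kernel of `u_{t,x}` is the heat semigroup applied to the initial condition, and its kernel of order
`n + 1` is the symmetrization of `p_{t-s}(x-y)` times the kernel of order `n` of `u_{s,y}`. The
functions `f_n` obey the same recursion (`chaosKernel_succ`): choose which of the `n + 1` points
carries the latest time. With Fubini this becomes `IsSpatialKernel.isSymmetrization_iff`, and, chaos
expansions with symmetric kernels being unique (`IsIsonormal.chaos_unique`), induction on `n` shows
that every solution has the kernels `f_n` (`IsMildSolution.exists_expansion`). The isometry
`E|I_n(G)|² = n! ‖G‖²` for symmetric `G` and the orthogonality of different chaoses then give the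
moment formula, the convergence of the series and uniqueness.

The isometry rests on Gaussian integration by parts, which yields `E[I_n(h^{⊗n}) I_n(g^{⊗n})] = n!
⟨h,g⟩^n`, followed by polarization. All inner products also presuppose that the covariance of the
noise is positive semidefinite. It is a time covariance times a space covariance, so Schur's product
theorem applies; the first factor is handled by a spectral integral for `|x|^{2H}`, the second by
the hypothesis that `f` is a Fourier transform of a measure.

Conversely, if the series of norms converges, `∑ I_n(f_n)` converges in `L²` by orthogonality, and
the recursion read backwards shows that its sum solves the equation. What remains is adaptedness:
`I_n(G)` must be measurable for the noise up to time `t` when `G` is represented by `f_n(·,t,x)`.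
Although `f_n` is supported in times below `t`, `G` is an abstract element of a completion known
only through its pairings with rectangles, so cutting it off in time is not available. Instead
`IsSpatialKernel.inner_eq_zero_of_represents` shows that `G` is orthogonal to every `v` that is
orthogonal to the products of rectangles up to time `t`.

For that, the potentials of rectangles are averaged over time contractions by factors in `[1-ε,1]`
and space translations in a ball of radius `ε`. The resulting functional `Φ_ε` on combinations `c`
of rectangles has three properties. It is bounded by `2^n ‖c‖ ‖G‖` uniformly in `ε`, because
scalings and translations act boundedly on the noise. It is bounded by `C_ε ‖c - v‖`, because an
averaged potential is the inner product with a normalized increment supported before time `t`, which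
does not see `v`. And `Φ_ε(c) → ⟨c, G⟩` as `ε → 0`, by Lebesgue differentiation. Approximating `v`
at fixed `ε` upgrades the first two bounds to `|Φ_ε(c)| ≤ 2^n ‖c - v‖ ‖G‖`; then `ε → 0` and `c → v`
give `⟨v, G⟩ = 0`. -/

lemma isPSDKernel_iff (k : I → I → ℝ) : IsPSDKernel k ↔ (Matrix.of k).PosSemidef := by
  unfold IsPSDKernel Matrix.PosSemidef
  refine and_congr ?_ ?_
  · rw [Matrix.IsHermitian.ext_iff]
    simp only [Matrix.of_apply, star_trivial]
    exact ⟨fun h i j => h j i, fun h i j => h j i⟩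
  · refine forall_congr' fun c => ?_
    simp only [Finsupp.sum, Matrix.of_apply, star_trivial]
    have : ∀ x y, c x * (c y * k x y) = c x * k x y * c y := fun x y => by ring
    simp only [this]

/-- Schur's product theorem. It is used for the tensor kernels and for the splitting of the noise
covariance into time and space. -/
lemma IsPSDKernel.mul {k l : I → I → ℝ} (hk : IsPSDKernel k) (hl : IsPSDKernel l) :
    IsPSDKernel fun a b => k a b * l a b := by
  rw [isPSDKernel_iff] at *
  exact hk.hadamard hl

lemma IsPSDKernel.smul {k : I → I → ℝ} (hk : IsPSDKernel k) {r : ℝ} (hr : 0 ≤ r) :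
    IsPSDKernel fun a b => r * k a b := by
  rw [isPSDKernel_iff] at *
  exact hk.smul hr

lemma isPSDKernel_one : IsPSDKernel fun _ _ : I => (1 : ℝ) := by
  refine ⟨fun _ _ => rfl, fun c => ?_⟩
  simp only [Finsupp.sum, mul_one, ← Finset.mul_sum, ← Finset.sum_mul]
  exact mul_self_nonneg _

lemma IsPSDKernel.comap {k : I → I → ℝ} (hk : IsPSDKernel k) (e : J → I) :
    IsPSDKernel fun a b => k (e a) (e b) := by
  rw [isPSDKernel_iff] at *
  exact hk.submatrix e

lemma IsPSDKernel.prod {ι : Type*} (s : Finset ι) {k : ι → I → I → ℝ}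
    (hk : ∀ i ∈ s, IsPSDKernel (k i)) : IsPSDKernel fun a b => ∏ i ∈ s, k i a b := by
  classical
  induction s using Finset.induction_on with
  | empty => simpa using isPSDKernel_one
  | insert i s hi ih =>
    simp only [Finset.prod_insert hi]
    exact (hk i (by simp)).mul (ih fun j hj => hk j (by simp [hj]))

lemma isPSDKernel_inner {E : Type*} [NormedAddCommGroup E] [InnerProductSpace ℝ E] :
    IsPSDKernel fun a b : E => inner ℝ a b := by
  refine ⟨fun a b => real_inner_comm b a, fun c => ?_⟩
  have : 0 ≤ inner ℝ (∑ a ∈ c.support, c a • a) (∑ a ∈ c.support, c a • a) :=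
    real_inner_self_nonneg
  simp only [sum_inner, inner_sum, real_inner_smul_left, real_inner_smul_right] at this
  rw [Finset.sum_comm] at this
  exact this.trans_eq (Finset.sum_congr rfl fun a _ => Finset.sum_congr rfl fun b _ => by
    change _ = c a * (c b * inner ℝ a b)
    ring)

lemma isPSDKernel_tensorKernel (V : Type*) [NormedAddCommGroup V] [InnerProductSpace ℝ V] (n : ℕ) :
    IsPSDKernel (tensorKernel V n) :=
  IsPSDKernel.prod _ fun i _ =>
    IsPSDKernel.comap (isPSDKernel_inner (E := V)) fun h : Fin n → V => h i

variable (k : I → I → ℝ)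

/-- The linear combination `∑ c_a gen(a)`. -/
abbrev lincomb (c : I →₀ ℝ) : KernelHilb k := Finsupp.linearCombination ℝ (gen k) c

variable {k} in
/-- The coefficients of a formal linear combination. -/
def PreHilb.coeffs (c : PreHilb k) : I →₀ ℝ := c

lemma coe_preHilb (c : PreHilb k) : (c : KernelHilb k) = lincomb k c.coeffs := by
  have h : c = ∑ a ∈ c.coeffs.support, c.coeffs a • preGen k a := by
    refine (Finsupp.sum_single c.coeffs).symm.trans ?_
    refine Finset.sum_congr rfl fun a _ => ?_
    change _ = c.coeffs a • (Finsupp.single a (1 : ℝ) : I →₀ ℝ)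
    simp
  conv_lhs => rw [h]
  change UniformSpace.Completion.toComplL (𝕜 := ℝ) _ = _
  rw [map_sum]
  refine Eq.trans ?_ (Finsupp.linearCombination_apply ℝ c.coeffs).symm
  refine Finset.sum_congr rfl fun a _ => ?_
  rw [map_smul]; rfl

lemma denseRange_lincomb : DenseRange (lincomb k) := by
  refine UniformSpace.Completion.denseRange_coe.mono ?_
  rintro _ ⟨c, rfl⟩
  exact ⟨c.coeffs, (coe_preHilb k c).symm⟩

variable {k}

/-- Two elements with the same inner products against the generators coincide. -/
lemma ext_inner_gen {F G : KernelHilb k} (h : ∀ a, inner ℝ (gen k a) F = inner ℝ (gen k a) G) :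
    F = G := by
  refine ext_inner_left ℝ fun v => ?_
  refine (denseRange_lincomb k).induction_on (p := fun v => inner ℝ v F = inner ℝ v G) v
    (isClosed_eq (by fun_prop) (by fun_prop)) fun c => ?_
  simp [lincomb, Finsupp.linearCombination_apply, Finsupp.sum, sum_inner, real_inner_smul_left, h]

lemma norm_sq_linearCombination {E : Type*} [NormedAddCommGroup E] [InnerProductSpace ℝ E]
    (X : I → E) (c : I →₀ ℝ) : ‖Finsupp.linearCombination ℝ X c‖ ^ 2 =
      ∑ a ∈ c.support, ∑ b ∈ c.support, c a * (c b * inner ℝ (X a) (X b)) := by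
  rw [← real_inner_self_eq_norm_sq]
  simp only [Finsupp.linearCombination_apply, Finsupp.sum, sum_inner, inner_sum,
    real_inner_smul_left, real_inner_smul_right]
  rw [Finset.sum_comm]
  exact Finset.sum_congr rfl fun a _ => Finset.sum_congr rfl fun b _ => by ring

section Lift

variable {E : Type*} [NormedAddCommGroup E] [NormedSpace ℝ E] [CompleteSpace E]

variable (k) in
/-- The continuous linear extension of a map defined on the generators. -/
def kernelLift (X : I → E) : KernelHilb k →L[ℝ] E :=
  (Finsupp.linearCombination ℝ X).extendOfNorm (Finsupp.linearCombination ℝ (gen k))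

/-- The bound `h` does two jobs: combinations of seminorm zero must go to zero, so that the map
descends to the completion, and the descended map must be continuous. -/
lemma kernelLift_lincomb {X : I → E} {C : ℝ}
    (h : ∀ c, ‖Finsupp.linearCombination ℝ X c‖ ≤ C * ‖lincomb k c‖) (c : I →₀ ℝ) :
    kernelLift k X (lincomb k c) = Finsupp.linearCombination ℝ X c :=
  LinearMap.extendOfNorm_eq (denseRange_lincomb k) ⟨C, h⟩ c

lemma kernelLift_gen {X : I → E} {C : ℝ}
    (h : ∀ c, ‖Finsupp.linearCombination ℝ X c‖ ≤ C * ‖lincomb k c‖) (a : I) :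
    kernelLift k X (gen k a) = X a := by
  have := kernelLift_lincomb h (Finsupp.single a 1)
  simpa [lincomb] using this

/-- `UniformSpace.Completion.extension` is meaningful only for uniformly continuous maps. The norm
bound supplies this, and it lets `wienerInt` be handled as a continuous linear map. -/
lemma kernelLift_eq_extension {X : I → E} {C : ℝ}
    (h : ∀ c, ‖Finsupp.linearCombination ℝ X c‖ ≤ C * ‖lincomb k c‖) :
    ⇑(kernelLift k X) = UniformSpace.Completion.extension fun c : PreHilb k =>
      Finsupp.sum (show I →₀ ℝ from c) fun a x => x • X a := by
  have e : ∀ c : PreHilb k, Finsupp.sum (show I →₀ ℝ from c) (fun a x => x • X a) =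
      kernelLift k X (c : KernelHilb k) := fun c => by
    rw [coe_preHilb]
    exact (kernelLift_lincomb h c.coeffs).symm
  symm
  refine UniformSpace.Completion.extension_unique ?_ (kernelLift k X).uniformContinuous e
  simp_rw [e]
  exact (kernelLift k X).uniformContinuous.comp (UniformSpace.Completion.uniformContinuous_coe _)

end Lift

end Kernels

/-! ### Elementary tensors -/

section Tensors

variable {V : Type*} [NormedAddCommGroup V] [InnerProductSpace ℝ V] {n : ℕ}

lemma inner_tens (h g : Fin n → V) : inner ℝ (tens h) (tens g) = ∏ i, inner ℝ (h i) (g i) :=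
  inner_gen _ (isPSDKernel_tensorKernel V n) h g

lemma norm_tens (h : Fin n → V) : ‖tens h‖ = ∏ i, ‖h i‖ := by
  have h1 : ‖tens h‖ ^ 2 = (∏ i, ‖h i‖) ^ 2 := by
    rw [← real_inner_self_eq_norm_sq, inner_tens, ← Finset.prod_pow]
    simp
  exact (sq_eq_sq₀ (norm_nonneg _) (Finset.prod_nonneg fun _ _ => norm_nonneg _)).1 h1

lemma prod_update_inner [DecidableEq (Fin n)] (h g : Fin n → V) (i : Fin n) (x : V) :
    ∏ j, inner ℝ (g j) (Function.update h i x j) =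
      inner ℝ (g i) x * ∏ j ∈ Finset.univ.erase i, inner ℝ (g j) (h j) := by
  rw [← Finset.mul_prod_erase _ _ (Finset.mem_univ i)]
  simp only [Function.update_self]
  congr 1
  refine Finset.prod_congr rfl fun j hj => ?_
  rw [Function.update_of_ne (Finset.ne_of_mem_erase hj)]

/-- `tens` as a multilinear map. -/
def tensMultilinear (V : Type*) [NormedAddCommGroup V] [InnerProductSpace ℝ V] (n : ℕ) :
    MultilinearMap ℝ (fun _ : Fin n => V) (TensorPow V n) where
  toFun := tens
  map_update_add' h i x y := by
    refine ext_inner_gen fun g => ?_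
    change inner ℝ (tens g) _ = inner ℝ (tens g) _
    rw [inner_add_right, inner_tens, inner_tens, inner_tens]
    simp only [prod_update_inner, inner_add_right, add_mul]
  map_update_smul' h i r x := by
    refine ext_inner_gen fun g => ?_
    change inner ℝ (tens g) _ = inner ℝ (tens g) _
    rw [real_inner_smul_right, inner_tens, inner_tens]
    simp only [prod_update_inner, real_inner_smul_right, mul_assoc]

/-- `tens` as a continuous multilinear map. -/
def tensL (V : Type*) [NormedAddCommGroup V] [InnerProductSpace ℝ V] (n : ℕ) :
    ContinuousMultilinearMap ℝ (fun _ : Fin n => V) (TensorPow V n) :=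
  (tensMultilinear V n).mkContinuous 1 fun h => by
    rw [one_mul]; exact (norm_tens h).le

@[simp] lemma tensL_apply (h : Fin n → V) : tensL V n h = tens h := rfl

/-- Tensors of generators of `V` are total in `V^{⊗n}`. -/
lemma ext_inner_tens_gen {I : Type*} {k : I → I → ℝ} {F G : TensorPow (KernelHilb k) n}
    (h : ∀ a : Fin n → I, inner ℝ (tens fun i => gen k (a i)) F =
      inner ℝ (tens fun i => gen k (a i)) G) : F = G := by
  classical
  -- The set `s` collects the slots already allowed to hold arbitrary vectors. A slot is freed by
  -- density of the combinations of generators, with multilinearity reducing to a single generator.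
  have key : ∀ s : Finset (Fin n), ∀ v : Fin n → KernelHilb k,
      (∀ i ∉ s, v i ∈ Set.range (gen k)) → inner ℝ (tens v) F = inner ℝ (tens v) G := by
    intro s
    induction s using Finset.induction_on with
    | empty =>
      intro v hv
      choose a ha using fun i => hv i (by simp)
      obtain rfl : (fun i => gen k (a i)) = v := funext ha
      exact h a
    | insert i s hi ih =>
      intro v hv
      have : ∀ x, inner ℝ (tens (Function.update v i x)) F =
          inner ℝ (tens (Function.update v i x)) G := by
        intro x
        refine (denseRange_lincomb k).induction_on (p := fun x =>
          inner ℝ (tens (Function.update v i x)) F = inner ℝ (tens (Function.update v i x)) G) x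
          (isClosed_eq ?_ ?_) fun c => ?_
        · simp_rw [← tensL_apply]; fun_prop
        · simp_rw [← tensL_apply]; fun_prop
        · have e : ∀ x, tens (Function.update v i x) = (tensMultilinear _ n).toLinearMap v i x :=
            fun x => rfl
          rw [e, lincomb, Finsupp.linearCombination_apply, Finsupp.sum, map_sum, sum_inner,
            sum_inner]
          refine Finset.sum_congr rfl fun a _ => ?_
          rw [map_smul, real_inner_smul_left, real_inner_smul_left, ← e]
          congr 1
          refine ih _ fun j hj => ?_
          by_cases hji : j = i
          · subst hji; simp
          · rw [Function.update_of_ne hji]; exact hv j (by simp [hji, hj])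
      simpa using this (v i)
  exact ext_inner_gen fun v => key Finset.univ v (by simp)

/-- The linear map `h₁ ⊗ ⋯ ⊗ hₙ ↦ h_{σ 1} ⊗ ⋯ ⊗ h_{σ n}`. -/
def permTensor (σ : Equiv.Perm (Fin n)) : TensorPow V n →L[ℝ] TensorPow V n :=
  kernelLift (tensorKernel V n) fun h => tens (h ∘ σ)

lemma inner_tens_comp (σ : Equiv.Perm (Fin n)) (h g : Fin n → V) :
    inner ℝ (tens (h ∘ σ)) (tens (g ∘ σ)) = inner ℝ (tens h) (tens g) := by
  rw [inner_tens, inner_tens]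
  exact Equiv.prod_comp σ fun i => inner ℝ (h i) (g i)

lemma permTensor_tens (σ : Equiv.Perm (Fin n)) (h : Fin n → V) :
    permTensor σ (tens h) = tens (h ∘ σ) := by
  refine kernelLift_gen (k := tensorKernel V n) (C := 1) (fun c => ?_) h
  rw [one_mul]
  refine le_of_sq_le_sq ?_ (norm_nonneg _) |> fun h => h
  rw [norm_sq_linearCombination, norm_sq_linearCombination]
  simp only [inner_tens_comp]
  exact le_rfl

/-- Permuting both arguments of an elementary inner product only reindexes a finite product, so
permutations act unitarily; density does the rest. -/
lemma inner_permTensor (σ : Equiv.Perm (Fin n)) (F G : TensorPow V n) :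
    inner ℝ (permTensor σ F) G = inner ℝ F (permTensor σ⁻¹ G) := by
  refine (denseRange_lincomb (tensorKernel V n)).induction_on (p := fun F =>
    inner ℝ (permTensor σ F) G = inner ℝ F (permTensor σ⁻¹ G)) F
    (isClosed_eq (by fun_prop) (by fun_prop)) fun c => ?_
  refine (denseRange_lincomb (tensorKernel V n)).induction_on (p := fun G =>
    inner ℝ (permTensor σ _) G = inner ℝ _ (permTensor σ⁻¹ G)) G
    (isClosed_eq (by fun_prop) (by fun_prop)) fun d => ?_
  simp only [lincomb, Finsupp.linearCombination_apply, Finsupp.sum, map_sum, map_smul, sum_inner,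
    inner_sum, real_inner_smul_left, real_inner_smul_right]
  refine Finset.sum_congr rfl fun a _ => Finset.sum_congr rfl fun b _ => ?_
  change _ * (_ * inner ℝ (permTensor σ (tens b)) (tens a)) =
    _ * (_ * inner ℝ (tens b) (permTensor σ⁻¹ (tens a)))
  rw [permTensor_tens, permTensor_tens, ← inner_tens_comp σ b (a ∘ ⇑σ⁻¹)]
  congr 4
  ext i; simp

lemma isSymmTensor_iff (G : TensorPow V n) :
    IsSymmTensor G ↔ ∀ σ : Equiv.Perm (Fin n), permTensor σ G = G := by
  constructor
  · intro h σ
    refine ext_inner_gen fun g => ?_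
    change inner ℝ (tens g) _ = inner ℝ (tens g) _
    rw [← h σ⁻¹ g, ← permTensor_tens, inner_permTensor, inv_inv]
  · intro h σ g
    rw [← permTensor_tens, inner_permTensor, h]

/-- Symmetry need only be tested on tensors of generators, which is where a representing function
gives information. -/
lemma isSymmTensor_of_gen {I : Type*} {k : I → I → ℝ} {G : TensorPow (KernelHilb k) n}
    (h : ∀ (σ : Equiv.Perm (Fin n)) (a : Fin n → I),
      inner ℝ (tens fun i => gen k (a (σ i))) G = inner ℝ (tens fun i => gen k (a i)) G) :
    IsSymmTensor G := by
  rw [isSymmTensor_iff]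
  intro σ
  refine ext_inner_tens_gen fun a => ?_
  rw [← h σ⁻¹ a, real_inner_comm, inner_permTensor, real_inner_comm, permTensor_tens]
  rfl

lemma IsSymmTensor.smul {G : TensorPow V n} (h : IsSymmTensor G) (r : ℝ) :
    IsSymmTensor (r • G) := fun σ g => by
  rw [real_inner_smul_right, real_inner_smul_right, h σ g]

lemma IsSymmTensor.sub {F G : TensorPow V n} (hF : IsSymmTensor F) (hG : IsSymmTensor G) :
    IsSymmTensor (F - G) := fun σ g => by
  rw [inner_sub_right, inner_sub_right, hF σ g, hG σ g]

end Tensors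

/-! ### Gaussian integration by parts -/

section GaussianIBP

open Polynomial

/-- Hölder with both exponents `2p`: having moments of all orders is stable under products, hence
under polynomials. -/
lemma memLp_mul_of_forall {Ω : Type*} [MeasurableSpace Ω] {P : Measure Ω} {X Y : Ω → ℝ}
    (hX : ∀ p : ℝ≥0, MemLp X p P) (hY : ∀ p : ℝ≥0, MemLp Y p P) (p : ℝ≥0) :
    MemLp (fun ω => X ω * Y ω) p P := by
  have : ENNReal.HolderTriple ((2 * p : ℝ≥0) : ℝ≥0∞) ((2 * p : ℝ≥0) : ℝ≥0∞) (p : ℝ≥0∞) := by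
    constructor
    rw [ENNReal.coe_mul, ENNReal.mul_inv (by simp) (by simp), ← add_mul]
    simp [ENNReal.inv_two_add_inv_two]
  exact (hY (2 * p)).mul (hX (2 * p))

lemma memLp_polynomial_eval {Ω : Type*} [MeasurableSpace Ω] {P : Measure Ω} [IsFiniteMeasure P]
    {X : Ω → ℝ} (hX : ∀ p : ℝ≥0, MemLp X p P) (q : ℝ[X]) (p : ℝ≥0) :
    MemLp (fun ω => q.eval (X ω)) p P := by
  induction q using Polynomial.induction_on' generalizing p with
  | add q r hq hr =>
    simp only [eval_add]
    exact (hq p).add (hr p)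
  | monomial n a =>
    simp only [eval_monomial]
    refine MemLp.const_mul ?_ a
    induction n generalizing p with
    | zero => simpa using memLp_const (1 : ℝ)
    | succ n ih =>
      simp only [pow_succ]
      exact memLp_mul_of_forall ih hX p

lemma integrable_polynomial_mul {Ω : Type*} [MeasurableSpace Ω] {P : Measure Ω}
    [IsFiniteMeasure P] {X Y : Ω → ℝ} (hX : ∀ p : ℝ≥0, MemLp X p P) (hY : ∀ p : ℝ≥0, MemLp Y p P)
    (q r : ℝ[X]) : Integrable (fun ω => q.eval (X ω) * r.eval (Y ω)) P :=
  memLp_one_iff_integrable.1 <| by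
    simpa using memLp_mul_of_forall (memLp_polynomial_eval hX q) (memLp_polynomial_eval hY r) 1

/-- Stein's identity: the density satisfies `φ' = -(x/v) φ`, so this is integration by parts on the
line. For `v = 0` the law is a point mass at the origin and both sides vanish. -/
lemma integral_id_mul_polynomial_gaussianReal (v : ℝ≥0) (q : ℝ[X]) :
    ∫ x, x * q.eval x ∂(gaussianReal 0 v) = v * ∫ x, (derivative q).eval x ∂(gaussianReal 0 v) := by
  by_cases hv : v = 0
  · subst hv
    simp [gaussianReal_zero_var]
  have hint : ∀ r : ℝ[X], Integrable (fun x => r.eval x * gaussianPDFReal 0 v x) := by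
    intro r
    have h1 : Integrable (fun x => r.eval x) (gaussianReal 0 v) :=
      memLp_one_iff_integrable.1 <| by
        simpa using memLp_polynomial_eval (P := gaussianReal 0 v) (X := id)
          (fun p => memLp_id_gaussianReal p) r 1
    rw [gaussianReal_of_var_ne_zero _ hv, integrable_withDensity_iff (measurable_gaussianPDF _ _)
      (by simp [gaussianPDF])] at h1
    simpa [toReal_gaussianPDF] using h1
  have hpdf : ∀ x, HasDerivAt (gaussianPDFReal 0 v) (-(x / v) * gaussianPDFReal 0 v x) x := by
    intro x
    have h1 : HasDerivAt (fun x : ℝ => -x ^ 2 / (2 * v)) (-(x / v)) x := by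
      refine ((hasDerivAt_pow 2 x).neg.div_const (2 * (v : ℝ))).congr_deriv ?_
      simp
      field_simp
    have h2 : gaussianPDFReal 0 v = fun x => (√(2 * Real.pi * v))⁻¹ * Real.exp (-x ^ 2 / (2 * v)) := by
      ext x; simp [gaussianPDFReal]
    rw [h2]
    refine (h1.exp.const_mul ((√(2 * Real.pi * v))⁻¹)).congr_deriv ?_
    ring
  have hvr : (v : ℝ) ≠ 0 := by exact_mod_cast hv
  have key := integral_mul_deriv_eq_deriv_mul_of_integrable
    (u := fun x => q.eval x) (u' := fun x => (derivative q).eval x)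
    (v := gaussianPDFReal 0 v) (v' := fun x => -(x / v) * gaussianPDFReal 0 v x)
    (fun x _ => q.hasDerivAt x) (fun x _ => hpdf x) ?_ (hint _) (hint _)
  · rw [integral_gaussianReal_eq_integral_smul hv, integral_gaussianReal_eq_integral_smul hv]
    simp only [smul_eq_mul]
    have e1 : ∫ x, gaussianPDFReal 0 v x * (x * q.eval x) =
        -v * ∫ x, q.eval x * (-(x / v) * gaussianPDFReal 0 v x) := by
      rw [← integral_const_mul]
      congr 1 with x
      field_simp
    rw [e1, key]
    simp only [mul_comm]
    ring
  · have := (hint (X * q)).const_mul (-(v : ℝ)⁻¹)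
    refine this.congr (Filter.Eventually.of_forall fun x => ?_)
    simp
    field_simp

end GaussianIBP

section Isonormal

variable {V : Type*} [NormedAddCommGroup V] [InnerProductSpace ℝ V]
  {Ω : Type*} [MeasurableSpace Ω] {P : Measure Ω} {W : V → Ω → ℝ}

namespace IsIsonormal

lemma map_eq (hW : IsIsonormal P W) (h : V) :
    P.map (W h) = gaussianReal 0 (‖h‖₊ ^ 2) := by
  have hg := hW.gaussian.hasGaussianLaw_eval h
  rw [hg.map_eq_gaussianReal]
  have h0 : ∫ ω, W h ω ∂P = 0 := hW.centered h
  rw [h0, variance_of_integral_eq_zero hg.aemeasurable h0]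
  have : ∫ ω, W h ω ^ 2 ∂P = ‖h‖ ^ 2 := by
    rw [← real_inner_self_eq_norm_sq, ← hW.covariance]
    simp only [sq]
  rw [this]
  congr 1
  ext
  simp

lemma memLp (hW : IsIsonormal P W) (h : V) (p : ℝ≥0) : MemLp (W h) p P :=
  (hW.gaussian.hasGaussianLaw_eval h).memLp (by simp)

open Polynomial in
-- Two-variable integration by parts, reduced to the one-variable case by regression: `W g = b W h +
-- Z` with `Z` independent of `W h`, and Stein's identity is applied with `Z` frozen.
lemma integral_mul_polynomial [IsProbabilityMeasure P] (hW : IsIsonormal P W) (h g : V) (p q : ℝ[X]) :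
    ∫ ω, W h ω * p.eval (W h ω) * q.eval (W g ω) ∂P =
      ‖h‖ ^ 2 * ∫ ω, (derivative p).eval (W h ω) * q.eval (W g ω) ∂P +
        inner ℝ h g * ∫ ω, p.eval (W h ω) * (derivative q).eval (W g ω) ∂P := by
  -- The degenerate case is separated because `b` divides by `‖h‖²`. Here `W h = 0` almost surely
  -- and Cauchy–Schwarz gives `⟨h,g⟩ = 0`.
  by_cases hh : ‖h‖ = 0
  · have hz : W h =ᵐ[P] 0 := by
      have h1 : ∫ ω, W h ω ^ 2 ∂P = 0 := by
        simp only [sq]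
        rw [hW.covariance, real_inner_self_eq_norm_sq, hh]; simp
      have := (integral_eq_zero_iff_of_nonneg (fun ω => sq_nonneg (W h ω))
        (by simpa using (hW.memLp h 2).integrable_sq)).1 h1
      filter_upwards [this] with ω hω
      simpa using hω
    have hi : inner ℝ h g = 0 := by
      have := abs_real_inner_le_norm h g
      rw [hh, zero_mul] at this
      exact abs_nonpos_iff.1 this
    rw [hh, hi]
    simp only [ne_eq, OfNat.ofNat_ne_zero, not_false_eq_true, zero_pow, zero_mul, add_zero]
    refine integral_eq_zero_of_ae ?_
    filter_upwards [hz] with ω hω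
    simp [hω]
  -- The regression coefficient, chosen to make `Z` and `W h` uncorrelated; as they are jointly
  -- Gaussian, they are then independent.
  set b : ℝ := inner ℝ h g / ‖h‖ ^ 2 with hb
  set Z : Ω → ℝ := fun ω => W g ω - b * W h ω with hZ
  have hZX : HasGaussianLaw (fun ω => (Z ω, W h ω)) P := by
    have := (hW.gaussian.hasGaussianLaw_prodMk (s := h) (t := g)).map_fun
      (((ContinuousLinearMap.snd ℝ ℝ ℝ) - b • (ContinuousLinearMap.fst ℝ ℝ ℝ)).prod
        (ContinuousLinearMap.fst ℝ ℝ ℝ))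
    simpa using this
  have hm := hW.measurable
  have hZm : Measurable Z := by fun_prop
  have hZp : ∀ p : ℝ≥0, MemLp Z p P := fun p => hZX.fst.memLp (by simp)
  have hXp := hW.memLp h
  have hcov : cov[Z, W h; P] = 0 := by
    rw [covariance_eq_sub (by simpa using hZp 2) (by simpa using hXp 2), hW.centered, mul_zero,
      sub_zero]
    have e : Z * W h = fun ω => W g ω * W h ω - b * (W h ω * W h ω) := by
      ext ω; simp [hZ]; ring
    rw [e, integral_sub, integral_const_mul, hW.covariance, hW.covariance,
      real_inner_self_eq_norm_sq, real_inner_comm, hb]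
    · field_simp; simp
    · simpa using integrable_polynomial_mul (hW.memLp g) (hW.memLp h) X X
    · exact (by simpa using integrable_polynomial_mul (hW.memLp h) (hW.memLp h) X X :
        Integrable (fun ω => W h ω * W h ω) P).const_mul b
  have hind : IndepFun Z (W h) P := hZX.indepFun_of_covariance_eq_zero hcov
  have hmap := (indepFun_iff_map_prod_eq_prod_map_map hZm.aemeasurable (hm h).aemeasurable).1 hind
  have hg : ∀ ω, W g ω = b * W h ω + Z ω := fun ω => by simp [hZ]
  -- the expectation of a function of `(Z, W h)` as an iterated integral
  have fub : ∀ r s : ℝ[X], ∫ ω, r.eval (W h ω) * s.eval (W g ω) ∂P =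
      ∫ z, ∫ x, r.eval x * s.eval (b * x + z) ∂(gaussianReal 0 (‖h‖₊ ^ 2)) ∂(P.map Z) := by
    intro r s
    have hcont : Continuous fun zx : ℝ × ℝ => r.eval zx.2 * s.eval (b * zx.2 + zx.1) := by
      fun_prop
    have hI : Integrable (fun zx : ℝ × ℝ => r.eval zx.2 * s.eval (b * zx.2 + zx.1))
        (P.map fun ω => (Z ω, W h ω)) := by
      rw [integrable_map_measure hcont.aestronglyMeasurable (hZm.prodMk (hm h)).aemeasurable]
      refine (integrable_polynomial_mul (hW.memLp h) (hW.memLp g) r s).congr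
        (Filter.Eventually.of_forall fun ω => ?_)
      simp [hg]
    have : IsProbabilityMeasure (P.map Z) := Measure.isProbabilityMeasure_map hZm.aemeasurable
    rw [hmap, hW.map_eq] at hI
    rw [← integral_prod _ hI, ← hW.map_eq, ← hmap,
      integral_map (hZm.prodMk (hm h)).aemeasurable hcont.aestronglyMeasurable]
    simp [hg]
  have intz : ∀ r s : ℝ[X], Integrable (fun z => ∫ x, r.eval x * s.eval (b * x + z)
      ∂(gaussianReal 0 (‖h‖₊ ^ 2))) (P.map Z) := by
    intro r s
    have hcont : Continuous fun zx : ℝ × ℝ => r.eval zx.2 * s.eval (b * zx.2 + zx.1) := by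
      fun_prop
    have hI : Integrable (fun zx : ℝ × ℝ => r.eval zx.2 * s.eval (b * zx.2 + zx.1))
        (P.map fun ω => (Z ω, W h ω)) := by
      rw [integrable_map_measure hcont.aestronglyMeasurable (hZm.prodMk (hm h)).aemeasurable]
      refine (integrable_polynomial_mul (hW.memLp h) (hW.memLp g) r s).congr
        (Filter.Eventually.of_forall fun ω => ?_)
      simp [hg]
    have : IsProbabilityMeasure (P.map Z) := Measure.isProbabilityMeasure_map hZm.aemeasurable
    rw [hmap, hW.map_eq] at hI
    exact hI.integral_prod_left
  have hsplit : ∀ z, ∫ x, x * p.eval x * q.eval (b * x + z) ∂(gaussianReal 0 (‖h‖₊ ^ 2)) =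
      ‖h‖ ^ 2 * ∫ x, (derivative p).eval x * q.eval (b * x + z) ∂(gaussianReal 0 (‖h‖₊ ^ 2)) +
      inner ℝ h g * ∫ x, p.eval x * (derivative q).eval (b * x + z)
        ∂(gaussianReal 0 (‖h‖₊ ^ 2)) := by
    intro z
    have hint : ∀ r : ℝ[X], Integrable (fun x => r.eval x) (gaussianReal 0 (‖h‖₊ ^ 2)) := fun r =>
      memLp_one_iff_integrable.1 <| by
        simpa using memLp_polynomial_eval (P := gaussianReal 0 (‖h‖₊ ^ 2)) (X := id)
          (fun p => memLp_id_gaussianReal p) r 1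
    -- The derivative falling on `q (b x + z)` produces a factor `b`, and `‖h‖² b = ⟨h,g⟩`.
    have h1 := integral_id_mul_polynomial_gaussianReal (‖h‖₊ ^ 2)
      (p * q.comp (C b * X + C z))
    have i1 := hint (derivative p * q.comp (C b * X + C z))
    have i2 := hint (p * (C b * (derivative q).comp (C b * X + C z)))
    simp only [derivative_mul, derivative_comp, eval_add, eval_mul, eval_comp, eval_C, eval_X,
      derivative_add, derivative_C, derivative_X, zero_mul, mul_one, zero_add, add_zero] at h1 i1 i2
    simp only [← mul_assoc] at h1
    simp only [mul_assoc] at h1 i2 ⊢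
    rw [h1, integral_add i1 i2, mul_add]
    simp only [NNReal.coe_pow, coe_nnnorm]
    congr 1
    rw [← integral_const_mul, ← integral_const_mul]
    congr 1 with x
    rw [hb]
    field_simp
  have f0 := fub (X * p) q
  simp only [eval_mul, eval_X] at f0
  rw [f0, fub (derivative p) q, fub p (derivative q), ← integral_const_mul, ← integral_const_mul,
    ← integral_add ((intz _ _).const_mul _) ((intz _ _).const_mul _)]
  exact integral_congr_ae (Filter.Eventually.of_forall hsplit)

end IsIsonormal
end Isonormal

/-! ### Hermite polynomials of Gaussian variables -/

section Hermite

open Polynomial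

/-- The polynomial `r^n He_n(X / r)`. -/
def scaledHermite (n : ℕ) (r : ℝ) : ℝ[X] :=
  C (r ^ n) * ((hermite n).map (Int.castRingHom ℝ)).comp (C r⁻¹ * X)

lemma derivative_hermite_succ (n : ℕ) :
    derivative (hermite (n + 1)) = (n + 1 : ℤ[X]) * hermite n := by
  induction n with
  | zero => simp
  | succ n ih =>
    rw [hermite_succ (n + 1), derivative_sub, derivative_mul, derivative_X, ih, derivative_mul,
      hermite_succ n]
    simp
    ring

lemma derivative_scaledHermite_succ (n : ℕ) {r : ℝ} (hr : r ≠ 0) :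
    derivative (scaledHermite (n + 1) r) = C (n + 1 : ℝ) * scaledHermite n r := by
  unfold scaledHermite
  rw [derivative_C_mul, derivative_comp, derivative_map, derivative_hermite_succ]
  have : C (r ^ (n + 1)) * C r⁻¹ = C (r ^ n) := by
    rw [← C_mul, pow_succ, mul_inv_cancel_right₀ hr]
  simp only [derivative_mul, derivative_C, derivative_X, zero_mul, zero_add, mul_one,
    Polynomial.map_mul, Polynomial.map_add, Polynomial.map_natCast, Polynomial.map_one, mul_comp,
    add_comp, natCast_comp, one_comp, C_add, C_1, map_natCast]
  rw [← this]
  ring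

/-- The Gaussian adjoint of differentiation, `x - r² d/dx`, raises the degree; this is the shape to
which integration by parts applies. -/
lemma scaledHermite_succ (n : ℕ) {r : ℝ} (hr : r ≠ 0) :
    scaledHermite (n + 1) r =
      X * scaledHermite n r - C (r ^ 2) * derivative (scaledHermite n r) := by
  unfold scaledHermite
  rw [derivative_C_mul, derivative_comp, derivative_map, hermite_succ]
  have h1 : C (r ^ (n + 1)) * C r⁻¹ = C (r ^ n) := by
    rw [← C_mul, pow_succ, mul_inv_cancel_right₀ hr]
  have h2 : C (r ^ 2) * C (r ^ n) * C r⁻¹ = C (r ^ (n + 1)) := by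
    rw [← C_mul, ← C_mul]; congr 1; field_simp; ring
  simp only [derivative_mul, derivative_C, derivative_X, zero_mul, zero_add, mul_one,
    Polynomial.map_mul, Polynomial.map_sub, mul_comp, sub_comp, Polynomial.map_X, X_comp]
  linear_combination X * ((hermite n).map (Int.castRingHom ℝ)).comp (C r⁻¹ * X) * h1 +
    (map (Int.castRingHom ℝ) (derivative (hermite n))).comp (C r⁻¹ * X) * h2

lemma wienerDiag_eq {V Ω : Type*} [NormedAddCommGroup V] (W : V → Ω → ℝ) (n : ℕ) (h : V) (ω : Ω) :
    wienerDiag W n h ω = (scaledHermite n ‖h‖).eval (W h ω) := by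
  unfold wienerDiag scaledHermite
  rw [aeval_def, eval₂_eq_eval_map]
  simp [div_eq_inv_mul]

lemma wienerDiag_zero_succ {V Ω : Type*} [NormedAddCommGroup V] (W : V → Ω → ℝ) (n : ℕ) (ω : Ω) : wienerDiag W (n + 1) 0 ω = 0 := by
  simp [wienerDiag]

lemma wienerDiag_index_zero {V Ω : Type*} [NormedAddCommGroup V] (W : V → Ω → ℝ) (h : V) (ω : Ω) : wienerDiag W 0 h ω = 1 := by
  simp [wienerDiag]

variable {V : Type*} [NormedAddCommGroup V] [InnerProductSpace ℝ V]
  {Ω : Type*} [MeasurableSpace Ω] {P : Measure Ω} {W : V → Ω → ℝ}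

variable [IsProbabilityMeasure P]

lemma IsIsonormal.memLp_wienerDiag (hW : IsIsonormal P W) (n : ℕ) (h : V) (p : ℝ≥0) :
    MemLp (wienerDiag W n h) p P := by
  have : wienerDiag W n h = fun ω => (scaledHermite n ‖h‖).eval (W h ω) :=
    funext fun ω => wienerDiag_eq W n h ω
  rw [this]
  exact memLp_polynomial_eval (hW.memLp h) _ p

/-- The derivative term of the raising formula cancels the `‖h‖²` term of the integration by parts.
Only the derivative of the second Hermite polynomial survives, and it lowers that degree by one. -/
lemma IsIsonormal.integral_wienerDiag_succ (hW : IsIsonormal P W) (n m : ℕ) (h g : V) :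
    ∫ ω, wienerDiag W (n + 1) h ω * wienerDiag W m g ω ∂P = if m = 0 then 0 else
      inner ℝ h g * m * ∫ ω, wienerDiag W n h ω * wienerDiag W (m - 1) g ω ∂P := by
  by_cases hh : h = 0
  · subst hh; simp [wienerDiag_zero_succ]
  rcases m with _ | m
  · simp only [↓reduceIte, wienerDiag_index_zero, mul_one]
    have h1 := hW.integral_mul_polynomial h g (scaledHermite n ‖h‖) 1
    simp only [derivative_one, eval_zero, mul_zero, integral_zero, add_zero, eval_one, mul_one]
      at h1
    simp only [wienerDiag_eq, scaledHermite_succ n (norm_ne_zero_iff.2 hh), eval_sub, eval_mul,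
      eval_X, eval_C]
    have i1 := integrable_polynomial_mul (hW.memLp h) (hW.memLp h) X (scaledHermite n ‖h‖)
    have i2 := integrable_polynomial_mul (hW.memLp h) (hW.memLp h) (C (‖h‖ ^ 2))
      (derivative (scaledHermite n ‖h‖))
    simp only [eval_X, eval_C] at i1 i2
    rw [integral_sub i1 i2, h1, integral_const_mul, sub_self]
  · by_cases hg : g = 0
    · subst hg; simp [wienerDiag_zero_succ]
    rw [if_neg (by simp)]
    have h1 := hW.integral_mul_polynomial h g (scaledHermite n ‖h‖) (scaledHermite (m + 1) ‖g‖)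
    simp only [wienerDiag_eq, scaledHermite_succ n (norm_ne_zero_iff.2 hh), eval_sub, eval_mul,
      eval_X, eval_C, sub_mul]
    have i1 := integrable_polynomial_mul (hW.memLp h) (hW.memLp g) (X * scaledHermite n ‖h‖)
      (scaledHermite (m + 1) ‖g‖)
    have i2 := integrable_polynomial_mul (hW.memLp h) (hW.memLp g) (C (‖h‖ ^ 2) *
      (derivative (scaledHermite n ‖h‖))) (scaledHermite (m + 1) ‖g‖)
    simp only [eval_X, eval_C, eval_mul] at i1 i2
    rw [integral_sub i1 i2, h1]
    simp only [mul_assoc]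
    rw [integral_const_mul, add_sub_cancel_left,
      derivative_scaledHermite_succ m (norm_ne_zero_iff.2 hg)]
    congr 1
    rw [← integral_const_mul]
    congr 1 with ω
    simp
    ring

lemma IsIsonormal.integral_wienerDiag_mul (hW : IsIsonormal P W) (n m : ℕ) (h g : V) :
    ∫ ω, wienerDiag W n h ω * wienerDiag W m g ω ∂P =
      if n = m then n ! * inner ℝ h g ^ n else 0 := by
  induction n generalizing m with
  | zero =>
    rcases m with _ | m
    · simp [wienerDiag_index_zero]
    · have := hW.integral_wienerDiag_succ m 0 g h
      simp only [mul_comm (wienerDiag W 0 h _), this]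
      simp
  | succ n ih =>
    rw [hW.integral_wienerDiag_succ]
    rcases m with _ | m
    · simp
    · simp only [Nat.add_eq_zero_iff, one_ne_zero, and_false, ↓reduceIte, Nat.add_sub_cancel,
        add_left_inj, ih]
      split_ifs with hnm
      · subst hnm
        rw [Nat.factorial_succ]; push_cast; ring
      · simp

end Hermite

/-! ### Polarization -/

section Polarization

variable {n : ℕ}

/-- If `e` misses an index `i`, flipping the sign `ε i` changes the first product but not the
second, so the terms cancel in pairs. If `e` is bijective, every term is a product of squares of
signs. -/
lemma sum_sign_prod_comp (e : Fin n → Fin n) :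
    ∑ ε : Fin n → ℤˣ, (∏ i, ((ε i : ℤ) : ℝ)) * ∏ k, ((ε (e k) : ℤ) : ℝ) =
      if Function.Bijective e then 2 ^ n else 0 := by
  split_ifs with he
  · have : ∀ ε : Fin n → ℤˣ, (∏ i, ((ε i : ℤ) : ℝ)) * ∏ k, ((ε (e k) : ℤ) : ℝ) = 1 := by
      intro ε
      rw [he.prod_comp (fun i => ((ε i : ℤ) : ℝ)), ← Finset.prod_mul_distrib]
      refine Finset.prod_eq_one fun i _ => ?_
      rcases Int.units_eq_one_or (ε i) with h | h <;> simp [h]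
    simp [this]
  · have : ¬ Function.Surjective e := fun h => he ⟨Finite.injective_iff_surjective.2 h, h⟩
    simp only [Function.Surjective, not_forall, not_exists] at this
    obtain ⟨i, hi⟩ := this
    refine Finset.sum_involution (fun ε _ => Function.update ε i (-ε i)) ?_ ?_ (by simp) ?_
    · intro ε _
      have h1 : ∏ k, ((Function.update ε i (-ε i) (e k) : ℤ) : ℝ) = ∏ k, ((ε (e k) : ℤ) : ℝ) :=
        Finset.prod_congr rfl fun k _ => by rw [Function.update_of_ne (hi k)]
      have h2 : ∏ k, ((Function.update ε i (-ε i) k : ℤ) : ℝ) = -∏ k, ((ε k : ℤ) : ℝ) := by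
        rw [← Finset.mul_prod_erase _ _ (Finset.mem_univ i),
          ← Finset.mul_prod_erase _ (fun k => ((ε k : ℤ) : ℝ)) (Finset.mem_univ i)]
        rw [Finset.prod_congr rfl fun k hk => by
          rw [Function.update_of_ne (Finset.ne_of_mem_erase hk)]]
        simp
      rw [h1, h2]; ring
    · intro ε _ _ h
      have := congrFun h i
      simp at this
    · intro ε _
      simp

/-- Expanding the product of linear forms gives a sum over all self-maps of the index set; the signs
keep only the permutations, leaving a permanent. -/
lemma sum_sign_prod_sum (c : Fin n → Fin n → ℝ) :
    ∑ ε : Fin n → ℤˣ, (∏ i, ((ε i : ℤ) : ℝ)) * ∏ k, ∑ j, ((ε j : ℤ) : ℝ) * c k j =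
      2 ^ n * ∑ σ : Equiv.Perm (Fin n), ∏ k, c k (σ k) := by
  simp only [Finset.prod_univ_sum, Fintype.piFinset_univ, Finset.prod_mul_distrib, Finset.mul_sum]
  rw [Finset.sum_comm]
  have : ∀ e : Fin n → Fin n, ∑ ε : Fin n → ℤˣ, (∏ i, ((ε i : ℤ) : ℝ)) *
      ((∏ k, ((ε (e k) : ℤ) : ℝ)) * ∏ k, c k (e k)) =
        if Function.Bijective e then 2 ^ n * ∏ k, c k (e k) else 0 := by
    intro e
    rw [← ite_zero_mul, ← sum_sign_prod_comp, Finset.sum_mul]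
    exact Finset.sum_congr rfl fun ε _ => by ring
  rw [Finset.sum_congr rfl fun e _ => this e, ← Finset.sum_filter]
  symm
  refine Finset.sum_bij (fun σ _ => ⇑σ) (fun σ _ => Finset.mem_filter.2 ⟨Finset.mem_univ _, σ.bijective⟩)
    (fun σ _ τ _ h => DFunLike.coe_injective h) (fun e he => ?_) fun σ _ => rfl
  exact ⟨Equiv.ofBijective e ((Finset.mem_filter.1 he).2), by simp, rfl⟩

/-- Two polarizations in succession: summing over `ε` turns the `n`-th power into a product of
linear forms in `η`, and summing over `η` turns that product into a permanent. -/
lemma sum_sign_sum_sign (c : Fin n → Fin n → ℝ) :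
    ∑ ε : Fin n → ℤˣ, ∑ η : Fin n → ℤˣ, (∏ i, ((ε i : ℤ) : ℝ)) * ((∏ i, ((η i : ℤ) : ℝ)) *
      (∑ i, ∑ j, ((ε i : ℤ) : ℝ) * (((η j : ℤ) : ℝ) * c i j)) ^ n) =
      2 ^ n * n ! * 2 ^ n * ∑ σ : Equiv.Perm (Fin n), ∏ k, c k (σ k) := by
  have h1 : ∀ x : Fin n → ℝ, ∑ ε : Fin n → ℤˣ, (∏ i, ((ε i : ℤ) : ℝ)) *
      (∑ j, ((ε j : ℤ) : ℝ) * x j) ^ n = 2 ^ n * n ! * ∏ i, x i := by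
    intro x
    have := sum_sign_prod_sum (n := n) fun _ j => x j
    simp only [Finset.prod_const, Finset.card_univ, Fintype.card_fin] at this
    rw [this, Finset.sum_congr rfl fun σ _ => Equiv.prod_comp σ x]
    simp [Fintype.card_perm]
    ring
  rw [Finset.sum_comm]
  have := sum_sign_prod_sum c
  rw [mul_assoc (2 ^ n * (n ! : ℝ)), ← this, Finset.mul_sum]
  refine Finset.sum_congr rfl fun η _ => ?_
  rw [mul_left_comm, ← h1, Finset.mul_sum]
  refine Finset.sum_congr rfl fun ε _ => ?_
  simp only [← Finset.mul_sum]
  ring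

end Polarization

/-! ### The isometry property of multiple Wiener integrals -/

section WienerIsometry

lemma clm_ext_gen {I E : Type*} {k : I → I → ℝ} [NormedAddCommGroup E] [NormedSpace ℝ E]
    {A B : KernelHilb k →L[ℝ] E} (h : ∀ a, A (gen k a) = B (gen k a)) : A = B := by
  ext x
  refine (denseRange_lincomb k).induction_on (p := fun x => A x = B x) x
    (isClosed_eq (by fun_prop) (by fun_prop)) fun c => ?_
  simp [lincomb, Finsupp.linearCombination_apply, Finsupp.sum, h]

lemma toL2_of_memLp {Ω : Type*} [MeasurableSpace Ω] {P : Measure Ω} {X : Ω → ℝ}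
    (hX : MemLp X 2 P) : toL2 P X = hX.toLp X := dif_pos hX

lemma toL2_ae_eq {Ω : Type*} [MeasurableSpace Ω] {P : Measure Ω} {X : Ω → ℝ}
    (hX : MemLp X 2 P) : toL2 P X =ᵐ[P] X := by
  rw [toL2_of_memLp hX]; exact hX.coeFn_toLp

lemma inner_toL2 {Ω : Type*} [MeasurableSpace Ω] {P : Measure Ω} {X Y : Ω → ℝ}
    (hX : MemLp X 2 P) (hY : MemLp Y 2 P) :
    inner ℝ (toL2 P X) (toL2 P Y) = ∫ ω, X ω * Y ω ∂P := by
  rw [L2.inner_def]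
  refine integral_congr_ae ?_
  filter_upwards [toL2_ae_eq hX, toL2_ae_eq hY] with ω h1 h2
  rw [h1, h2]
  simp [mul_comm]

variable {V : Type*} [NormedAddCommGroup V] [InnerProductSpace ℝ V]
  {Ω : Type*} [MeasurableSpace Ω] {P : Measure Ω} [IsProbabilityMeasure P] {W : V → Ω → ℝ}
  {n m : ℕ}

namespace IsIsonormal

lemma memLp_two_wienerDiag (hW : IsIsonormal P W) (n : ℕ) (h : V) :
    MemLp (wienerDiag W n h) 2 P := by
  simpa using hW.memLp_wienerDiag n h 2

lemma memLp_wienerElem (hW : IsIsonormal P W) (h : Fin n → V) :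
    MemLp (wienerElem W h) 2 P := by
  have : MemLp (fun ω => ∑ ε : Fin n → ℤˣ,
      (∏ i, ((ε i : ℤ) : ℝ)) * wienerDiag W n (∑ i, ((ε i : ℤ) : ℝ) • h i) ω) 2 P :=
    memLp_finsetSum _ fun ε _ => (hW.memLp_two_wienerDiag n _).const_mul _
  exact this.const_mul _

lemma integral_wienerElem_mul (hW : IsIsonormal P W) (h : Fin n → V) (g : Fin m → V) :
    ∫ ω, wienerElem W h ω * wienerElem W g ω ∂P =
      ((2 : ℝ) ^ n * (n ! : ℝ))⁻¹ * ((2 : ℝ) ^ m * (m ! : ℝ))⁻¹ *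
      ∑ ε : Fin n → ℤˣ, ∑ η : Fin m → ℤˣ, (∏ i, ((ε i : ℤ) : ℝ)) * ((∏ i, ((η i : ℤ) : ℝ)) *
        if n = m then n ! *
          inner ℝ (∑ i, ((ε i : ℤ) : ℝ) • h i) (∑ i, ((η i : ℤ) : ℝ) • g i) ^ n else 0) := by
  have hint : ∀ (h : V) (g : V),
      Integrable (fun ω => wienerDiag W n h ω * wienerDiag W m g ω) P := fun h g =>
    (hW.memLp_two_wienerDiag n h).integrable_mul (hW.memLp_two_wienerDiag m g)
  have e : ∀ ω, wienerElem W h ω * wienerElem W g ω =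
      ((2 : ℝ) ^ n * (n ! : ℝ))⁻¹ * ((2 : ℝ) ^ m * (m ! : ℝ))⁻¹ *
      ∑ ε : Fin n → ℤˣ, ∑ η : Fin m → ℤˣ, (∏ i, ((ε i : ℤ) : ℝ)) * ((∏ i, ((η i : ℤ) : ℝ)) *
        (wienerDiag W n (∑ i, ((ε i : ℤ) : ℝ) • h i) ω *
          wienerDiag W m (∑ i, ((η i : ℤ) : ℝ) • g i) ω)) := by
    intro ω
    unfold wienerElem
    rw [mul_mul_mul_comm, Finset.sum_mul_sum]
    congr 1
    refine Finset.sum_congr rfl fun ε _ => Finset.sum_congr rfl fun η _ => by ring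
  simp only [e]
  rw [integral_const_mul, integral_finsetSum _ fun ε _ => integrable_finsetSum _ fun η _ =>
    ((hint _ _).const_mul _).const_mul _]
  congr 1
  refine Finset.sum_congr rfl fun ε _ => ?_
  rw [integral_finsetSum _ fun η _ => ((hint _ _).const_mul _).const_mul _]
  refine Finset.sum_congr rfl fun η _ => ?_
  rw [integral_const_mul, integral_const_mul, hW.integral_wienerDiag_mul]

/-- The Hermite moments contribute `n! ⟨∑ ε h, ∑ η g⟩^n`. Double polarization makes this the
permanent of the Gram matrix, whose terms are the pairings of permuted elementary tensors. -/
lemma inner_wienerElem (hW : IsIsonormal P W) (h g : Fin n → V) :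
    inner ℝ (toL2 P (wienerElem W h)) (toL2 P (wienerElem W g)) =
      ∑ σ : Equiv.Perm (Fin n), inner ℝ (tens h) (permTensor σ (tens g)) := by
  rw [inner_toL2 (hW.memLp_wienerElem h) (hW.memLp_wienerElem g), hW.integral_wienerElem_mul]
  simp only [↓reduceIte, permTensor_tens, inner_tens, sum_inner, inner_sum, real_inner_smul_left,
    real_inner_smul_right, Function.comp_apply]
  have := sum_sign_sum_sign fun i j => inner ℝ (h i) (g j)
  have e : ∀ (ε η : Fin n → ℤˣ), (∏ i, ((ε i : ℤ) : ℝ)) * ((∏ i, ((η i : ℤ) : ℝ)) *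
      ((n ! : ℝ) * (∑ i, ∑ j, ((η i : ℤ) : ℝ) * (((ε j : ℤ) : ℝ) * inner ℝ (h j) (g i))) ^ n)) =
      n ! * ((∏ i, ((ε i : ℤ) : ℝ)) * ((∏ i, ((η i : ℤ) : ℝ)) *
      (∑ i, ∑ j, ((ε i : ℤ) : ℝ) * (((η j : ℤ) : ℝ) * inner ℝ (h i) (g j))) ^ n)) := by
    intro ε η
    rw [Finset.sum_comm]
    simp only [mul_left_comm (((η _ : ℤ) : ℝ))]
    ring
  rw [Finset.sum_congr rfl fun ε _ => Finset.sum_congr rfl fun η _ => e ε η]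
  simp only [← Finset.mul_sum _ _ ((n ! : ℕ) : ℝ)]
  rw [this]
  have h1 : (n ! : ℝ) ≠ 0 := by positivity
  field_simp

lemma inner_wienerElem_of_ne (hW : IsIsonormal P W) (hnm : n ≠ m) (h : Fin n → V)
    (g : Fin m → V) : inner ℝ (toL2 P (wienerElem W h)) (toL2 P (wienerElem W g)) = 0 := by
  rw [inner_toL2 (hW.memLp_wienerElem h) (hW.memLp_wienerElem g), hW.integral_wienerElem_mul]
  simp [hnm]

end IsIsonormal

lemma norm_permTensor (σ : Equiv.Perm (Fin n)) (F : TensorPow V n) :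
    ‖permTensor σ F‖ = ‖F‖ := by
  refine (denseRange_lincomb (tensorKernel V n)).induction_on (p := fun F =>
    ‖permTensor σ F‖ = ‖F‖) F (isClosed_eq (by fun_prop) (by fun_prop)) fun c => ?_
  rw [← sq_eq_sq₀ (norm_nonneg _) (norm_nonneg _), lincomb, Finsupp.linearCombination_apply,
    Finsupp.sum, map_sum]
  simp only [map_smul]
  have e : ∀ a, permTensor σ (gen (tensorKernel V n) a) = tens (a ∘ σ) := permTensor_tens σ
  simp only [e]
  have h1 := norm_sq_linearCombination (fun a : Fin n → V => tens (a ∘ σ)) c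
  have h2 := norm_sq_linearCombination (fun a : Fin n → V => tens a) c
  simp only [inner_tens_comp] at h1
  exact h1.trans h2.symm

namespace IsIsonormal

/-- With `F` the tensor on the right, the squared norm on the left is `∑_σ ⟨F, σF⟩`, a sum of `n!`
terms each at most `‖F‖²`. This is the continuity needed to extend to the completion. -/
lemma norm_linearCombination_wienerElem (hW : IsIsonormal P W) (n : ℕ) (c : (Fin n → V) →₀ ℝ) :
    ‖Finsupp.linearCombination ℝ (fun h => toL2 P (wienerElem W h)) c‖ ≤
      √(n ! : ℝ) * ‖lincomb (tensorKernel V n) c‖ := by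
  have key : ‖Finsupp.linearCombination ℝ (fun h => toL2 P (wienerElem W h)) c‖ ^ 2 =
      ∑ σ : Equiv.Perm (Fin n), inner ℝ (lincomb (tensorKernel V n) c)
        (permTensor σ (lincomb (tensorKernel V n) c)) := by
    have e : ∀ F, ∑ σ : Equiv.Perm (Fin n), inner ℝ F (permTensor σ F) =
        inner ℝ F ((∑ σ : Equiv.Perm (Fin n), permTensor (V := V) σ) F) := by
      simp [inner_sum]
    rw [norm_sq_linearCombination, e]
    simp only [lincomb, Finsupp.linearCombination_apply, Finsupp.sum, map_sum,
      sum_inner, inner_sum _ _ (_ : TensorPow V n), real_inner_smul_left, real_inner_smul_right, map_smul]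
    rw [Finset.sum_comm]
    refine Finset.sum_congr rfl fun a _ => Finset.sum_congr rfl fun b _ => ?_
    rw [hW.inner_wienerElem, _root_.sum_apply, inner_sum]
    change _ = c a * (c b * ∑ σ, inner ℝ (tens b) (permTensor σ (tens a)))
    ring
  refine le_of_sq_le_sq ?_ (by positivity) |> fun h => h
  rw [key, mul_pow, Real.sq_sqrt (by positivity)]
  calc _ ≤ ∑ σ : Equiv.Perm (Fin n), ‖lincomb (tensorKernel V n) c‖ ^ 2 :=
        Finset.sum_le_sum fun σ _ => by
          refine (real_inner_le_norm _ _).trans ?_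
          rw [norm_permTensor, sq]
    _ = _ := by simp [Fintype.card_perm]

/-- The multiple Wiener integral as a continuous linear map. -/
def wienerIntL (P : Measure Ω) (W : V → Ω → ℝ) (n : ℕ) : TensorPow V n →L[ℝ] Lp ℝ 2 P :=
  kernelLift (tensorKernel V n) fun h => toL2 P (wienerElem W h)

lemma wienerInt_eq (hW : IsIsonormal P W) (n : ℕ) : wienerInt P W n = wienerIntL P W n :=
  (kernelLift_eq_extension (hW.norm_linearCombination_wienerElem n)).symm

lemma wienerIntL_tens (hW : IsIsonormal P W) (h : Fin n → V) :
    wienerIntL P W n (tens h) = toL2 P (wienerElem W h) :=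
  kernelLift_gen (hW.norm_linearCombination_wienerElem n) h

/-- As operators, `I_n* I_n` is the sum of all permutations. Both sides are continuous and linear,
so elementary tensors suffice. -/
lemma inner_wienerIntL (hW : IsIsonormal P W) (F G : TensorPow V n) :
    inner ℝ (wienerIntL P W n F) (wienerIntL P W n G) =
      ∑ σ : Equiv.Perm (Fin n), inner ℝ F (permTensor σ G) := by
  have e : (ContinuousLinearMap.adjoint (wienerIntL P W n)).comp (wienerIntL P W n) =
      ∑ σ : Equiv.Perm (Fin n), permTensor σ := by
    refine clm_ext_gen fun g => ext_inner_gen fun h => ?_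
    change inner ℝ (tens h) ((_ : TensorPow V _ →L[ℝ] TensorPow V _) (tens g)) =
      inner ℝ (tens h) ((_ : TensorPow V _ →L[ℝ] TensorPow V _) (tens g))
    rw [ContinuousLinearMap.comp_apply, ContinuousLinearMap.adjoint_inner_right,
      hW.wienerIntL_tens, hW.wienerIntL_tens, hW.inner_wienerElem, _root_.sum_apply,
      inner_sum]
  rw [← ContinuousLinearMap.adjoint_inner_right, ← ContinuousLinearMap.comp_apply, e,
    _root_.sum_apply, inner_sum]

lemma inner_wienerIntL_of_isSymm (hW : IsIsonormal P W) (F : TensorPow V n) {G : TensorPow V n}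
    (hG : IsSymmTensor G) :
    inner ℝ (wienerIntL P W n F) (wienerIntL P W n G) = n ! * inner ℝ F G := by
  rw [hW.inner_wienerIntL]
  simp [(isSymmTensor_iff G).1 hG, Fintype.card_perm]

lemma norm_sq_wienerIntL (hW : IsIsonormal P W) {G : TensorPow V n} (hG : IsSymmTensor G) :
    ‖wienerIntL P W n G‖ ^ 2 = n ! * ‖G‖ ^ 2 := by
  rw [← real_inner_self_eq_norm_sq, hW.inner_wienerIntL_of_isSymm G hG, real_inner_self_eq_norm_sq]

lemma inner_wienerIntL_of_ne (hW : IsIsonormal P W) (hnm : n ≠ m) (F : TensorPow V n)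
    (G : TensorPow V m) : inner ℝ (wienerIntL P W n F) (wienerIntL P W m G) = 0 := by
  have e : (ContinuousLinearMap.adjoint (wienerIntL P W n)).comp (wienerIntL P W m) = 0 := by
    refine clm_ext_gen fun g => ext_inner_gen fun h => ?_
    change inner ℝ (tens h) ((_ : TensorPow V _ →L[ℝ] TensorPow V _) (tens g)) =
      inner ℝ (tens h) ((_ : TensorPow V _ →L[ℝ] TensorPow V _) (tens g))
    rw [ContinuousLinearMap.comp_apply, ContinuousLinearMap.adjoint_inner_right,
      hW.wienerIntL_tens, hW.wienerIntL_tens, hW.inner_wienerElem_of_ne hnm]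
    simp
  rw [← ContinuousLinearMap.adjoint_inner_right, ← ContinuousLinearMap.comp_apply, e]
  simp

/-- The chaos expansion with symmetric kernels is unique. -/
lemma chaos_unique (hW : IsIsonormal P W) {F G : ∀ n, TensorPow V n} {X : Lp ℝ 2 P}
    (hF : HasSum (fun n => wienerIntL P W n (F n)) X)
    (hG : HasSum (fun n => wienerIntL P W n (G n)) X) (n : ℕ)
    (hFs : IsSymmTensor (F n)) (hGs : IsSymmTensor (G n)) : F n = G n := by
  -- Pairing with an element of the `n`-th chaos kills all other orders of the expansion.
  have key : ∀ {K : ∀ n, TensorPow V n}, HasSum (fun n => wienerIntL P W n (K n)) X →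
      ∀ D : TensorPow V n, inner ℝ (wienerIntL P W n D) X =
        inner ℝ (wienerIntL P W n D) (wienerIntL P W n (K n)) := by
    intro K hK D
    have h1 := (innerSL ℝ (wienerIntL P W n D)).hasSum hK
    have h2 := hasSum_single (f := fun m => innerSL ℝ (wienerIntL P W n D) (wienerIntL P W m (K m)))
      n fun m hm => hW.inner_wienerIntL_of_ne hm.symm _ _
    exact h1.unique h2
  -- The test tensor is the difference itself; it is symmetric, and on symmetric tensors `I_n` is
  -- injective. Symmetry is needed at order `n` only.
  have hD := hFs.sub hGs
  have h1 : inner ℝ (wienerIntL P W n (F n - G n)) (wienerIntL P W n (F n - G n)) = 0 := by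
    conv_lhs => rw [map_sub (wienerIntL P W n) (F n) (G n), inner_sub_right]
    rw [← map_sub, ← key hF, ← key hG, sub_self]
  rw [hW.inner_wienerIntL_of_isSymm _ hD, real_inner_self_eq_norm_sq] at h1
  have h2 : ‖F n - G n‖ = 0 := by
    have : (n ! : ℝ) ≠ 0 := by positivity
    simpa [this] using h1
  exact sub_eq_zero.1 (norm_eq_zero.1 h2)

/-- The zeroth tensor power is a line spanned by the empty tensor, whose norm is an empty product,
so `I_0` is the embedding of constants. -/
lemma wienerIntL_zero (hW : IsIsonormal P W) (G : TensorPow V 0) :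
    wienerIntL P W 0 G = toL2 P fun _ => inner ℝ (tens ![]) G := by
  have hc : ∀ c : ℝ, toL2 P (fun _ => c) = c • toL2 P (fun _ : Ω => (1 : ℝ)) := by
    intro c
    rw [toL2_of_memLp (memLp_const c), toL2_of_memLp (memLp_const 1)]
    rw [← MemLp.toLp_const_smul]
    congr 1; ext; simp
  have hG : G = (inner ℝ (tens ![]) G : ℝ) • tens ![] := by
    refine ext_inner_gen fun a => ?_
    obtain rfl : a = ![] := Subsingleton.elim _ _
    rw [real_inner_smul_right]
    change inner ℝ (tens ![]) G = _ * inner ℝ (tens ![]) (tens ![])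
    rw [inner_tens]; simp
  conv_lhs => rw [hG]
  rw [map_smul, hW.wienerIntL_tens, hc]
  congr 2
  ext ω
  simp [wienerElem, wienerDiag_index_zero]

end IsIsonormal

end WienerIsometry

/-! ### The covariance of fractional Brownian motion -/

section FBM

lemma isPSDKernel_mul_self {I : Type*} (g : I → ℝ) : IsPSDKernel fun a b => g a * g b := by
  have := IsPSDKernel.comap (isPSDKernel_inner (E := ℝ)) g
  convert this using 3
  simp [mul_comm]

lemma IsPSDKernel.add {I : Type*} {k l : I → I → ℝ} (hk : IsPSDKernel k) (hl : IsPSDKernel l) :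
    IsPSDKernel fun a b => k a b + l a b := by
  rw [isPSDKernel_iff] at *
  exact hk.add hl

lemma IsPSDKernel.integral {I X : Type*} [MeasurableSpace X] {ν : Measure X} {k : X → I → I → ℝ}
    (hk : ∀ x, IsPSDKernel (k x)) (hi : ∀ a b, Integrable (fun x => k x a b) ν) :
    IsPSDKernel fun a b => ∫ x, k x a b ∂ν := by
  refine ⟨fun a b => integral_congr_ae (Filter.Eventually.of_forall fun x => (hk x).1 a b),
    fun c => ?_⟩
  have : ∫ x, (∑ a ∈ c.support, ∑ b ∈ c.support, c a * (c b * k x a b)) ∂ν =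
      ∑ a ∈ c.support, ∑ b ∈ c.support, c a * (c b * ∫ x, k x a b ∂ν) := by
    rw [integral_finsetSum _ fun a _ => integrable_finsetSum _ fun b _ =>
      ((hi a b).const_mul _).const_mul _]
    refine Finset.sum_congr rfl fun a _ => ?_
    rw [integral_finsetSum _ fun b _ => ((hi a b).const_mul _).const_mul _]
    simp only [integral_const_mul]
  refine le_of_le_of_eq ?_ this
  exact integral_nonneg fun x => (hk x).2 c

/-- The covariance of fractional Brownian motion with Hurst index `H`. -/
def fbmCov (H T S : ℝ) : ℝ := (|T| ^ (2 * H) + |S| ^ (2 * H) - |T - S| ^ (2 * H)) / 2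

variable {H : ℝ}

/-- Near zero `1 - cos (l x) ≤ l² x² / 2` leaves the power `l^{1-2H}`, integrable since `H < 1`; at
infinity the bound `2 l^{-2H-1}` is integrable since `H > 0`. -/
lemma integrableOn_one_sub_cos (h0 : 0 < H) (h1 : H < 1) (x : ℝ) :
    IntegrableOn (fun l : ℝ => (1 - Real.cos (l * x)) * l ^ (-2 * H - 1)) (Set.Ioi 0) := by
  have hm : AEStronglyMeasurable (fun l : ℝ => (1 - Real.cos (l * x)) * l ^ (-2 * H - 1))
      (volume.restrict (Set.Ioi 0)) := by
    apply Measurable.aestronglyMeasurable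
    fun_prop
  rw [← Set.Ioc_union_Ioi_eq_Ioi (zero_le_one' ℝ)]
  refine IntegrableOn.union ?_ ?_
  · have h2 : IntegrableOn (fun l : ℝ => x ^ 2 / 2 * l ^ (1 - 2 * H)) (Set.Ioc 0 1) :=
      ((intervalIntegrable_iff_integrableOn_Ioc_of_le zero_le_one).1
        (intervalIntegral.intervalIntegrable_rpow' (by linarith))).const_mul _
    refine h2.mono' (hm.mono_set Set.Ioc_subset_Ioi_self) ?_
    filter_upwards [ae_restrict_mem measurableSet_Ioc] with l hl
    have hc := Real.one_sub_sq_div_two_le_cos (x := l * x)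
    have hc' := Real.cos_le_one (l * x)
    rw [Real.norm_of_nonneg (mul_nonneg (by linarith) (Real.rpow_nonneg hl.1.le _))]
    have e : l ^ (1 - 2 * H) = l ^ 2 * l ^ (-2 * H - 1) := by
      rw [← Real.rpow_natCast, ← Real.rpow_add hl.1]; congr 1; push_cast; ring
    rw [e, ← mul_assoc]
    refine mul_le_mul_of_nonneg_right ?_ (Real.rpow_nonneg hl.1.le _)
    nlinarith
  · have h2 : IntegrableOn (fun l : ℝ => 2 * l ^ (-2 * H - 1)) (Set.Ioi 1) :=
      (integrableOn_Ioi_rpow_of_lt (by linarith) one_pos).const_mul _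
    refine h2.mono' (hm.mono_set (Set.Ioi_subset_Ioi zero_le_one)) ?_
    filter_upwards [ae_restrict_mem measurableSet_Ioi] with l hl
    have hl0 : (0 : ℝ) ≤ l := zero_le_one.trans (le_of_lt hl)
    have hc' := Real.cos_le_one (l * x)
    have hc'' := Real.neg_one_le_cos (l * x)
    rw [Real.norm_of_nonneg (mul_nonneg (by linarith) (Real.rpow_nonneg hl0 _))]
    exact mul_le_mul_of_nonneg_right (by linarith) (Real.rpow_nonneg hl0 _)

/-- The normalizing constant in the spectral representation of `|x|^{2H}`. -/
def spectralConst (H : ℝ) : ℝ :=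
  ∫ l in Set.Ioi (0 : ℝ), (1 - Real.cos (l * 1)) * l ^ (-2 * H - 1)

lemma spectralConst_pos (h0 : 0 < H) (h1 : H < 1) : 0 < spectralConst H := by
  unfold spectralConst
  rw [setIntegral_pos_iff_support_of_nonneg_ae _ (integrableOn_one_sub_cos h0 h1 1)]
  · refine lt_of_lt_of_le (b := volume (Set.Ioo (1 : ℝ) 2)) (by simp) (measure_mono ?_)
    intro l hl
    have hl0 : 0 < l := zero_lt_one.trans hl.1
    refine ⟨?_, hl0⟩
    have := Real.cos_lt_cos_of_nonneg_of_le_pi le_rfl (by linarith [hl.2, Real.pi_gt_three]) hl0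
    rw [Real.cos_zero] at this
    simp only [mul_one, Function.mem_support]
    exact mul_ne_zero (by linarith) (Real.rpow_pos_of_pos hl0 _).ne'
  · filter_upwards [ae_restrict_mem measurableSet_Ioi] with l hl
    exact mul_nonneg (by linarith [Real.cos_le_one (l * 1)]) (Real.rpow_nonneg (le_of_lt hl) _)

lemma integral_one_sub_cos (h0 : 0 < H) (x : ℝ) :
    ∫ l in Set.Ioi (0 : ℝ), (1 - Real.cos (l * x)) * l ^ (-2 * H - 1) =
      |x| ^ (2 * H) * spectralConst H := by
  rcases eq_or_ne x 0 with rfl | hx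
  · simp [Real.zero_rpow (by positivity : 2 * H ≠ 0)]
  have hx' : 0 < |x| := abs_pos.2 hx
  have := integral_comp_mul_left_Ioi
    (fun l => (1 - Real.cos (l * 1)) * l ^ (-2 * H - 1)) 0 hx'
  rw [mul_zero, smul_eq_mul] at this
  have e : ∫ l in Set.Ioi (0 : ℝ), (1 - Real.cos (|x| * l * 1)) * (|x| * l) ^ (-2 * H - 1) =
      |x| ^ (-2 * H - 1) *
        ∫ l in Set.Ioi (0 : ℝ), (1 - Real.cos (l * x)) * l ^ (-2 * H - 1) := by
    rw [← integral_const_mul]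
    refine setIntegral_congr_fun measurableSet_Ioi fun l hl => ?_
    have hc : Real.cos (|x| * l * 1) = Real.cos (l * x) := by
      rw [mul_one, ← Real.cos_abs (l * x), abs_mul, abs_of_pos (show (0 : ℝ) < l from hl), mul_comm]
    simp only [hc]
    rw [Real.mul_rpow hx'.le (le_of_lt hl)]
    ring
  rw [e] at this
  have h2 : |x| ^ (2 * H) * |x| * |x| ^ (-2 * H - 1) = 1 := by
    rw [← Real.rpow_add_one hx'.ne', ← Real.rpow_add hx']
    simp
  have h3 : |x| * |x|⁻¹ = 1 := mul_inv_cancel₀ hx'.ne'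
  change _ = |x|⁻¹ * spectralConst H at this
  linear_combination |x| ^ (2 * H) * |x| * this -
    (∫ l in Set.Ioi (0 : ℝ), (1 - Real.cos (l * x)) * l ^ (-2 * H - 1)) * h2 +
    |x| ^ (2 * H) * spectralConst H * h3

/-- Spectral representation: `(1 - cos lT)(1 - cos lS) + sin lT sin lS` is a sum of two rank-one
kernels and equals `(1 - cos lT) + (1 - cos lS) - (1 - cos l(T-S))`. Integrated against `l^{-2H-1}`
this is a positive multiple of the covariance. -/
lemma isPSDKernel_fbmCov (h0 : 0 < H) (h1 : H < 1) : IsPSDKernel (fbmCov H) := by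
  have hc := spectralConst_pos h0 h1
  set ν : Measure ℝ := volume.restrict (Set.Ioi 0)
  -- The absolute value makes the kernel positive semidefinite for every real `l`; on the range of
  -- integration it changes nothing.
  set k : ℝ → ℝ → ℝ → ℝ := fun l T S => ((1 - Real.cos (l * T)) * (1 - Real.cos (l * S)) +
    Real.sin (l * T) * Real.sin (l * S)) * |l ^ (-2 * H - 1)| with hk
  have hkk : ∀ l T S, l ∈ Set.Ioi (0 : ℝ) → k l T S = (1 - Real.cos (l * T)) * l ^ (-2 * H - 1) +
      (1 - Real.cos (l * S)) * l ^ (-2 * H - 1) -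
      (1 - Real.cos (l * (T - S))) * l ^ (-2 * H - 1) := by
    intro l T S hl
    rw [hk]
    simp only
    rw [abs_of_nonneg (Real.rpow_nonneg (le_of_lt hl) _), mul_sub l, Real.cos_sub]
    ring
  have hint : ∀ T S, IntegrableOn (fun l => (1 - Real.cos (l * T)) * l ^ (-2 * H - 1) +
      (1 - Real.cos (l * S)) * l ^ (-2 * H - 1) -
      (1 - Real.cos (l * (T - S))) * l ^ (-2 * H - 1)) (Set.Ioi 0) := fun T S =>
    ((integrableOn_one_sub_cos h0 h1 T).add (integrableOn_one_sub_cos h0 h1 S)).sub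
      (integrableOn_one_sub_cos h0 h1 (T - S))
  have h2 : IsPSDKernel fun T S => ∫ l, k l T S ∂ν := by
    refine IsPSDKernel.integral (fun l => ?_) fun T S => ?_
    · have := (((isPSDKernel_mul_self fun T => 1 - Real.cos (l * T)).add
        (isPSDKernel_mul_self fun T => Real.sin (l * T))).smul (abs_nonneg (l ^ (-2 * H - 1))))
      convert this using 3
      rw [mul_comm]
    · refine (hint T S).congr ?_
      filter_upwards [ae_restrict_mem measurableSet_Ioi] with l hl
      rw [hkk l T S hl]
  have h3 := h2.smul (inv_nonneg.2 (mul_pos two_pos hc).le)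
  convert h3 using 3 with T S
  rw [setIntegral_congr_fun measurableSet_Ioi fun l hl => hkk l T S hl, integral_sub, integral_add,
    integral_one_sub_cos h0, integral_one_sub_cos h0, integral_one_sub_cos h0, fbmCov]
  · field_simp
  · exact integrableOn_one_sub_cos h0 h1 T
  · exact integrableOn_one_sub_cos h0 h1 S
  · exact (integrableOn_one_sub_cos h0 h1 T).add (integrableOn_one_sub_cos h0 h1 S)
  · exact integrableOn_one_sub_cos h0 h1 (T - S)

lemma fbmCov_half {T S : ℝ} (hT : 0 ≤ T) (hS : 0 ≤ S) : fbmCov (1 / 2) T S = min T S := by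
  unfold fbmCov
  norm_num
  rw [abs_of_nonneg hT, abs_of_nonneg hS]
  rcases le_total T S with h | h
  · rw [min_eq_left h, abs_of_nonpos (by linarith)]; ring
  · rw [min_eq_right h, abs_of_nonneg (by linarith)]; ring

lemma fbmCov_comm (T S : ℝ) : fbmCov H T S = fbmCov H S T := by
  unfold fbmCov
  rw [abs_sub_comm]; ring

lemma fbmCov_mul {l : ℝ} (hl : 0 ≤ l) (T S : ℝ) :
    fbmCov H (l * T) (l * S) = l ^ (2 * H) * fbmCov H T S := by
  unfold fbmCov
  rw [← mul_sub, abs_mul, abs_mul, abs_mul, abs_of_nonneg hl, Real.mul_rpow hl (abs_nonneg _),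
    Real.mul_rpow hl (abs_nonneg _), Real.mul_rpow hl (abs_nonneg _)]
  ring

/-- The potential of `1_{[0,T]}` with respect to the covariance in time. -/
def timePot (H T s : ℝ) : ℝ :=
  if H = 1 / 2 then (Set.Icc 0 T).indicator (fun _ => 1) s
  else H * (2 * H - 1) * ∫ r in (0 : ℝ)..T, |s - r| ^ (2 * H - 2)

lemma intervalIntegrable_abs_rpow (hH : 1 / 2 < H) (a b : ℝ) :
    IntervalIntegrable (fun x : ℝ => |x| ^ (2 * H - 2)) volume a b := by
  have h0 : ∀ b : ℝ, IntervalIntegrable (fun x : ℝ => |x| ^ (2 * H - 2)) volume 0 b := by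
    have hp : ∀ b : ℝ, 0 ≤ b → IntervalIntegrable (fun x : ℝ => |x| ^ (2 * H - 2)) volume 0 b := by
      intro b hb
      refine (intervalIntegral.intervalIntegrable_rpow' (r := 2 * H - 2) (by linarith)).congr ?_
      intro x hx
      rw [Set.uIoc_of_le hb] at hx
      simp [abs_of_pos hx.1]
    intro b
    rcases le_total 0 b with hb | hb
    · exact hp b hb
    · have := (IntervalIntegrable.iff_comp_neg).1 (hp (-b) (by linarith))
      simpa using this
  exact (h0 a).symm.trans (h0 b)

/-- The function has size `|x|^{2H-1}` with positive exponent, so the singularity of `|x|^{2H-2}` at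
the origin is removed. This gives bounded time potentials when `H > 1/2`. -/
lemma continuous_abs_rpow_mul (hH : 1 / 2 < H) :
    Continuous fun x : ℝ => |x| ^ (2 * H - 2) * x := by
  rw [continuous_iff_continuousAt]
  intro x
  rcases eq_or_ne x 0 with rfl | hx
  · have h1 : Filter.Tendsto (fun x : ℝ => |x| ^ (2 * H - 1)) (nhds 0) (nhds 0) := by
      have : ContinuousAt (fun x : ℝ => |x| ^ (2 * H - 1)) 0 :=
        continuous_abs.continuousAt.rpow_const (Or.inr (by linarith))
      simpa [ContinuousAt, Real.zero_rpow (by linarith : 2 * H - 1 ≠ 0)] using this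
    rw [ContinuousAt, mul_zero]
    refine squeeze_zero_norm (fun x => ?_) h1
    rcases eq_or_ne x 0 with rfl | hx
    · simp [Real.zero_rpow (by linarith : 2 * H - 1 ≠ 0)]
    · rw [norm_mul, Real.norm_of_nonneg (Real.rpow_nonneg (abs_nonneg _) _), Real.norm_eq_abs]
      conv_lhs => rw [← Real.rpow_one |x|, ← Real.rpow_mul (abs_nonneg x), one_mul,
        ← Real.rpow_add (abs_pos.2 hx)]
      rw [show 2 * H - 2 + 1 = 2 * H - 1 by ring]
  · exact (continuous_abs.continuousAt.rpow_const (Or.inl (abs_ne_zero.2 hx))).mul continuousAt_id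

/-- The antiderivative is continuous everywhere and is differentiated only away from the origin, so
the fundamental theorem is used off a countable set. -/
lemma integral_abs_rpow (hH : 1 / 2 < H) (a b : ℝ) :
    ∫ x in a..b, |x| ^ (2 * H - 2) =
      (|b| ^ (2 * H - 2) * b - |a| ^ (2 * H - 2) * a) / (2 * H - 1) := by
  have hd : ∀ x : ℝ, x ≠ 0 → HasDerivAt (fun x : ℝ => |x| ^ (2 * H - 2) * x)
      ((2 * H - 1) * |x| ^ (2 * H - 2)) x := by
    intro x hx
    have h1 := ((hasDerivAt_abs hx).rpow_const (p := 2 * H - 2) (Or.inl (abs_ne_zero.2 hx))).mul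
      (hasDerivAt_id x)
    refine h1.congr_deriv ?_
    have h2 : (SignType.sign x : ℝ) * x = |x| := sign_mul_self x
    have h3 : |x| ^ (2 * H - 2) = |x| ^ (2 * H - 2 - 1) * |x| := by
      conv_rhs => rw [← Real.rpow_one |x|, ← Real.rpow_mul (abs_nonneg x), one_mul,
        ← Real.rpow_add (abs_pos.2 hx)]
      congr 1; ring
    simp only [id]
    rw [h3, ← h2]
    ring
  have h2 := integral_eq_of_hasDerivAt_off_countable
    (fun x : ℝ => |x| ^ (2 * H - 2) * x) (fun x => (2 * H - 1) * |x| ^ (2 * H - 2)) (a := a) (b := b)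
    (s := {0}) (Set.countable_singleton 0) (continuous_abs_rpow_mul hH).continuousOn
    (fun x hx => hd x (by simpa using hx.2)) ((intervalIntegrable_abs_rpow hH a b).const_mul _)
  rw [intervalIntegral.integral_const_mul] at h2
  rw [eq_div_iff (by linarith), ← h2]; ring

lemma timePot_eq (hH : 1 / 2 < H) (T s : ℝ) :
    timePot H T s = H * (|s| ^ (2 * H - 2) * s - |s - T| ^ (2 * H - 2) * (s - T)) := by
  rw [timePot, if_neg hH.ne', intervalIntegral.integral_comp_sub_left (fun x => |x| ^ (2 * H - 2)),
    integral_abs_rpow hH]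
  have : 2 * H - 1 ≠ 0 := by linarith
  rw [sub_zero, mul_assoc, mul_div_cancel₀ _ this]

lemma integral_abs_rpow_mul (hH : 1 / 2 < H) (a b : ℝ) :
    ∫ x in a..b, |x| ^ (2 * H - 2) * x = (|b| ^ (2 * H) - |a| ^ (2 * H)) / (2 * H) := by
  have := intervalIntegral.integral_eq_sub_of_hasDerivAt (a := a) (b := b)
    (f := fun x : ℝ => |x| ^ (2 * H)) (fun x _ => hasDerivAt_abs_rpow x (by linarith)) ?_
  · simp only [mul_assoc] at this
    rw [intervalIntegral.integral_const_mul, intervalIntegral.integral_const_mul] at this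
    rw [eq_div_iff (by linarith), ← this]; ring
  · simp only [mul_assoc]
    exact (((continuous_abs_rpow_mul hH).intervalIntegrable a b).const_mul H).const_mul 2

/-- This merges the white and the fractional case: from here on the time part of the noise enters
through `fbmCov` and `timePot` alone. -/
lemma integral_timePot (hH : 1 / 2 ≤ H) {S T : ℝ} (hS : 0 ≤ S) (hT : 0 ≤ T) :
    ∫ s in (0 : ℝ)..S, timePot H T s = fbmCov H S T := by
  rcases hH.eq_or_lt with rfl | hH
  · rw [fbmCov_half hS hT, intervalIntegral.integral_of_le hS]
    simp only [timePot, if_true]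
    rw [setIntegral_indicator measurableSet_Icc]
    have : Set.Ioc 0 S ∩ Set.Icc 0 T = Set.Ioc 0 (min S T) := by
      ext s; simp only [Set.mem_inter_iff, Set.mem_Ioc, Set.mem_Icc, le_min_iff]
      exact ⟨fun h => ⟨h.1.1, h.1.2, h.2.2⟩, fun h => ⟨⟨h.1, h.2.1⟩, h.1.le, h.2.2⟩⟩
    rw [this]
    simp [hS, hT]
  · simp only [timePot_eq hH]
    rw [intervalIntegral.integral_const_mul, intervalIntegral.integral_sub,
      intervalIntegral.integral_comp_sub_right (fun x => |x| ^ (2 * H - 2) * x),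
      integral_abs_rpow_mul hH, integral_abs_rpow_mul hH, fbmCov]
    · simp [Real.zero_rpow (by linarith : 2 * H ≠ 0)]
      field_simp
      ring
    · exact (continuous_abs_rpow_mul hH).intervalIntegrable _ _
    · exact ((continuous_abs_rpow_mul hH).comp (continuous_sub_right T)).intervalIntegrable _ _

lemma timePot_mul (hH : 1 / 2 ≤ H) {l : ℝ} (hl : 0 < l) (T s : ℝ) :
    timePot H (l * T) (l * s) = l ^ (2 * H - 1) * timePot H T s := by
  rcases hH.eq_or_lt with rfl | hH
  · simp only [timePot, if_true]
    rw [show (2 * (1 / 2) - 1 : ℝ) = 0 by norm_num, Real.rpow_zero, one_mul]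
    by_cases h : s ∈ Set.Icc 0 T
    · rw [Set.indicator_of_mem h, Set.indicator_of_mem]
      exact ⟨mul_nonneg hl.le h.1, mul_le_mul_of_nonneg_left h.2 hl.le⟩
    · rw [Set.indicator_of_notMem h, Set.indicator_of_notMem]
      exact fun h' => h ⟨nonneg_of_mul_nonneg_right h'.1 hl, le_of_mul_le_mul_left h'.2 hl⟩
  · rw [timePot_eq hH, timePot_eq hH, ← mul_sub, abs_mul, abs_mul, abs_of_pos hl,
      Real.mul_rpow hl.le (abs_nonneg _), Real.mul_rpow hl.le (abs_nonneg _),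
      show 2 * H - 1 = 2 * H - 2 + 1 by ring, Real.rpow_add_one hl.ne']
    ring

lemma measurable_timePot (hH : 1 / 2 ≤ H) (T : ℝ) : Measurable (timePot H T) := by
  rcases hH.eq_or_lt with rfl | hH
  · have : timePot (1 / 2) T = (Set.Icc 0 T).indicator fun _ => 1 := by
      ext s; simp only [timePot, if_true]
    rw [this]
    exact measurable_const.indicator measurableSet_Icc
  · have : timePot H T = fun s => H * (|s| ^ (2 * H - 2) * s - |s - T| ^ (2 * H - 2) * (s - T)) :=
      funext fun s => timePot_eq hH T s
    rw [this]
    fun_prop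

lemma exists_timePot_le (hH : 1 / 2 ≤ H) (T t : ℝ) :
    ∃ C, 0 ≤ C ∧ ∀ s ∈ Set.Icc 0 t, |timePot H T s| ≤ C := by
  rcases hH.eq_or_lt with rfl | hH
  · refine ⟨1, zero_le_one, fun s _ => ?_⟩
    simp only [timePot, if_true]
    by_cases h : s ∈ Set.Icc 0 T <;> simp [h]
  · have : timePot H T = fun s => H * (|s| ^ (2 * H - 2) * s - |s - T| ^ (2 * H - 2) * (s - T)) :=
      funext fun s => timePot_eq hH T s
    have hc : Continuous (timePot H T) := by
      rw [this]
      exact ((continuous_abs_rpow_mul hH).sub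
        ((continuous_abs_rpow_mul hH).comp (continuous_sub_right T))).const_mul H
    obtain ⟨C, hC⟩ := isCompact_Icc.exists_bound_of_continuousOn (s := Set.Icc 0 t) hc.continuousOn
    exact ⟨max C 0, le_max_right _ _, fun s hs => (hC s hs).trans (le_max_left _ _)⟩

end FBM

/-! ### The spatial covariance -/

section SpatialFourier

open scoped FourierTransform Convolution ContDiff

variable {d : ℕ} {f : Sp d → ℝ} {μ : Measure (Sp d)}

/-- A smooth compactly supported real function as a complex Schwartz function. -/
def testFun {g : Sp d → ℝ} (h₁ : HasCompactSupport g) (h₂ : ContDiff ℝ ∞ g) : 𝓢(Sp d, ℂ) :=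
  HasCompactSupport.toSchwartzMap (f := fun x => (g x : ℂ))
    (h₁.comp_left (g := fun r : ℝ => (r : ℂ)) Complex.ofReal_zero)
    (Complex.ofRealCLM.contDiff.comp h₂)

lemma testFun_apply {g : Sp d → ℝ} (h₁ : HasCompactSupport g) (h₂ : ContDiff ℝ ∞ g) (x : Sp d) :
    testFun h₁ h₂ x = (g x : ℂ) := rfl

lemma contDiff_comp_neg {g : Sp d → ℝ} (h : ContDiff ℝ ∞ g) : ContDiff ℝ ∞ fun x => g (-x) :=
  h.comp contDiff_neg

lemma hasCompactSupport_comp_neg {g : Sp d → ℝ} (h : HasCompactSupport g) :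
    HasCompactSupport fun x => g (-x) :=
  h.comp_homeomorph (Homeomorph.neg (Sp d))

lemma integral_exp_mul_comp_neg (g : Sp d → ℝ) (ξ : Sp d) :
    ∫ x, Complex.exp (-Complex.I * (inner ℝ ξ x : ℝ)) * (g (-x) : ℂ) =
      starRingEnd ℂ (∫ x, Complex.exp (-Complex.I * (inner ℝ ξ x : ℝ)) * (g x : ℂ)) := by
  rw [← integral_conj, ← integral_neg_eq_self]
  refine integral_congr_ae (Filter.Eventually.of_forall fun x => ?_)
  simp [← Complex.exp_conj, inner_neg_right]

/-- The two Fourier transforms differ in normalization, `e^{-iξ·x}` against `e^{-2πiξ·x}`, whence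
the rescaled argument. -/
lemma integral_exp_eq_fourier (s : 𝓢(Sp d, ℂ)) (ξ : Sp d) :
    ∫ x, Complex.exp (-Complex.I * (inner ℝ ξ x : ℝ)) * s x =
      𝓕 (s : Sp d → ℂ) ((2 * Real.pi)⁻¹ • ξ) := by
  rw [Real.fourier_eq']
  refine integral_congr_ae (Filter.Eventually.of_forall fun x => ?_)
  simp only [smul_eq_mul]
  congr 2
  rw [inner_smul_right, real_inner_comm]
  have : Real.pi ≠ 0 := Real.pi_ne_zero
  rw [show -2 * Real.pi * ((2 * Real.pi)⁻¹ * inner ℝ x ξ) = - inner ℝ x ξ by field_simp]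
  push_cast; ring

namespace IsSpatialKernel

/-- Reflecting a real test function conjugates its Fourier transform, hence conjugates the pairing
with `f`. Since `f` is real, so is the pairing, and `f` and its reflection have the same pairings.
-/
lemma ae_even (hf : IsSpatialKernel f μ) : ∀ᵐ x, f (-x) = f x := by
  have hl : LocallyIntegrable (fun x => f (-x)) volume := by
    rw [locallyIntegrable_iff]
    intro k hk
    have h1 := hf.locallyIntegrable.integrableOn_isCompact hk.neg
    rw [← (Measure.measurePreserving_neg (volume : Measure (Sp d))).integrableOn_comp_preimage
      (Homeomorph.neg (Sp d)).measurableEmbedding] at h1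
    simpa [Function.comp_def] using h1
  have := ae_eq_zero_of_integral_contDiff_smul_eq_zero (hl.sub hf.locallyIntegrable) ?_
  · filter_upwards [this] with x hx
    simpa [sub_eq_zero] using hx
  intro g hg hgc
  have i1 : Integrable fun x => g x * f x :=
    hf.locallyIntegrable.integrable_smul_left_of_hasCompactSupport hg.continuous hgc
  have i2 : Integrable fun x => g x * f (-x) :=
    hl.integrable_smul_left_of_hasCompactSupport hg.continuous hgc
  have h1 := hf.fourier (testFun hgc hg)
  have h2 := hf.fourier (testFun (hasCompactSupport_comp_neg hgc) (contDiff_comp_neg hg))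
  simp only [testFun_apply] at h1 h2
  simp only [integral_exp_mul_comp_neg] at h2
  rw [integral_conj, ← h1, ← integral_conj] at h2
  simp only [map_mul, Complex.conj_ofReal] at h2
  have h3 : ∫ x, f x * g (-x) = ∫ x, f x * g x := by
    apply Complex.ofReal_injective
    rw [← integral_complex_ofReal, ← integral_complex_ofReal]
    simpa using h2
  simp only [Pi.sub_apply, smul_eq_mul, mul_sub]
  rw [integral_sub i2 i1, sub_eq_zero]
  simp only [mul_comm (g _)]
  rw [← h3, ← integral_neg_eq_self]
  simp

/-- The autocorrelation of `g` is its convolution with its reflection, with Fourier transform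
`|ĝ|²`; the hypothesis on `f` turns the integral into `∫ |ĝ|² dμ`. -/
lemma autocorr_nonneg_of_smooth (hf : IsSpatialKernel f μ) {g : Sp d → ℝ}
    (hgc : HasCompactSupport g) (hg : ContDiff ℝ ∞ g) :
    0 ≤ ∫ z, f z * ∫ x, g x * g (x - z) := by
  set s₁ := testFun hgc hg with hs₁
  set s₂ := testFun (hasCompactSupport_comp_neg hgc) (contDiff_comp_neg hg) with hs₂
  set s := SchwartzMap.convolution (ContinuousLinearMap.mul ℂ ℂ) s₁ s₂ with hs
  have hsz : ∀ z, s z = ((∫ x, g x * g (x - z) : ℝ) : ℂ) := by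
    intro z
    rw [hs, SchwartzMap.convolution_apply, convolution, ← integral_complex_ofReal]
    refine integral_congr_ae (Filter.Eventually.of_forall fun x => ?_)
    simp [hs₁, hs₂, testFun_apply]
  have h1 := hf.fourier s
  have h2 : ∀ ξ, ∫ x, Complex.exp (-Complex.I * (inner ℝ ξ x : ℝ)) * s x =
      ((Complex.normSq (𝓕 (s₁ : Sp d → ℂ) ((2 * Real.pi)⁻¹ • ξ)) : ℝ) : ℂ) := by
    intro ξ
    have h3 : 𝓕 (s : Sp d → ℂ) ((2 * Real.pi)⁻¹ • ξ) =
        𝓕 (s₁ : Sp d → ℂ) ((2 * Real.pi)⁻¹ • ξ) * 𝓕 (s₂ : Sp d → ℂ) ((2 * Real.pi)⁻¹ • ξ) := by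
      have := SchwartzMap.fourier_convolution (ContinuousLinearMap.mul ℂ ℂ) s₁ s₂
      have := congrArg (fun u : 𝓢(Sp d, ℂ) => u ((2 * Real.pi)⁻¹ • ξ)) this
      simpa [SchwartzMap.fourier_coe] using this
    have h4 : 𝓕 (s₂ : Sp d → ℂ) ((2 * Real.pi)⁻¹ • ξ) =
        starRingEnd ℂ (𝓕 (s₁ : Sp d → ℂ) ((2 * Real.pi)⁻¹ • ξ)) := by
      rw [← integral_exp_eq_fourier, ← integral_exp_eq_fourier]
      exact integral_exp_mul_comp_neg g ξ
    rw [integral_exp_eq_fourier, h3, h4, Complex.mul_conj]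
  simp only [h2] at h1
  rw [integral_complex_ofReal] at h1
  simp only [hsz] at h1
  have h5 : ((∫ z, f z * ∫ x, g x * g (x - z) : ℝ) : ℂ) =
      ((∫ ξ, Complex.normSq (𝓕 (s₁ : Sp d → ℂ) ((2 * Real.pi)⁻¹ • ξ)) ∂μ : ℝ) : ℂ) := by
    rw [← h1, ← integral_complex_ofReal]
    simp
  rw [Complex.ofReal_injective h5]
  exact integral_nonneg fun _ => Complex.normSq_nonneg _

end IsSpatialKernel

end SpatialFourier

/-! ### Positive definiteness of `f` on bounded measurable functions of bounded support -/

section SpatialCov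

open scoped Convolution ContDiff

variable {d : ℕ} {f : Sp d → ℝ} {μ : Measure (Sp d)}

/-- Where the integrand is nonzero, `‖p.1‖ ≤ R` and `‖p.2‖ ≤ 2R`, so local integrability of `f`
suffices. The explicit majorant depends on `g` only through `M` and `R`, and so dominates a whole
approximating sequence. -/
lemma integrable_autocorr (hf : LocallyIntegrable f) {g : Sp d → ℝ} {M R : ℝ}
    (hgm : AEStronglyMeasurable g) (hgM : ∀ x, |g x| ≤ M) (hgR : ∀ x, g x ≠ 0 → ‖x‖ ≤ R) :
    Integrable (fun p : Sp d × Sp d => g p.1 * g (p.1 - p.2) * f p.2) (volume.prod volume) ∧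
    ∀ p : Sp d × Sp d, |g p.1 * g (p.1 - p.2) * f p.2| ≤
      (Metric.closedBall 0 R).indicator (fun _ => M * M) p.1 *
        (Metric.closedBall 0 (R + R)).indicator (fun x => |f x|) p.2 := by
  have hM : 0 ≤ M := (abs_nonneg _).trans (hgM 0)
  have hb : ∀ p : Sp d × Sp d, |g p.1 * g (p.1 - p.2) * f p.2| ≤
      (Metric.closedBall 0 R).indicator (fun _ => M * M) p.1 *
        (Metric.closedBall 0 (R + R)).indicator (fun x => |f x|) p.2 := by
    intro p
    have hr : 0 ≤ (Metric.closedBall 0 R).indicator (fun _ => M * M) p.1 *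
        (Metric.closedBall 0 (R + R)).indicator (fun x => |f x|) p.2 :=
      mul_nonneg (Set.indicator_nonneg (fun _ _ => mul_self_nonneg M) _)
        (Set.indicator_nonneg (fun _ _ => abs_nonneg _) _)
    by_cases h1 : g p.1 = 0
    · simpa [h1] using hr
    by_cases h2 : g (p.1 - p.2) = 0
    · simpa [h2] using hr
    have h3 := hgR _ h1
    have h4 : ‖p.2‖ ≤ R + R := by
      have := norm_sub_le p.1 (p.1 - p.2)
      rw [sub_sub_cancel] at this
      linarith [hgR _ h2]
    rw [Set.indicator_of_mem (by simpa using h3), Set.indicator_of_mem (by simpa using h4),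
      abs_mul, abs_mul]
    gcongr
    · exact hgM _
    · exact hgM _
  refine ⟨?_, hb⟩
  have hint : Integrable (fun p : Sp d × Sp d =>
      (Metric.closedBall 0 R).indicator (fun _ => M * M) p.1 *
        (Metric.closedBall 0 (R + R)).indicator (fun x => |f x|) p.2) (volume.prod volume) := by
    refine Integrable.mul_prod (f := (Metric.closedBall (0 : Sp d) R).indicator (fun _ => M * M))
      (g := (Metric.closedBall (0 : Sp d) (R + R)).indicator (fun x => |f x|)) ?_ ?_
    · exact (integrable_indicator_iff Metric.isClosed_closedBall.measurableSet).2
        (integrableOn_const measure_closedBall_lt_top.ne)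
    · exact (integrable_indicator_iff Metric.isClosed_closedBall.measurableSet).2
        (hf.integrableOn_isCompact (isCompact_closedBall _ _)).abs
  refine hint.mono' ?_ (Filter.Eventually.of_forall hb)
  refine (hgm.comp_fst.mul ?_).mul hf.aestronglyMeasurable.comp_snd
  exact hgm.comp_quasiMeasurePreserving (quasiMeasurePreserving_sub volume volume)

/-- Mollification keeps the bound `M` and enlarges the support by at most `1`. Both factors `g(x)`
and `g(x-z)` converge almost everywhere on the product space, so dominated convergence carries over
the smooth case. -/
lemma IsSpatialKernel.autocorr_nonneg (hf : IsSpatialKernel f μ) {g : Sp d → ℝ} {M R : ℝ}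
    (hgm : Measurable g) (hgM : ∀ x, |g x| ≤ M) (hgR : ∀ x, g x ≠ 0 → ‖x‖ ≤ R) :
    0 ≤ ∫ x, g x * ∫ y, g y * f (x - y) := by
  have hgli : Integrable g := by
    have : Integrable ((Metric.closedBall (0 : Sp d) R).indicator (fun _ => M)) :=
      (integrable_indicator_iff Metric.isClosed_closedBall.measurableSet).2
        (integrableOn_const measure_closedBall_lt_top.ne)
    refine this.mono' hgm.aestronglyMeasurable (Filter.Eventually.of_forall fun x => ?_)
    by_cases h : g x = 0
    · rw [h, norm_zero]
      exact Set.indicator_nonneg (fun _ _ => (abs_nonneg _).trans (hgM 0)) _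
    · rw [Set.indicator_of_mem (by simpa using hgR x h)]
      exact hgM x
  -- smooth approximations
  let b : ℕ → ContDiffBump (0 : Sp d) := fun n =>
    ⟨1 / (n + 2), 2 / (n + 2), by positivity, by gcongr; norm_num⟩
  let gn : ℕ → Sp d → ℝ := fun n =>
    ((b n).normed volume ⋆[ContinuousLinearMap.lsmul ℝ ℝ, volume] g : Sp d → ℝ)
  have hbo : ∀ n, (b n).rOut = 2 / (n + 2) := fun n => rfl
  have hb1 : ∀ n, (b n).rOut ≤ 1 := fun n => by
    rw [hbo, div_le_one (by positivity)]; linarith [n.cast_nonneg (α := ℝ)]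
  have hlim : ∀ᵐ x, Filter.Tendsto (fun n => gn n x) Filter.atTop (nhds (g x)) := by
    refine ContDiffBump.ae_convolution_tendsto_right_of_locallyIntegrable (K := 2) ?_ ?_
      hgli.locallyIntegrable
    · simp only [hbo]
      have h1 := tendsto_const_div_atTop_nhds_zero_nat (2 : ℝ)
      have h2 := (Filter.tendsto_add_atTop_iff_nat 2).2 h1
      simpa using h2
    · refine Filter.Eventually.of_forall fun n => ?_
      change 2 / ((n : ℝ) + 2) ≤ 2 * (1 / (n + 2))
      rw [mul_one_div]
  have hgc : HasCompactSupport g := HasCompactSupport.intro (isCompact_closedBall (0 : Sp d) R)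
    fun x hx => by
      by_contra h
      exact hx (by simpa using hgR x h)
  have hgnc : ∀ n, HasCompactSupport (gn n) := fun n =>
    (b n).hasCompactSupport_normed.convolution _ hgc
  have hgns : ∀ n, ContDiff ℝ ∞ (gn n) := fun n =>
    (b n).hasCompactSupport_normed.contDiff_convolution_left _ (b n).contDiff_normed
      hgli.locallyIntegrable
  have hgnM : ∀ n x, |gn n x| ≤ M := by
    intro n x
    change |∫ t, (b n).normed volume t * g (x - t)| ≤ M
    calc _ ≤ ∫ t, (b n).normed volume t * M := by
          refine (Real.norm_eq_abs _).symm.le.trans (norm_integral_le_of_norm_le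
            ((b n).integrable_normed.mul_const M) (Filter.Eventually.of_forall fun t => ?_))
          rw [norm_mul, Real.norm_of_nonneg ((b n).nonneg_normed t)]
          exact mul_le_mul_of_nonneg_left (hgM _) ((b n).nonneg_normed t)
      _ = M := by rw [integral_mul_const, (b n).integral_normed, one_mul]
  have hgnR : ∀ n x, gn n x ≠ 0 → ‖x‖ ≤ R + 1 := by
    intro n x hx
    have h1 := support_convolution_subset_swap (ContinuousLinearMap.lsmul ℝ ℝ) (μ := volume)
      (f := (b n).normed volume) (g := g) hx
    obtain ⟨u, hu, v, hv, rfl⟩ := h1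
    rw [(b n).support_normed_eq] at hv
    have h2 : ‖v‖ < (b n).rOut := by simpa using hv
    exact (norm_add_le _ _).trans (add_le_add (hgR u hu) (h2.le.trans (hb1 n)))
  have hQ : ∀ {k : Sp d → ℝ} {R' : ℝ}, AEStronglyMeasurable k → (∀ x, |k x| ≤ M) →
      (∀ x, k x ≠ 0 → ‖x‖ ≤ R') → ∫ z, f z * ∫ x, k x * k (x - z) =
      ∫ p : Sp d × Sp d, k p.1 * k (p.1 - p.2) * f p.2 ∂(volume.prod volume) := by
    intro k R' hk hkM hkR
    rw [integral_prod_symm _ (integrable_autocorr hf.locallyIntegrable hk hkM hkR).1]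
    simp only [integral_mul_const, mul_comm (f _)]
  have hnn : ∀ n, 0 ≤ ∫ p : Sp d × Sp d, gn n p.1 * gn n (p.1 - p.2) * f p.2
      ∂(volume.prod volume) := fun n => by
    rw [← hQ (hgns n).continuous.aestronglyMeasurable (hgnM n) (hgnR n)]
    exact hf.autocorr_nonneg_of_smooth (hgnc n) (hgns n)
  have hgR' : ∀ x, g x ≠ 0 → ‖x‖ ≤ R + 1 := fun x hx => (hgR x hx).trans (by linarith)
  have hconv : Filter.Tendsto (fun n => ∫ p : Sp d × Sp d, gn n p.1 * gn n (p.1 - p.2) * f p.2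
      ∂(volume.prod volume)) Filter.atTop (nhds (∫ p : Sp d × Sp d, g p.1 * g (p.1 - p.2) * f p.2
      ∂(volume.prod volume))) := by
    have hint : Integrable (fun p : Sp d × Sp d =>
        (Metric.closedBall 0 (R + 1)).indicator (fun _ => M * M) p.1 *
        (Metric.closedBall 0 (R + 1 + (R + 1))).indicator (fun x => |f x|) p.2)
          (volume.prod volume) := by
      refine Integrable.mul_prod
        (f := (Metric.closedBall (0 : Sp d) (R + 1)).indicator (fun _ => M * M))
        (g := (Metric.closedBall (0 : Sp d) (R + 1 + (R + 1))).indicator (fun x => |f x|)) ?_ ?_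
      · exact (integrable_indicator_iff Metric.isClosed_closedBall.measurableSet).2
          (integrableOn_const measure_closedBall_lt_top.ne)
      · exact (integrable_indicator_iff Metric.isClosed_closedBall.measurableSet).2
          (hf.locallyIntegrable.integrableOn_isCompact (isCompact_closedBall _ _)).abs
    refine tendsto_integral_of_dominated_convergence _ (fun n =>
      (integrable_autocorr hf.locallyIntegrable (hgns n).continuous.aestronglyMeasurable (hgnM n)
        (hgnR n)).1.aestronglyMeasurable) hint (fun n => Filter.Eventually.of_forall
        (integrable_autocorr hf.locallyIntegrable (hgns n).continuous.aestronglyMeasurable (hgnM n)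
        (hgnR n)).2) ?_
    filter_upwards [Measure.quasiMeasurePreserving_fst.ae hlim,
      (quasiMeasurePreserving_sub volume volume).ae hlim] with p h1 h2
    exact (h1.mul h2).mul_const _
  have hfin := ge_of_tendsto' hconv hnn
  rw [integral_prod _ (integrable_autocorr hf.locallyIntegrable hgm.aestronglyMeasurable hgM
    hgR).1] at hfin
  refine hfin.trans_eq (integral_congr_ae (Filter.Eventually.of_forall fun x => ?_))
  simp only [mul_assoc, integral_const_mul]
  congr 1
  rw [← integral_sub_left_eq_self _ volume x]
  simp

end SpatialCov

/-! ### Space potentials and the factorization of the noise covariance -/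

section SpacePot

variable {d : ℕ} {f : Sp d → ℝ} {μ : Measure (Sp d)}

/-- The potential of `1_A` with respect to the covariance in space. -/
def spacePot (f : Sp d → ℝ) (A : Set (Sp d)) (y : Sp d) : ℝ := ∫ x in A, f (y - x)

/-- The covariance in space. -/
def spaceCov (f : Sp d → ℝ) (A B : Set (Sp d)) : ℝ := ∫ x in A, ∫ y in B, f (x - y)

lemma spaceCov_eq (f : Sp d → ℝ) (A B : Set (Sp d)) :
    spaceCov f A B = ∫ x in A, spacePot f B x := rfl

/-- Allows `f`, which is only almost everywhere measurable, to be replaced by a measurable version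
without changing any value of the potential. -/
lemma spacePot_congr {f' : Sp d → ℝ} (h : f =ᵐ[volume] f') (A : Set (Sp d)) :
    spacePot f A = spacePot f' A := by
  ext y
  refine integral_congr_ae (ae_restrict_of_ae ?_)
  have := (Measure.measurePreserving_sub_left (volume : Measure (Sp d)) y).quasiMeasurePreserving.ae h
  exact this

/-- Translation of a set. -/
abbrev shift (k : Sp d) (A : Set (Sp d)) : Set (Sp d) := (fun x => x - k) ⁻¹' A

lemma spacePot_shift (k : Sp d) (A : Set (Sp d)) (y : Sp d) :
    spacePot f (shift k A) y = spacePot f A (y - k) := by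
  unfold spacePot
  have := (measurePreserving_sub_right (volume : Measure (Sp d)) k).setIntegral_preimage_emb
    (Homeomorph.subRight k).measurableEmbedding (fun x => f (y - k - x)) A
  rw [← this]
  simp

lemma spaceCov_shift (k : Sp d) (A B : Set (Sp d)) :
    spaceCov f (shift k A) (shift k B) = spaceCov f A B := by
  simp only [spaceCov_eq, spacePot_shift]
  exact (measurePreserving_sub_right (volume : Measure (Sp d)) k).setIntegral_preimage_emb
    (Homeomorph.subRight k).measurableEmbedding (fun x => spacePot f B x) A

namespace IsSpatialKernel

lemma measurable_spacePot (hf : IsSpatialKernel f μ) (A : Set (Sp d)) :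
    Measurable (spacePot f A) := by
  have h1 := hf.locallyIntegrable.aestronglyMeasurable
  rw [spacePot_congr h1.ae_eq_mk A]
  have : StronglyMeasurable fun p : Sp d × Sp d => h1.mk f (p.1 - p.2) :=
    h1.stronglyMeasurable_mk.comp_measurable (measurable_fst.sub measurable_snd)
  exact this.integral_prod_right.measurable

/-- Cover `A` by finitely many unit balls. The map `x ↦ y - x` sends each to a unit ball, where
uniform local integrability gives a bound independent of `y`. Thus potentials of bounded sets are
bounded on the whole space. -/
lemma exists_lintegral_le (hf : IsSpatialKernel f μ) {A : Set (Sp d)}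
    (hb : Bornology.IsBounded A) :
    ∃ C : ℝ≥0, ∀ y, ∫⁻ x in A, ‖f (y - x)‖ₑ ≤ C := by
  obtain ⟨C, hC⟩ := hf.uniform
  obtain ⟨t, ht, hAt⟩ := Metric.totallyBounded_iff.1
    (Metric.isBounded_iff_subset_closedBall 0 |>.1 hb |>.choose_spec |> fun h =>
      (isCompact_closedBall (0 : Sp d) _).totallyBounded.subset h) 1 one_pos
  refine ⟨∑ _i ∈ ht.toFinset, C, fun y => ?_⟩
  calc ∫⁻ x in A, ‖f (y - x)‖ₑ ≤ ∫⁻ x in ⋃ i ∈ ht.toFinset, Metric.ball i 1, ‖f (y - x)‖ₑ := by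
        refine lintegral_mono_set ?_
        simpa using hAt
    _ ≤ ∑ i ∈ ht.toFinset, ∫⁻ x in Metric.ball i 1, ‖f (y - x)‖ₑ := by
        generalize ht.toFinset = S
        classical
        induction S using Finset.induction_on with
        | empty => simp
        | insert i S hi ih =>
          rw [Finset.set_biUnion_insert, Finset.sum_insert hi]
          exact (lintegral_union_le _ _ _).trans (add_le_add_right ih _)
    _ ≤ ∑ _i ∈ ht.toFinset, (C : ℝ≥0∞) := by
        refine Finset.sum_le_sum fun i _ => ?_
        refine le_trans (le_of_eq ?_) (hC (y - i))
        have h := (Measure.measurePreserving_sub_left (volume : Measure (Sp d)) y).setLIntegral_comp_preimage_emb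
          (Homeomorph.subLeft y).measurableEmbedding (fun x => ‖f x‖ₑ) (Metric.ball (y - i) 1)
        rw [← h]
        congr 2
        ext x
        simp only [Metric.mem_ball, Set.mem_preimage, dist_sub_left]
    _ = _ := by push_cast; rfl

lemma integrableOn_sub (hf : IsSpatialKernel f μ) {A : Set (Sp d)}
    (hb : Bornology.IsBounded A) (y : Sp d) : IntegrableOn (fun x => f (y - x)) A := by
  obtain ⟨C, hC⟩ := hf.exists_lintegral_le hb
  refine ⟨?_, lt_of_le_of_lt (hC y) ENNReal.coe_lt_top⟩
  exact (hf.locallyIntegrable.aestronglyMeasurable.comp_quasiMeasurePreserving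
    (Measure.measurePreserving_sub_left (volume : Measure (Sp d)) y).quasiMeasurePreserving).restrict

lemma exists_spacePot_le (hf : IsSpatialKernel f μ) {A : Set (Sp d)}
    (hb : Bornology.IsBounded A) : ∃ C, 0 ≤ C ∧ ∀ y, |spacePot f A y| ≤ C := by
  obtain ⟨C, hC⟩ := hf.exists_lintegral_le hb
  refine ⟨C, C.2, fun y => ?_⟩
  have h1 := enorm_integral_le_lintegral_enorm (μ := volume.restrict A) fun x => f (y - x)
  have h2 := h1.trans (hC y)
  rw [← Real.norm_eq_abs, ← coe_nnnorm]
  exact_mod_cast h2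

lemma integrableOn_spacePot (hf : IsSpatialKernel f μ) {A B : Set (Sp d)}
    (hA : Bornology.IsBounded A) (hBb : Bornology.IsBounded B) :
    IntegrableOn (spacePot f B) A := by
  obtain ⟨C, hC, h⟩ := hf.exists_spacePot_le hBb
  refine Measure.integrableOn_of_bounded (M := C) hA.measure_lt_top.ne
    (hf.measurable_spacePot B).aestronglyMeasurable (Filter.Eventually.of_forall h)

lemma integrable_prod_sub (hf : IsSpatialKernel f μ) {A B : Set (Sp d)}
    (hA : Bornology.IsBounded A) (hB : Bornology.IsBounded B) :
    Integrable (fun p : Sp d × Sp d => f (p.1 - p.2))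
      ((volume.restrict A).prod (volume.restrict B)) := by
  obtain ⟨C, hC⟩ := hf.exists_lintegral_le hB
  have hm : AEStronglyMeasurable (fun p : Sp d × Sp d => f (p.1 - p.2)) (volume.prod volume) :=
    hf.locallyIntegrable.aestronglyMeasurable.comp_quasiMeasurePreserving
      (quasiMeasurePreserving_sub volume volume)
  rw [Measure.prod_restrict]
  refine ⟨hm.restrict, ?_⟩
  rw [← Measure.prod_restrict]
  have hm' : AEMeasurable (fun p : Sp d × Sp d => ‖f (p.1 - p.2)‖ₑ)
      ((volume.restrict A).prod (volume.restrict B)) := by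
    rw [Measure.prod_restrict]; exact hm.restrict.enorm
  rw [HasFiniteIntegral, lintegral_prod _ hm']
  calc _ ≤ ∫⁻ _ in A, (C : ℝ≥0∞) := lintegral_mono fun x => hC x
    _ < ∞ := by
      rw [setLIntegral_const]
      exact ENNReal.mul_lt_top ENNReal.coe_lt_top hA.measure_lt_top

lemma spaceCov_comm (hf : IsSpatialKernel f μ) {A B : Set (Sp d)}
    (hA : Bornology.IsBounded A) (hB : Bornology.IsBounded B) :
    spaceCov f A B = spaceCov f B A := by
  unfold spaceCov
  rw [integral_integral_swap (f := fun x y => f (x - y)) (hf.integrable_prod_sub hA hB)]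
  refine integral_congr_ae (Filter.Eventually.of_forall fun y => ?_)
  refine integral_congr_ae (ae_restrict_of_ae ?_)
  have := (Measure.measurePreserving_sub_left (volume : Measure (Sp d)) y).quasiMeasurePreserving.ae
    hf.ae_even
  filter_upwards [this] with x hx
  simpa using hx

/-- The covariance in space as a kernel on rectangles. -/
lemma isPSDKernel_spaceCov (hf : IsSpatialKernel f μ) :
    IsPSDKernel fun a b : Rect d => spaceCov f a.set b.set := by
  refine ⟨fun a b => hf.spaceCov_comm a.bounded b.bounded, fun c => ?_⟩
  -- The quadratic form of the coefficients `c` is the autocorrelation of the step function `g`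
  -- tested against `f`.
  set g : Sp d → ℝ := fun x => ∑ a ∈ c.support, c a * a.set.indicator (fun _ => 1) x with hg
  have hgm : Measurable g := Finset.measurable_fun_sum _ fun a _ =>
    (measurable_const.indicator a.measurableSet).const_mul _
  have hgM : ∀ x, |g x| ≤ ∑ a ∈ c.support, |c a| := by
    intro x
    refine (Finset.abs_sum_le_sum_abs _ _).trans (Finset.sum_le_sum fun a _ => ?_)
    rw [abs_mul]
    refine mul_le_of_le_one_right (abs_nonneg _) ?_
    by_cases h : x ∈ a.set <;> simp [h]
  obtain ⟨R, hR⟩ : ∃ R, ⋃ a ∈ c.support, a.set ⊆ Metric.closedBall 0 R :=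
    (Metric.isBounded_iff_subset_closedBall 0).1
      ((Bornology.isBounded_biUnion_finset _).2 fun a _ => a.bounded)
  have hgR : ∀ x, g x ≠ 0 → ‖x‖ ≤ R := by
    intro x hx
    obtain ⟨a, ha, hax⟩ := Finset.exists_ne_zero_of_sum_ne_zero hx
    have hxa : x ∈ a.set := by
      by_contra h
      exact hax (by simp [h])
    simpa using hR (Set.mem_biUnion ha hxa)
  refine (hf.autocorr_nonneg hgm hgM hgR).trans_eq ?_
  have h1 : ∀ x, ∫ y, g y * f (x - y) = ∑ b ∈ c.support, c b * spacePot f b.set x := by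
    intro x
    simp only [hg, Finset.sum_mul]
    have e : ∀ (b : Rect d) (y : Sp d), c b * b.set.indicator (fun _ => (1 : ℝ)) y * f (x - y) =
        c b * b.set.indicator (fun y => f (x - y)) y := by
      intro b y
      by_cases h : y ∈ b.set <;> simp [h]
    simp only [e]
    rw [integral_finsetSum _ fun b _ => ((integrable_indicator_iff b.measurableSet).2
      (hf.integrableOn_sub b.bounded x)).const_mul _]
    refine Finset.sum_congr rfl fun b _ => ?_
    rw [integral_const_mul, integral_indicator b.measurableSet, spacePot]
  simp only [h1]
  have e : ∀ x, g x * ∑ b ∈ c.support, c b * spacePot f b.set x = ∑ a ∈ c.support,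
      ∑ b ∈ c.support, c a * (c b * a.set.indicator (fun x => spacePot f b.set x) x) := by
    intro x
    rw [hg, Finset.sum_mul_sum]
    refine Finset.sum_congr rfl fun a _ => Finset.sum_congr rfl fun b _ => ?_
    by_cases h : x ∈ a.set <;> simp [h]
  simp only [e]
  have hi : ∀ a b : Rect d, Integrable fun x =>
      c a * (c b * a.set.indicator (fun x => spacePot f b.set x) x) := fun a b =>
    (((integrable_indicator_iff a.measurableSet).2 (hf.integrableOn_spacePot a.bounded
      b.bounded)).const_mul _).const_mul _
  rw [integral_finsetSum _ fun a _ => integrable_finsetSum _ fun b _ => hi a b]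
  refine Finset.sum_congr rfl fun a _ => ?_
  rw [integral_finsetSum _ fun b _ => hi a b]
  refine Finset.sum_congr rfl fun b _ => ?_
  rw [integral_const_mul, integral_const_mul, integral_indicator a.measurableSet]
  rfl

end IsSpatialKernel

variable {H : ℝ}

lemma pot_eq (a : Rect d) (z : ℝ × Sp d) :
    pot H f a z = timePot H a.time z.1 * spacePot f a.set z.2 := by
  unfold pot timePot spacePot
  split_ifs with h
  · by_cases hz : z.1 ∈ Set.Icc 0 a.time <;> simp [hz]
  · simp only [integral_const_mul, intervalIntegral.integral_mul_const]
    ring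

lemma rectCov_eq (hH : 1 / 2 ≤ H) (a b : Rect d) :
    rectCov H f a b = fbmCov H a.time b.time * spaceCov f a.set b.set := by
  unfold rectCov
  split_ifs with h
  · subst h
    rw [fbmCov_half a.time_nonneg b.time_nonneg]; rfl
  · rw [← integral_timePot hH a.time_nonneg b.time_nonneg]
    simp only [timePot, if_neg h, integral_const_mul, intervalIntegral.integral_mul_const,
      intervalIntegral.integral_const_mul, spaceCov]
    ring

/-- Schur product of the time and space kernels. Without it `preInner` would take its default value
zero; with it the inner products in `HP` are the prescribed covariances. -/
lemma IsSpatialKernel.isPSDKernel_rectCov (hf : IsSpatialKernel f μ) (hH : 1 / 2 ≤ H)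
    (hH1 : H < 1) : IsPSDKernel (rectCov H f) := by
  have h1 := (IsPSDKernel.comap (isPSDKernel_fbmCov (H := H) (by linarith) hH1)
    (Rect.time (d := d))).mul hf.isPSDKernel_spaceCov
  have : rectCov H f = fun a b : Rect d => fbmCov H a.time b.time * spaceCov f a.set b.set := by
    ext a b; exact rectCov_eq hH a b
  rw [this]
  exact h1

lemma IsSpatialKernel.inner_ind (hf : IsSpatialKernel f μ) (hH : 1 / 2 ≤ H) (hH1 : H < 1)
    (a b : Rect d) : inner ℝ (ind H f a) (ind H f b) =
      fbmCov H a.time b.time * spaceCov f a.set b.set := by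
  rw [← rectCov_eq hH]
  exact inner_gen _ (hf.isPSDKernel_rectCov hH hH1) a b

lemma IsSpatialKernel.measurable_pot (hf : IsSpatialKernel f μ) (hH : 1 / 2 ≤ H) (a : Rect d) :
    Measurable (pot H f a) := by
  have : pot H f a = fun z => timePot H a.time z.1 * spacePot f a.set z.2 :=
    funext fun z => pot_eq a z
  rw [this]
  exact ((measurable_timePot hH _).comp measurable_fst).mul
    ((hf.measurable_spacePot a.set).comp measurable_snd)

lemma IsSpatialKernel.exists_pot_le (hf : IsSpatialKernel f μ) (hH : 1 / 2 ≤ H) (a : Rect d)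
    (t : ℝ) : ∃ C, 0 ≤ C ∧ ∀ z : ℝ × Sp d, z.1 ∈ Set.Icc 0 t → |pot H f a z| ≤ C := by
  obtain ⟨C, hC, h⟩ := exists_timePot_le hH a.time t
  obtain ⟨C', hC', h'⟩ := hf.exists_spacePot_le a.bounded
  refine ⟨C * C', mul_nonneg hC hC', fun z hz => ?_⟩
  rw [pot_eq, abs_mul]
  exact mul_le_mul (h _ hz) (h' _) (abs_nonneg _) hC

end SpacePot

/-! ### Heat kernel bounds -/

section Heat

variable {d : ℕ}

lemma heatKernel_nonneg (t : ℝ) (x : Sp d) : 0 ≤ heatKernel t x := by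
  unfold heatKernel
  split_ifs with h
  · positivity
  · exact le_rfl

lemma measurable_heatKernel : Measurable fun p : ℝ × Sp d => heatKernel p.1 p.2 := by
  unfold heatKernel
  refine Measurable.ite (measurableSet_lt measurable_const measurable_fst) ?_ measurable_const
  fun_prop

lemma integral_heatKernel {t : ℝ} (ht : 0 < t) : ∫ y : Sp d, heatKernel t y = 1 := by
  have h := GaussianFourier.integral_rexp_neg_mul_sq_norm (V := Sp d) (b := 1 / (2 * t))
    (by positivity)
  have e : ∀ y : Sp d, heatKernel t y =
      (2 * Real.pi * t) ^ (-(d : ℝ) / 2) * Real.exp (-(1 / (2 * t)) * ‖y‖ ^ 2) := by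
    intro y
    rw [heatKernel, if_pos ht]
    congr 2
    field_simp
  simp only [e, integral_const_mul, h, finrank_euclideanSpace_fin]
  rw [show Real.pi / (1 / (2 * t)) = 2 * Real.pi * t by field_simp, neg_div,
    Real.rpow_neg (by positivity)]
  exact inv_mul_cancel₀ (by positivity)

lemma lintegral_heatKernel_le (t : ℝ) (x : Sp d) : ∫⁻ y, ‖heatKernel t (x - y)‖ₑ ≤ 1 := by
  rw [lintegral_sub_left_eq_self (μ := (volume : Measure (Sp d))) (fun y => ‖heatKernel t y‖ₑ) x]
  by_cases ht : 0 < t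
  · have hi : Integrable (heatKernel t : Sp d → ℝ) := by
      by_contra h
      have := integral_heatKernel (d := d) ht
      rw [integral_undef h] at this
      exact zero_ne_one this
    rw [← ofReal_integral_norm_eq_lintegral_enorm hi]
    simp [Real.norm_of_nonneg (heatKernel_nonneg _ _), integral_heatKernel ht]
  · simp [heatKernel, ht]

lemma abs_heatSemigroup_le (u₀ : Sp d →ᵇ ℝ) (t : ℝ) (x : Sp d) :
    |heatSemigroup t u₀ x| ≤ ‖u₀‖ := by
  unfold heatSemigroup
  split_ifs with h
  · exact u₀.norm_coe_le_norm x
  · have h1 : ‖∫ y, heatKernel t (x - y) * u₀ y‖ₑ ≤ ‖u₀‖ₑ := by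
      calc _ ≤ ∫⁻ y, ‖heatKernel t (x - y) * u₀ y‖ₑ := enorm_integral_le_lintegral_enorm _
        _ ≤ ∫⁻ y, ‖heatKernel t (x - y)‖ₑ * ‖u₀‖ₑ := by
          refine lintegral_mono fun y => ?_
          rw [enorm_mul]
          gcongr
          exact enorm_le_iff_norm_le.2 (u₀.norm_coe_le_norm y)
        _ = (∫⁻ y, ‖heatKernel t (x - y)‖ₑ) * ‖u₀‖ₑ := lintegral_mul_const' _ _ (by simp)
        _ ≤ 1 * ‖u₀‖ₑ := by gcongr; exact lintegral_heatKernel_le t x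
        _ = _ := one_mul _
    simpa using enorm_le_iff_norm_le.1 h1

lemma measurable_heatSemigroup (u₀ : Sp d →ᵇ ℝ) :
    Measurable fun p : ℝ × Sp d => heatSemigroup p.1 u₀ p.2 := by
  unfold heatSemigroup
  refine Measurable.ite (measurable_fst (measurableSet_singleton 0))
    (u₀.continuous.measurable.comp measurable_snd) ?_
  have : Measurable fun q : (ℝ × Sp d) × Sp d => heatKernel q.1.1 (q.1.2 - q.2) * u₀ q.2 :=
    (measurable_heatKernel.comp (measurable_fst.fst.prodMk (measurable_fst.snd.sub
      measurable_snd))).mul (u₀.continuous.measurable.comp measurable_snd)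
  exact this.stronglyMeasurable.integral_prod_right.measurable

/-- The transition density from `z` to `(t,x)`, for `z` with time in `(0,t)`. -/
def heatStep (t : ℝ) (x : Sp d) (z : ℝ × Sp d) : ℝ :=
  if 0 < z.1 ∧ z.1 < t then heatKernel (t - z.1) (x - z.2) else 0

lemma measurable_heatStep :
    Measurable fun p : (ℝ × Sp d) × (ℝ × Sp d) => heatStep p.1.1 p.1.2 p.2 := by
  unfold heatStep
  refine Measurable.ite ((measurableSet_lt measurable_const measurable_snd.fst).inter
    (measurableSet_lt measurable_snd.fst measurable_fst.fst)) ?_ measurable_const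
  exact measurable_heatKernel.comp ((measurable_fst.fst.sub measurable_snd.fst).prodMk
    (measurable_fst.snd.sub measurable_snd.snd))

lemma measurable_heatStep_right (t : ℝ) (x : Sp d) : Measurable (heatStep t x) :=
  measurable_heatStep.comp (measurable_const (a := (t, x)) |>.prodMk measurable_id)

/-- Integrating the heat kernel in space costs a factor at most one, so only the time weight is
left. -/
lemma lintegral_heatStep_mul_le (t : ℝ) (x : Sp d) {w : ℝ → ℝ≥0∞} (hw : Measurable w) :
    ∫⁻ z : ℝ × Sp d, ‖heatStep t x z‖ₑ * w z.1 ≤ ∫⁻ s in Set.Ioo 0 t, w s := by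
  have hm : Measurable fun z : ℝ × Sp d => ‖heatStep t x z‖ₑ * w z.1 :=
    (measurable_heatStep_right t x).enorm.mul (hw.comp measurable_fst)
  rw [Measure.volume_eq_prod, lintegral_prod _ hm.aemeasurable,
    ← lintegral_indicator measurableSet_Ioo]
  refine lintegral_mono fun s => ?_
  by_cases hs : 0 < s ∧ s < t
  · rw [Set.indicator_of_mem (show s ∈ Set.Ioo 0 t from hs)]
    simp only [heatStep, if_pos hs]
    rw [lintegral_mul_const]
    · calc _ ≤ 1 * w s := by gcongr; exact lintegral_heatKernel_le _ _
        _ = w s := one_mul _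
    · exact (measurable_heatKernel.comp (measurable_const.prodMk
        (measurable_const.sub measurable_id))).enorm
  · simp [heatStep, hs]

end Heat

/-! ### Recursion, support and integrability of the chaos kernels -/

section ChaosKernel

variable {d : ℕ}

/-- The kernel `chaosKernel` on increasing times. -/
def simplexKernel (u₀ : Sp d → ℝ) : ∀ n : ℕ, ℝ → Sp d → (Fin n → ℝ × Sp d) → ℝ
  | 0, t, x, _ => heatSemigroup t u₀ x
  | n + 1, t, x, z => heatStep t x (z (Fin.last n)) *
      simplexKernel u₀ n (z (Fin.last n)).1 (z (Fin.last n)).2 (fun j => z j.castSucc)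

/-- The recursion peels off the latest point: the ordering condition splits into the same condition
for the earlier points, with that point as new endpoint, and its time being below `t`. -/
lemma simplexKernel_eq (u₀ : Sp d → ℝ) (n : ℕ) (t : ℝ) (x : Sp d) (z : Fin n → ℝ × Sp d)
    [Decidable ((∀ j, 0 < (z j).1) ∧
      StrictMono (Fin.snoc (fun j => (z j).1) t : Fin (n + 1) → ℝ))] :
    simplexKernel u₀ n t x z =
      if (∀ j, 0 < (z j).1) ∧ StrictMono (Fin.snoc (fun j => (z j).1) t : Fin (n + 1) → ℝ) then
        (∏ j : Fin n, heatKernel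
          ((Fin.snoc (fun j => (z j).1) t : Fin (n + 1) → ℝ) j.succ -
            (Fin.snoc (fun j => (z j).1) t : Fin (n + 1) → ℝ) j.castSucc)
          ((Fin.snoc (fun j => (z j).2) x : Fin (n + 1) → Sp d) j.succ -
            (Fin.snoc (fun j => (z j).2) x : Fin (n + 1) → Sp d) j.castSucc)) *
        heatSemigroup ((Fin.snoc (fun j => (z j).1) t : Fin (n + 1) → ℝ) 0) u₀
          ((Fin.snoc (fun j => (z j).2) x : Fin (n + 1) → Sp d) 0)
      else 0 := by
  classical
  induction n generalizing t x with
  | zero =>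
    have : StrictMono (Fin.snoc (fun j => (z j).1) t : Fin 1 → ℝ) := fun i j h => by omega
    rw [if_pos ⟨fun j => j.elim0, this⟩]
    simp [simplexKernel, Fin.snoc]
  | succ n ih =>
    have e1 : ∀ (α : Type) (v : Fin (n + 1) → α) (t : α),
        (fun j : Fin (n + 1) => (Fin.snoc v t : Fin (n + 2) → α) j.castSucc) = v := by
      intro α v t; ext j; simp
    have e2 : ∀ (α : Type) (v : Fin (n + 1) → α),
        (Fin.snoc (fun j => v j.castSucc) (v (Fin.last n)) : Fin (n + 1) → α) = v := by
      intro α v; exact Fin.snoc_init_self v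
    have hmono : StrictMono (Fin.snoc (fun j => (z j).1) t : Fin (n + 2) → ℝ) ↔
        StrictMono (fun j => (z j).1) ∧ (z (Fin.last n)).1 < t := by
      rw [Fin.strictMono_iff_lt_succ, Fin.forall_fin_succ', Fin.strictMono_iff_lt_succ]
      simp [← Fin.castSucc_succ]
    rw [simplexKernel, ih]
    rw [e2 ℝ (fun j => (z j).1), e2 (Sp d) (fun j => (z j).2)]
    by_cases hc : (∀ j, 0 < (z j).1) ∧
      StrictMono (Fin.snoc (fun j => (z j).1) t : Fin (n + 2) → ℝ)
    · rw [if_pos hc, if_pos ⟨fun j => hc.1 _, (hmono.1 hc.2).1⟩, heatStep,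
        if_pos ⟨hc.1 _, (hmono.1 hc.2).2⟩, Fin.prod_univ_castSucc (n := n)]
      simp only [Fin.succ_last, Fin.snoc_last, Fin.snoc_castSucc, Fin.succ_castSucc]
      have : ∀ (α : Type) (v : Fin (n + 1) → α) (t : α),
        (Fin.snoc v t : Fin (n + 2) → α) 0 = v 0 := by
        intro α v t
        exact Fin.snoc_castSucc (α := fun _ => α) t v 0
      rw [this, this]
      ring
    · rw [if_neg hc]
      by_cases h1 : 0 < (z (Fin.last n)).1 ∧ (z (Fin.last n)).1 < t
      · rw [if_neg, mul_zero]
        rintro ⟨h2, h3⟩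
        refine hc ⟨fun j => ?_, hmono.2 ⟨h3, h1.2⟩⟩
        refine Fin.lastCases h1.1 (fun j => h2 j) j
      · rw [heatStep, if_neg h1, zero_mul]

lemma chaosKernel_eq_sum (u₀ : Sp d → ℝ) (n : ℕ) (t : ℝ) (x : Sp d) (z : Fin n → ℝ × Sp d) :
    chaosKernel u₀ n t x z = (n ! : ℝ)⁻¹ * ∑ ρ : Equiv.Perm (Fin n),
      simplexKernel u₀ n t x (z ∘ ρ) := by
  classical
  unfold chaosKernel
  congr 1
  refine Finset.sum_congr rfl fun ρ _ => ?_
  rw [simplexKernel_eq]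
  have : (∀ j, 0 < (z j).1) ↔ ∀ j, 0 < ((z ∘ ρ) j).1 :=
    ⟨fun h j => h _, fun h j => by simpa using h (ρ.symm j)⟩
  simp only [this]
  rfl

lemma chaosKernel_index_zero (u₀ : Sp d → ℝ) (t : ℝ) (x : Sp d) (z : Fin 0 → ℝ × Sp d) :
    chaosKernel u₀ 0 t x z = heatSemigroup t u₀ x := by
  simp [chaosKernel_eq_sum, simplexKernel]

lemma chaosKernel_comp (u₀ : Sp d → ℝ) {n : ℕ} (t : ℝ) (x : Sp d) (z : Fin n → ℝ × Sp d)
    (σ : Equiv.Perm (Fin n)) : chaosKernel u₀ n t x (z ∘ σ) = chaosKernel u₀ n t x z := by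
  simp only [chaosKernel_eq_sum]
  congr 1
  exact Fintype.sum_equiv (Equiv.mulLeft σ) _ _ fun ρ => rfl

/-- The permutation that sends the last index to `i` and acts like `σ` on the other ones. -/
def permInsert {n : ℕ} (p : Fin (n + 1) × Equiv.Perm (Fin n)) : Equiv.Perm (Fin (n + 1)) :=
  (finSuccEquiv' (Fin.last n)).trans ((Equiv.optionCongr p.2).trans (finSuccEquiv' p.1).symm)

lemma permInsert_last {n : ℕ} (p : Fin (n + 1) × Equiv.Perm (Fin n)) :
    permInsert p (Fin.last n) = p.1 := by
  simp [permInsert]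

lemma permInsert_castSucc {n : ℕ} (p : Fin (n + 1) × Equiv.Perm (Fin n)) (j : Fin n) :
    permInsert p j.castSucc = p.1.succAbove (p.2 j) := by
  have := finSuccEquiv'_succAbove (Fin.last n) j
  rw [Fin.succAbove_last] at this
  simp [permInsert, this]

lemma bijective_permInsert {n : ℕ} : Function.Bijective (permInsert (n := n)) := by
  rw [Fintype.bijective_iff_injective_and_card]
  constructor
  · rintro ⟨i, σ⟩ ⟨j, τ⟩ h
    have h1 : i = j := by
      have := permInsert_last (i, σ)
      rwa [h, permInsert_last, eq_comm] at this
    subst h1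
    congr 1
    ext k
    have h2 := permInsert_castSucc (i, σ) k
    rw [h, permInsert_castSucc] at h2
    exact congrArg Fin.val (Fin.succAbove_right_injective h2.symm)
  · simp [Fintype.card_perm, Nat.factorial_succ]

/-- Orderings are grouped by the index `i` of the latest point; what remains is an ordering of the
other `n` points, with `permInsert` as the bijection. This is the recursion that the mild equation
imposes on chaos kernels. -/
lemma chaosKernel_succ (u₀ : Sp d → ℝ) (n : ℕ) (t : ℝ) (x : Sp d)
    (z : Fin (n + 1) → ℝ × Sp d) :
    chaosKernel u₀ (n + 1) t x z = ((n : ℝ) + 1)⁻¹ * ∑ i, heatStep t x (z i) *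
      chaosKernel u₀ n (z i).1 (z i).2 (fun j => z (i.succAbove j)) := by
  rw [chaosKernel_eq_sum, ← bijective_permInsert.sum_comp, Fintype.sum_prod_type,
    Nat.factorial_succ]
  push_cast
  rw [mul_inv, mul_assoc]
  congr 1
  rw [Finset.mul_sum]
  refine Finset.sum_congr rfl fun i _ => ?_
  rw [chaosKernel_eq_sum, Finset.mul_sum, Finset.mul_sum, Finset.mul_sum]
  refine Finset.sum_congr rfl fun σ _ => ?_
  simp only [simplexKernel, Function.comp_apply, permInsert_last, permInsert_castSucc]
  rw [mul_left_comm]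
  rfl

/-- Because of this support property, potentials need to be bounded on `[0,t]` only. -/
lemma chaosKernel_eq_zero (u₀ : Sp d → ℝ) {n : ℕ} {t : ℝ} {x : Sp d}
    {z : Fin n → ℝ × Sp d} {i : Fin n} (h : ¬ (0 < (z i).1 ∧ (z i).1 < t)) :
    chaosKernel u₀ n t x z = 0 := by
  induction n generalizing t x with
  | zero => exact i.elim0
  | succ n ih =>
    rw [chaosKernel_succ, Finset.sum_eq_zero, mul_zero]
    intro j _
    by_cases hj : 0 < (z j).1 ∧ (z j).1 < t
    · rcases eq_or_ne i j with rfl | hij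
      · exact absurd hj h
      · obtain ⟨k, rfl⟩ := Fin.exists_succAbove_eq hij
        rw [ih (i := k), mul_zero]
        intro hk
        exact h ⟨hk.1, hk.2.trans hj.2⟩
    · rw [heatStep, if_neg hj, zero_mul]

lemma measurable_chaosKernel_joint (u₀ : Sp d →ᵇ ℝ) (n : ℕ) :
    Measurable fun p : (ℝ × Sp d) × (Fin n → ℝ × Sp d) =>
      chaosKernel u₀ n p.1.1 p.1.2 p.2 := by
  induction n with
  | zero =>
    simp only [chaosKernel_index_zero]
    exact (measurable_heatSemigroup u₀).comp measurable_fst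
  | succ n ih =>
    simp only [chaosKernel_succ]
    refine (Finset.measurable_fun_sum _ fun i _ => ?_).const_mul _
    have hi : Measurable fun p : (ℝ × Sp d) × (Fin (n + 1) → ℝ × Sp d) => p.2 i :=
      (measurable_pi_apply i).comp measurable_snd
    refine (measurable_heatStep.comp (measurable_fst.prodMk hi)).mul
      (ih.comp (hi.prodMk ?_))
    exact measurable_pi_lambda _ fun j => (measurable_pi_apply _).comp measurable_snd

lemma measurable_chaosKernel (u₀ : Sp d →ᵇ ℝ) (n : ℕ) (t : ℝ) (x : Sp d) :
    Measurable (chaosKernel u₀ n t x) :=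
  (measurable_chaosKernel_joint u₀ n).comp (measurable_const (a := (t, x)) |>.prodMk measurable_id)

lemma measurePreserving_insertNth {X : Type*} [MeasureSpace X] [SigmaFinite (volume : Measure X)]
    {n : ℕ} (i : Fin (n + 1)) :
    MeasurePreserving (fun p : X × (Fin n → X) => (i.insertNth p.1 p.2 : Fin (n + 1) → X))
      (volume.prod volume) volume :=
  (volume_preserving_piFinSuccAbove (fun _ : Fin (n + 1) => X) i).symm

lemma measurableEmbedding_insertNth {X : Type*} [MeasurableSpace X] {n : ℕ} (i : Fin (n + 1)) :
    MeasurableEmbedding (fun p : X × (Fin n → X) => (i.insertNth p.1 p.2 : Fin (n + 1) → X)) :=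
  (MeasurableEquiv.piFinSuccAbove (fun _ : Fin (n + 1) => X) i).symm.measurableEmbedding

lemma measurable_pi_succ {X : Type*} [MeasurableSpace X] {n : ℕ} (i : Fin (n + 1)) {A : X → ℝ≥0∞}
    (hA : Measurable A) {B : X × (Fin n → X) → ℝ≥0∞} (hB : Measurable B) :
    Measurable fun z : Fin (n + 1) → X => A (z i) * B (z i, fun j => z (i.succAbove j)) :=
  (hA.comp (measurable_pi_apply i)).mul (hB.comp ((measurable_pi_apply i).prodMk
    (measurable_pi_lambda _ fun _ => measurable_pi_apply _)))

lemma lintegral_pi_succ {X : Type*} [MeasureSpace X] [SigmaFinite (volume : Measure X)]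
    {n : ℕ} (i : Fin (n + 1)) {A : X → ℝ≥0∞} (hA : Measurable A) {B : X × (Fin n → X) → ℝ≥0∞}
    (hB : Measurable B) :
    ∫⁻ z : Fin (n + 1) → X, A (z i) * B (z i, fun j => z (i.succAbove j)) =
      ∫⁻ a, A a * ∫⁻ z, B (a, z) := by
  have hps := measurePreserving_insertNth (X := X) i
  rw [← hps.lintegral_comp (measurable_pi_succ i hA hB)]
  simp only [Fin.insertNth_apply_same, Fin.insertNth_apply_succAbove]
  rw [lintegral_prod (fun p : X × (Fin n → X) => A p.1 * B p)
    ((hA.comp measurable_fst).mul hB).aemeasurable]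
  exact lintegral_congr fun a => lintegral_const_mul (A a) (f := fun z => B (a, z))
    (hB.comp measurable_prodMk_left)

lemma measurable_chaosKernel_mul (u₀ : Sp d →ᵇ ℝ) (n : ℕ) {w : ℝ → ℝ≥0∞} (hw : Measurable w) :
    Measurable fun p : (ℝ × Sp d) × (Fin n → ℝ × Sp d) =>
      ‖chaosKernel u₀ n p.1.1 p.1.2 p.2‖ₑ * ∏ i, w (p.2 i).1 :=
  (measurable_chaosKernel_joint u₀ n).enorm.mul (Finset.measurable_fun_prod _ fun j _ =>
    hw.comp (measurable_fst.comp ((measurable_pi_apply j).comp measurable_snd)))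

lemma enorm_chaosKernel_succ_le (u₀ : Sp d → ℝ) (n : ℕ) (t : ℝ) (x : Sp d)
    (z : Fin (n + 1) → ℝ × Sp d) (w : ℝ → ℝ≥0∞) :
    ‖chaosKernel u₀ (n + 1) t x z‖ₑ * ∏ i, w (z i).1 ≤
      ((n : ℝ≥0∞) + 1)⁻¹ * ∑ i, (‖heatStep t x (z i)‖ₑ * w (z i).1) *
        (‖chaosKernel u₀ n (z i).1 (z i).2 (fun j => z (i.succAbove j))‖ₑ *
          ∏ j, w (z (i.succAbove j)).1) := by
  have hn : ‖((n : ℝ) + 1)⁻¹‖ₑ = ((n : ℝ≥0∞) + 1)⁻¹ := by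
    rw [enorm_inv (by positivity)]
    congr 1
    rw [Real.enorm_of_nonneg (by positivity), ENNReal.ofReal_add (by positivity) zero_le_one]
    simp
  rw [chaosKernel_succ, enorm_mul, mul_assoc, hn]
  gcongr
  calc _ ≤ (∑ i, ‖heatStep t x (z i)‖ₑ *
        ‖chaosKernel u₀ n (z i).1 (z i).2 (fun j => z (i.succAbove j))‖ₑ) *
          ∏ i, w (z i).1 := by
        gcongr
        refine (enorm_sum_le _ _).trans (Finset.sum_le_sum fun i _ => ?_)
        rw [enorm_mul]
    _ = _ := by
        rw [Finset.sum_mul]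
        refine Finset.sum_congr rfl fun i _ => ?_
        rw [Fin.prod_univ_succAbove _ i]
        ring

/-- In the recursion each of the `n + 1` summands contributes the same bound, and the prefactor
`(n+1)⁻¹` undoes their number. The case `w = 1` gives integrability; a multiple of `s^{H-1}` serves
the normalized increments `bump`. -/
lemma lintegral_chaosKernel_mul_le (u₀ : Sp d →ᵇ ℝ) (n : ℕ) (t : ℝ) (x : Sp d)
    {w : ℝ → ℝ≥0∞} (hw : Measurable w) :
    ∫⁻ z : Fin n → ℝ × Sp d, ‖chaosKernel u₀ n t x z‖ₑ * ∏ i, w (z i).1 ≤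
      ‖u₀‖ₑ * (∫⁻ s in Set.Ioo 0 t, w s) ^ n := by
  induction n generalizing t x with
  | zero =>
    have h : ‖heatSemigroup t u₀ x‖ₑ ≤ ‖u₀‖ₑ :=
      enorm_le_iff_norm_le.2 (by simpa using abs_heatSemigroup_le u₀ t x)
    simp only [chaosKernel_index_zero, Finset.univ_eq_empty, Finset.prod_empty, mul_one, pow_zero,
      lintegral_const]
    rw [show (volume : Measure (Fin 0 → ℝ × Sp d)) Set.univ = 1 by
      rw [volume_pi, Measure.pi_univ]; simp, mul_one]
    exact h
  | succ n ih =>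
    set I : ℝ≥0∞ := ∫⁻ s in Set.Ioo 0 t, w s with hI
    have hA : Measurable fun a : ℝ × Sp d => ‖heatStep t x a‖ₑ * w a.1 :=
      (measurable_heatStep_right t x).enorm.mul (hw.comp measurable_fst)
    have hB := measurable_chaosKernel_mul u₀ n hw
    have hterm : ∀ a : ℝ × Sp d, ‖heatStep t x a‖ₑ * w a.1 *
        (∫⁻ z : Fin n → ℝ × Sp d, ‖chaosKernel u₀ n a.1 a.2 z‖ₑ * ∏ i, w (z i).1) ≤
        ‖heatStep t x a‖ₑ * w a.1 * (‖u₀‖ₑ * I ^ n) := by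
      intro a
      by_cases ha : 0 < a.1 ∧ a.1 < t
      · gcongr
        refine (ih a.1 a.2).trans ?_
        gcongr
        exact lintegral_mono_set (Set.Ioo_subset_Ioo_right ha.2.le)
      · simp [heatStep, ha]
    have hsum : ∀ i : Fin (n + 1), ∫⁻ z : Fin (n + 1) → ℝ × Sp d,
        (‖heatStep t x (z i)‖ₑ * w (z i).1) *
        (‖chaosKernel u₀ n (z i).1 (z i).2 (fun j => z (i.succAbove j))‖ₑ *
          ∏ j, w (z (i.succAbove j)).1) ≤ ‖u₀‖ₑ * I ^ (n + 1) := by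
      intro i
      refine (lintegral_pi_succ i hA hB).le.trans ((lintegral_mono hterm).trans ?_)
      rw [lintegral_mul_const _ hA]
      refine (mul_le_mul_left (lintegral_heatStep_mul_le t x hw) _).trans_eq ?_
      rw [← hI]
      ring
    refine (lintegral_mono fun z => enorm_chaosKernel_succ_le u₀ n t x z w).trans ?_
    have hm : ∀ i : Fin (n + 1), Measurable fun z : Fin (n + 1) → ℝ × Sp d =>
        (‖heatStep t x (z i)‖ₑ * w (z i).1) *
        (‖chaosKernel u₀ n (z i).1 (z i).2 (fun j => z (i.succAbove j))‖ₑ *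
          ∏ j, w (z (i.succAbove j)).1) := fun i =>
      measurable_pi_succ i hA hB
    rw [lintegral_const_mul _ (Finset.measurable_fun_sum _ fun i _ => hm i),
      lintegral_finsetSum _ fun i _ => hm i]
    calc _ ≤ ((n : ℝ≥0∞) + 1)⁻¹ * ∑ _i : Fin (n + 1), (‖u₀‖ₑ * I ^ (n + 1)) := by
          gcongr with i
          exact hsum i
      _ = _ := by
          rw [Finset.sum_const, Finset.card_univ, Fintype.card_fin, nsmul_eq_mul, ← mul_assoc]
          push_cast
          rw [ENNReal.inv_mul_cancel (by positivity) (by finiteness), one_mul]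

end ChaosKernel

/-! ### Tensors represented by chaos kernels -/

section Represent

variable {d : ℕ} {H : ℝ} {f : Sp d → ℝ} {μ : Measure (Sp d)}

lemma Represents.unique {n : ℕ} {g : (Fin n → ℝ × Sp d) → ℝ} {G G' : TensorPow (HP H f) n}
    (h : Represents H f g G) (h' : Represents H f g G') : G = G' :=
  ext_inner_tens_gen fun a => (h a).2.trans (h' a).2.symm

lemma Represents.toTensor_eq {n : ℕ} {g : (Fin n → ℝ × Sp d) → ℝ} {G : TensorPow (HP H f) n}
    (h : Represents H f g G) : toTensor H f g = G := by
  have h' : ∃ G, Represents H f g G := ⟨G, h⟩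
  rw [toTensor, dif_pos h']
  exact h'.choose_spec.unique h

lemma Represents.tensorNormSq_eq {n : ℕ} {g : (Fin n → ℝ × Sp d) → ℝ}
    {G : TensorPow (HP H f) n} (h : Represents H f g G) : tensorNormSq H f g = ‖G‖ₑ ^ 2 := by
  rw [tensorNormSq, if_pos ⟨G, h⟩, h.toTensor_eq]

lemma exists_represents_of_tensorNormSq_ne_top {n : ℕ} {g : (Fin n → ℝ × Sp d) → ℝ}
    (h : tensorNormSq H f g ≠ ∞) : Represents H f g (toTensor H f g) := by
  by_cases h' : ∃ G, Represents H f g G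
  · obtain ⟨G, hG⟩ := h'
    rwa [hG.toTensor_eq]
  · rw [tensorNormSq, if_neg h'] at h
    exact absurd rfl h

lemma IsSpatialKernel.exists_prod_pot_le (hf : IsSpatialKernel f μ) (hH : 1 / 2 ≤ H) {n : ℕ}
    (a : Fin n → Rect d) (t : ℝ) : ∃ C, 0 ≤ C ∧ ∀ z : Fin n → ℝ × Sp d,
      (∀ i, (z i).1 ∈ Set.Icc 0 t) → |∏ i, pot H f (a i) (z i)| ≤ C := by
  choose C hC h using fun i => hf.exists_pot_le hH (a i) t
  refine ⟨∏ i, C i, Finset.prod_nonneg fun i _ => hC i, fun z hz => ?_⟩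
  rw [Finset.abs_prod]
  exact Finset.prod_le_prod (fun i _ => abs_nonneg _) fun i _ => h i _ (hz i)

lemma IsSpatialKernel.measurable_prod_pot (hf : IsSpatialKernel f μ) (hH : 1 / 2 ≤ H) {n : ℕ}
    (a : Fin n → Rect d) :
    Measurable fun z : Fin n → ℝ × Sp d => ∏ i, pot H f (a i) (z i) :=
  Finset.measurable_fun_prod _ fun i _ => (hf.measurable_pot hH (a i)).comp (measurable_pi_apply i)

lemma lintegral_chaosKernel_le (u₀ : Sp d →ᵇ ℝ) (n : ℕ) (t : ℝ) (x : Sp d) :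
    ∫⁻ z : Fin n → ℝ × Sp d, ‖chaosKernel u₀ n t x z‖ₑ ≤ ‖u₀‖ₑ * ENNReal.ofReal t ^ n := by
  have := lintegral_chaosKernel_mul_le u₀ n t x (w := fun _ => 1) measurable_const
  simpa using this

lemma integrable_chaosKernel (u₀ : Sp d →ᵇ ℝ) (n : ℕ) (t : ℝ) (x : Sp d) :
    Integrable (chaosKernel u₀ n t x) :=
  ⟨(measurable_chaosKernel u₀ n t x).aestronglyMeasurable,
    (lintegral_chaosKernel_le u₀ n t x).trans_lt (by finiteness)⟩

lemma abs_chaosKernel_mul_le (u₀ : Sp d → ℝ) {n : ℕ} {t : ℝ} {x : Sp d}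
    {z : Fin n → ℝ × Sp d} {b C : ℝ} (h : (∀ i, (z i).1 ∈ Set.Ioo 0 t) → |b| ≤ C) :
    |chaosKernel u₀ n t x z * b| ≤ C * |chaosKernel u₀ n t x z| := by
  by_cases hz : ∀ i, (z i).1 ∈ Set.Ioo 0 t
  · rw [abs_mul, mul_comm]
    exact mul_le_mul_of_nonneg_right (h hz) (abs_nonneg _)
  · push Not at hz
    obtain ⟨i, hi⟩ := hz
    rw [chaosKernel_eq_zero u₀ (i := i) hi]
    simp

lemma IsSpatialKernel.integrable_chaosKernel_mul (hf : IsSpatialKernel f μ) (hH : 1 / 2 ≤ H)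
    (u₀ : Sp d →ᵇ ℝ) {n : ℕ} (t : ℝ) (x : Sp d) (a : Fin n → Rect d) :
    Integrable fun z => chaosKernel u₀ n t x z * ∏ i, pot H f (a i) (z i) := by
  obtain ⟨C, hC, h⟩ := hf.exists_prod_pot_le hH a t
  refine ((integrable_chaosKernel u₀ n t x).norm.const_mul C).mono'
    ((measurable_chaosKernel u₀ n t x).mul (hf.measurable_prod_pot hH a)).aestronglyMeasurable
    (Filter.Eventually.of_forall fun z => ?_)
  exact abs_chaosKernel_mul_le u₀ fun hz => h z fun i => Set.Ioo_subset_Icc_self (hz i)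

lemma setIntegral_chaosKernel_mul (u₀ : Sp d → ℝ) {n : ℕ} (t : ℝ) (x : Sp d)
    (b : (Fin n → ℝ × Sp d) → ℝ) :
    ∫ z in {z : Fin n → ℝ × Sp d | ∀ i, 0 ≤ (z i).1}, chaosKernel u₀ n t x z * b z =
      ∫ z, chaosKernel u₀ n t x z * b z := by
  refine setIntegral_eq_integral_of_forall_compl_eq_zero fun z hz => ?_
  simp only [Set.mem_ofPred_eq, not_forall, not_le] at hz
  obtain ⟨i, hi⟩ := hz
  rw [chaosKernel_eq_zero u₀ (i := i) fun h => lt_asymm h.1 hi, zero_mul]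

/-- The integrability clause is automatic: the kernel is integrable and the potentials are bounded
on its support, which also removes the restriction to nonnegative times. -/
lemma IsSpatialKernel.represents_chaosKernel_iff (hf : IsSpatialKernel f μ) (hH : 1 / 2 ≤ H)
    (u₀ : Sp d →ᵇ ℝ) {n : ℕ} {t : ℝ} {x : Sp d} {G : TensorPow (HP H f) n} :
    Represents H f (chaosKernel u₀ n t x) G ↔ ∀ a : Fin n → Rect d,
      inner ℝ (tens fun i => ind H f (a i)) G =
        ∫ z, chaosKernel u₀ n t x z * ∏ i, pot H f (a i) (z i) := by
  refine forall_congr' fun a => ?_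
  rw [setIntegral_chaosKernel_mul, and_iff_right]
  exact (hf.integrable_chaosKernel_mul hH u₀ t x a).integrableOn

/-- The chaos kernel is a symmetric function and permuting the variables preserves volume. -/
lemma IsSpatialKernel.isSymmTensor_of_represents (hf : IsSpatialKernel f μ) (hH : 1 / 2 ≤ H)
    (u₀ : Sp d →ᵇ ℝ) {n : ℕ} {t : ℝ} {x : Sp d} {G : TensorPow (HP H f) n}
    (h : Represents H f (chaosKernel u₀ n t x) G) : IsSymmTensor G := by
  rw [hf.represents_chaosKernel_iff hH] at h
  refine isSymmTensor_of_gen fun σ a => ?_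
  have h1 := h (a ∘ σ)
  have h2 := h a
  refine h1.trans (Eq.trans ?_ h2.symm)
  have hp : MeasurePreserving (fun z : Fin n → ℝ × Sp d => z ∘ σ) :=
    (volume_preserving_arrowCongr' σ.symm (MeasurableEquiv.refl (ℝ × Sp d))
      (MeasurePreserving.id _))
  have he : MeasurableEmbedding (fun z : Fin n → ℝ × Sp d => z ∘ σ) :=
    (MeasurableEquiv.arrowCongr' σ.symm (MeasurableEquiv.refl (ℝ × Sp d))).measurableEmbedding
  rw [← hp.integral_comp he]
  refine integral_congr_ae (Filter.Eventually.of_forall fun z => ?_)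
  simp only [chaosKernel_comp, Function.comp_apply]
  rw [Equiv.prod_comp σ fun i => pot H f (a i) (z i)]

/-- The factor `1_{[0,t]}(s) p_{t-s}(x-y)`. -/
def mildWeight (t : ℝ) (x : Sp d) (s : ℝ) (y : Sp d) : ℝ :=
  open Classical in if s ∈ Set.Icc 0 t then heatKernel (t - s) (x - y) else 0

lemma mildIntegrand_eq {Ω : Type*} (u : ℝ → Sp d → Ω → ℝ) (t : ℝ) (x : Sp d) (s : ℝ) (y : Sp d) :
    mildIntegrand u t x s y = mildWeight t x s y • u s y := by
  ext ω
  simp [mildIntegrand, mildWeight]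

/-- At `s = t` both weights vanish since the heat kernel at time zero is set to zero; only `s = 0`,
a null set of times, can make a difference. -/
lemma mildWeight_eq (t : ℝ) (x : Sp d) {s : ℝ} (hs : s ≠ 0) (y : Sp d) :
    mildWeight t x s y = heatStep t x (s, y) := by
  unfold mildWeight heatStep
  split_ifs with h1 h2 h2
  · rfl
  · have : s = t := le_antisymm h1.2 (not_lt.1 fun h => h2 ⟨lt_of_le_of_ne h1.1 hs.symm, h⟩)
    simp [this, heatKernel]
  · exact absurd ⟨h2.1.le, h2.2.le⟩ h1
  · rfl

lemma IsSpatialKernel.integrable_heatStep_mul (hf : IsSpatialKernel f μ) (hH : 1 / 2 ≤ H)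
    (u₀ : Sp d →ᵇ ℝ) {n : ℕ} (t : ℝ) (x : Sp d) (b : Rect d) (a : Fin n → Rect d) :
    Integrable (fun p : (ℝ × Sp d) × (Fin n → ℝ × Sp d) =>
      (heatStep t x p.1 * pot H f b p.1) *
        (chaosKernel u₀ n p.1.1 p.1.2 p.2 * ∏ i, pot H f (a i) (p.2 i)))
      (volume.prod volume) := by
  obtain ⟨C, hC, h⟩ := hf.exists_prod_pot_le hH a t
  obtain ⟨D, hD, h'⟩ := hf.exists_pot_le hH b t
  have hA := measurable_heatStep_right (d := d) t x
  have hB := measurable_chaosKernel_joint u₀ n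
  have hi : Integrable (fun p : (ℝ × Sp d) × (Fin n → ℝ × Sp d) =>
      heatStep t x p.1 * chaosKernel u₀ n p.1.1 p.1.2 p.2) (volume.prod volume) := by
    have hm : Measurable (fun p : (ℝ × Sp d) × (Fin n → ℝ × Sp d) =>
      heatStep t x p.1 * chaosKernel u₀ n p.1.1 p.1.2 p.2) := (hA.comp measurable_fst).mul hB
    refine ⟨hm.aestronglyMeasurable, ?_⟩
    rw [HasFiniteIntegral, lintegral_prod _ hm.enorm.aemeasurable]
    refine lt_of_le_of_lt (b := ∫⁻ p : ℝ × Sp d, ‖heatStep t x p‖ₑ *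
      (‖u₀‖ₑ * ENNReal.ofReal t ^ n)) (lintegral_mono fun p => ?_) ?_
    · simp only [enorm_mul]
      rw [lintegral_const_mul _ (measurable_chaosKernel u₀ n p.1 p.2).enorm]
      by_cases hp : 0 < p.1 ∧ p.1 < t
      · gcongr
        refine (lintegral_chaosKernel_le u₀ n p.1 p.2).trans ?_
        gcongr
        exact hp.2.le
      · simp [heatStep, hp]
    · rw [lintegral_mul_const _ hA.enorm]
      have := lintegral_heatStep_mul_le t x (w := fun _ => 1) measurable_const
      simp only [mul_one, setLIntegral_const, Real.volume_Ioo, one_mul, sub_zero] at this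
      exact ENNReal.mul_lt_top (this.trans_lt ENNReal.ofReal_lt_top) (by finiteness)
  refine (hi.norm.const_mul (D * C)).mono' ?_ (Filter.Eventually.of_forall fun p => ?_)
  · exact (((hA.mul (hf.measurable_pot hH b)).comp measurable_fst).mul
      (hB.mul ((hf.measurable_prod_pot hH a).comp measurable_snd))).aestronglyMeasurable
  · rw [Real.norm_eq_abs, abs_mul, Real.norm_eq_abs, abs_mul (heatStep _ _ _) (chaosKernel _ _ _ _ _)]
    by_cases hp : 0 < p.1.1 ∧ p.1.1 < t
    · have h1 : |heatStep t x p.1 * pot H f b p.1| ≤ |heatStep t x p.1| * D := by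
        rw [abs_mul]
        gcongr
        exact h' _ ⟨hp.1.le, hp.2.le⟩
      have h2 := abs_chaosKernel_mul_le u₀ (t := p.1.1) (x := p.1.2) (z := p.2)
        (b := ∏ i, pot H f (a i) (p.2 i)) (C := C)
        fun hz => h _ fun i => ⟨(hz i).1.le, (hz i).2.le.trans hp.2.le⟩
      refine (mul_le_mul h1 h2 (abs_nonneg _) (by positivity)).trans_eq (by ring)
    · simp [heatStep, hp]

/-- By Fubini, the pairing of `p_{t-s}(x-y) f_n(·,s,y)` with a rectangle in the distinguished
variable `i` is an integral over all `n + 1` variables; summed over `i` it is `chaosKernel_succ`.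
The equivalence is used in both directions: to identify the kernels of a solution and to verify the
equation for the series. -/
lemma IsSpatialKernel.isSymmetrization_iff (hf : IsSpatialKernel f μ) (hH : 1 / 2 ≤ H)
    (u₀ : Sp d →ᵇ ℝ) {n : ℕ} {t : ℝ} {x : Sp d} {k g : ℝ → Sp d → TensorPow (HP H f) n}
    (hk : ∀ s y, 0 ≤ s → Represents H f (chaosKernel u₀ n s y) (k s y))
    (hg : ∀ s y, 0 ≤ s → g s y = mildWeight t x s y • k s y)
    {G : TensorPow (HP H f) (n + 1)} :
    IsSymmetrization H f g G ↔ Represents H f (chaosKernel u₀ (n + 1) t x) G := by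
  rw [hf.represents_chaosKernel_iff hH]
  refine forall_congr' fun a => ?_
  set F : Fin (n + 1) → (ℝ × Sp d) × (Fin n → ℝ × Sp d) → ℝ := fun i p =>
    (heatStep t x p.1 * pot H f (a i) p.1) *
      (chaosKernel u₀ n p.1.1 p.1.2 p.2 * ∏ j, pot H f (a (i.succAbove j)) (p.2 j)) with hF
  have hFi : ∀ i, Integrable (F i) (volume.prod volume) := fun i =>
    hf.integrable_heatStep_mul hH u₀ t x (a i) fun j => a (i.succAbove j)
  have hae : ∀ᵐ z : ℝ × Sp d, z.1 ≠ 0 := by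
    have : ∀ᵐ s : ℝ, s ≠ 0 := by simp [ae_iff]
    exact Measure.quasiMeasurePreserving_fst.ae this
  have hS : MeasurableSet {z : ℝ × Sp d | 0 ≤ z.1} := measurableSet_le measurable_const measurable_fst
  have heq : ∀ i, ∀ᵐ z : ℝ × Sp d ∂(volume.restrict {z : ℝ × Sp d | 0 ≤ z.1}),
      (∫ p, F i (z, p)) = inner ℝ (tens fun j => ind H f (a (i.succAbove j))) (g z.1 z.2) *
        pot H f (a i) z := by
    intro i
    filter_upwards [ae_restrict_of_ae hae, ae_restrict_mem hS] with z hz hz0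
    rw [hg _ _ hz0, real_inner_smul_right, mildWeight_eq t x hz,
      (hf.represents_chaosKernel_iff hH u₀).1 (hk z.1 z.2 hz0)]
    simp only [hF]
    rw [integral_const_mul]
    ring
  have hint : ∀ i, IntegrableOn (fun z : ℝ × Sp d =>
      inner ℝ (tens fun j => ind H f (a (i.succAbove j))) (g z.1 z.2) * pot H f (a i) z)
        {z | 0 ≤ z.1} := fun i =>
    ((hFi i).integral_prod_left.restrict).congr (heq i)
  rw [and_iff_right hint]
  have hval : ∀ i, ∫ z in {z : ℝ × Sp d | 0 ≤ z.1},
      inner ℝ (tens fun j => ind H f (a (i.succAbove j))) (g z.1 z.2) * pot H f (a i) z =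
      ∫ z : Fin (n + 1) → ℝ × Sp d, F i (z i, fun j => z (i.succAbove j)) := by
    intro i
    rw [← integral_congr_ae (heq i), setIntegral_eq_integral_of_forall_compl_eq_zero,
      ← integral_prod _ (hFi i),
      ← (measurePreserving_insertNth (X := ℝ × Sp d) i).integral_comp
        (measurableEmbedding_insertNth i)]
    · simp only [Fin.insertNth_apply_same, Fin.insertNth_apply_succAbove]
    · intro z hz
      have : heatStep t x z = 0 := if_neg fun h => hz h.1.le
      simp [hF, this]
  have hsum : ∫ z, chaosKernel u₀ (n + 1) t x z * ∏ i, pot H f (a i) (z i) =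
      ((n : ℝ) + 1)⁻¹ * ∑ i, ∫ z in {z : ℝ × Sp d | 0 ≤ z.1},
        inner ℝ (tens fun j => ind H f (a (i.succAbove j))) (g z.1 z.2) * pot H f (a i) z := by
    simp only [hval]
    rw [← integral_finsetSum, ← integral_const_mul]
    · refine integral_congr_ae (Filter.Eventually.of_forall fun z => ?_)
      simp only [hF, chaosKernel_succ]
      rw [mul_assoc, Finset.sum_mul]
      congr 1
      refine Finset.sum_congr rfl fun i _ => ?_
      rw [Fin.prod_univ_succAbove _ i]
      ring
    · intro i _
      rw [← (measurePreserving_insertNth (X := ℝ × Sp d) i).integrable_comp_emb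
        (measurableEmbedding_insertNth i)]
      simpa [Function.comp_def] using hFi i
  rw [hsum]

end Represent

/-! ### Averaged potentials and Lebesgue differentiation -/

section Average

variable {d : ℕ} {H : ℝ} {f : Sp d → ℝ} {μ : Measure (Sp d)}

/-- The uniform distribution on `[1-ε, 1]`. -/
def unifTime (ε : ℝ) : Measure ℝ := cond volume (Set.Icc (1 - ε) 1)

/-- The uniform distribution on the ball of radius `ε`. -/
def unifSpace (d : ℕ) (ε : ℝ) : Measure (Sp d) := cond volume (Metric.closedBall 0 ε)

lemma isProbabilityMeasure_unifTime {ε : ℝ} (hε : 0 < ε) : IsProbabilityMeasure (unifTime ε) :=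
  cond_isProbabilityMeasure_of_finite (by simp [hε]) (by simp)

lemma isProbabilityMeasure_unifSpace (d : ℕ) {ε : ℝ} (hε : 0 < ε) :
    IsProbabilityMeasure (unifSpace d ε) :=
  cond_isProbabilityMeasure_of_finite (Metric.measure_closedBall_pos _ _ hε).ne'
    measure_closedBall_lt_top.ne

lemma integral_unifTime {ε : ℝ} (hε : 0 < ε) (g : ℝ → ℝ) :
    ∫ r, g r ∂unifTime ε = ε⁻¹ * ∫ r in (1 - ε)..1, g r := by
  rw [unifTime, ProbabilityTheory.cond, integral_smul_measure, intervalIntegral.integral_of_le (by linarith),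
    integral_Icc_eq_integral_Ioc, smul_eq_mul]
  congr 1
  simp [hε.le]

lemma integral_unifSpace (ε : ℝ) (g : Sp d → ℝ) :
    ∫ k, g k ∂unifSpace d ε = (volume.real (Metric.closedBall (0 : Sp d) ε))⁻¹ *
      ∫ k in Metric.closedBall 0 ε, g k := by
  rw [unifSpace, ProbabilityTheory.cond, integral_smul_measure, smul_eq_mul, ENNReal.toReal_inv]
  rfl

/-- The average of the potential in time over `[(1-ε)s, s]`. -/
def timeAvg (H T ε s : ℝ) : ℝ := ∫ r, timePot H T (r * s) ∂unifTime ε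

/-- The average of the potential in space over the ball of radius `ε` at `y`. -/
def spaceAvg (f : Sp d → ℝ) (A : Set (Sp d)) (ε : ℝ) (y : Sp d) : ℝ :=
  ∫ k, spacePot f A (y + k) ∂unifSpace d ε

lemma intervalIntegrable_timePot (hH : 1 / 2 ≤ H) (T : ℝ) {a b : ℝ} (ha : 0 ≤ a) (hb : 0 ≤ b) :
    IntervalIntegrable (timePot H T) volume a b := by
  obtain ⟨C, hC, h⟩ := exists_timePot_le hH T (max a b)
  rw [intervalIntegrable_iff]
  refine Measure.integrableOn_of_bounded (M := C) (by simp)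
    (measurable_timePot hH T).aestronglyMeasurable ?_
  refine (ae_restrict_iff' measurableSet_uIoc).2 (Filter.Eventually.of_forall fun s hs => ?_)
  exact h s ⟨(le_min ha hb).trans hs.1.le, hs.2⟩

lemma timeAvg_eq_integral (H T : ℝ) {ε s : ℝ} (hε : 0 < ε) (hs : 0 < s) :
    timeAvg H T ε s = (ε * s)⁻¹ * ∫ r in ((1 - ε) * s)..s, timePot H T r := by
  rw [timeAvg, integral_unifTime hε,
    intervalIntegral.integral_comp_mul_right (fun r => timePot H T r) hs.ne', one_mul, smul_eq_mul]
  rw [mul_inv]; ring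

/-- As a difference quotient of covariances, the average is an inner product with a normalized time
increment, unlike the pointwise potential. -/
lemma timeAvg_eq (hH : 1 / 2 ≤ H) {T ε s : ℝ} (hT : 0 ≤ T) (hε : 0 < ε) (hε1 : ε ≤ 1)
    (hs : 0 < s) :
    timeAvg H T ε s = (ε * s)⁻¹ * (fbmCov H T s - fbmCov H T ((1 - ε) * s)) := by
  have h0 : 0 ≤ (1 - ε) * s := mul_nonneg (by linarith) hs.le
  rw [timeAvg_eq_integral H T hε hs, fbmCov_comm T s, fbmCov_comm T ((1 - ε) * s),
    ← integral_timePot hH hs.le hT,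
    ← integral_timePot hH h0 hT, intervalIntegral.integral_interval_sub_left]
  · exact intervalIntegrable_timePot hH T le_rfl hs.le
  · exact intervalIntegrable_timePot hH T le_rfl h0

lemma spaceAvg_eq_integral (f : Sp d → ℝ) (A : Set (Sp d)) (ε : ℝ) (y : Sp d) :
    spaceAvg f A ε y = (volume.real (Metric.closedBall (0 : Sp d) ε))⁻¹ *
      ∫ x in Metric.closedBall y ε, spacePot f A x := by
  rw [spaceAvg, integral_unifSpace]
  congr 1
  have := (measurePreserving_add_left (volume : Measure (Sp d)) y).setIntegral_preimage_emb
    (Homeomorph.addLeft y).measurableEmbedding (fun x => spacePot f A x) (Metric.closedBall y ε)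
  rw [← this]
  congr 2
  ext k
  simp

lemma IsSpatialKernel.spaceAvg_eq (hf : IsSpatialKernel f μ) {A : Set (Sp d)}
    (hA : Bornology.IsBounded A) (ε : ℝ) (y : Sp d) :
    spaceAvg f A ε y = (volume.real (Metric.closedBall (0 : Sp d) ε))⁻¹ *
      spaceCov f A (Metric.closedBall y ε) := by
  rw [spaceAvg_eq_integral, hf.spaceCov_comm hA Metric.isBounded_closedBall, spaceCov_eq]

/-- The interval `[(1-ε)s, s]` is a ball centred at `(1-ε/2)s` that contains `s`, so Lebesgue
differentiation along non-centred balls applies. -/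
lemma ae_tendsto_timeAvg (hH : 1 / 2 ≤ H) (T : ℝ) : ∀ᵐ s : ℝ, 0 < s →
    Filter.Tendsto (fun ε => timeAvg H T ε s) (nhdsWithin 0 (Set.Ioi 0))
      (nhds (timePot H T s)) := by
  -- The bound `exists_timePot_le` covers nonnegative times only; for `s > 0` and `ε < 1` the
  -- cut-off is invisible.
  set g : ℝ → ℝ := (Set.Ici 0).indicator (timePot H T) with hg
  have hgi : LocallyIntegrable g volume := by
    rw [locallyIntegrable_iff]
    intro K hK
    obtain ⟨R, hR⟩ := hK.isBounded.subset_closedBall 0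
    obtain ⟨C, hC, h⟩ := exists_timePot_le hH T R
    refine Measure.integrableOn_of_bounded (M := C) hK.measure_lt_top.ne
      ((measurable_timePot hH T).indicator measurableSet_Ici).aestronglyMeasurable ?_
    refine (ae_restrict_iff' hK.measurableSet).2 (Filter.Eventually.of_forall fun s hs => ?_)
    by_cases h0 : 0 ≤ s
    · rw [hg, Set.indicator_of_mem (show s ∈ Set.Ici 0 from h0)]
      refine h s ⟨h0, ?_⟩
      have := hR hs
      rw [Metric.mem_closedBall, dist_zero_right, Real.norm_eq_abs] at this
      exact (le_abs_self s).trans this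
    · rw [hg, Set.indicator_of_notMem (show s ∉ Set.Ici 0 from h0)]
      simpa using hC
  filter_upwards [IsUnifLocDoublingMeasure.ae_tendsto_average (μ := volume) hgi 1] with s hs h0
  have hδ : Filter.Tendsto (fun ε : ℝ => ε * s / 2) (nhdsWithin 0 (Set.Ioi 0))
      (nhdsWithin 0 (Set.Ioi 0)) := by
    refine tendsto_nhdsWithin_iff.2 ⟨?_, ?_⟩
    · have : Filter.Tendsto (fun ε : ℝ => ε * s / 2) (nhds 0) (nhds (0 * s / 2)) :=
        Continuous.tendsto (by fun_prop) 0
      simp only [zero_mul, zero_div] at this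
      exact this.mono_left nhdsWithin_le_nhds
    · filter_upwards [self_mem_nhdsWithin] with ε hε
      have : 0 < ε := hε
      exact Set.mem_Ioi.2 (by positivity)
  have hball : ∀ ε : ℝ, Metric.closedBall ((1 - ε / 2) * s) (ε * s / 2) =
      Set.Icc ((1 - ε) * s) s := by
    intro ε
    rw [Real.closedBall_eq_Icc]
    congr 1 <;> ring
  have := hs (fun ε => (1 - ε / 2) * s) (fun ε => ε * s / 2) hδ (by
    filter_upwards [self_mem_nhdsWithin] with ε hε
    rw [one_mul, hball]
    have : 0 < ε := hε
    exact ⟨by nlinarith, le_rfl⟩)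
  rw [hg, Set.indicator_of_mem (show s ∈ Set.Ici 0 from h0.le), ← hg] at this
  refine this.congr' ?_
  filter_upwards [Ioo_mem_nhdsGT (zero_lt_one' ℝ)] with ε hε
  have hle : (1 - ε) * s ≤ s := by nlinarith [hε.1]
  rw [hball, timeAvg_eq_integral H T hε.1 h0, setAverage_eq, smul_eq_mul, measureReal_def,
    Real.volume_Icc, ENNReal.toReal_ofReal (by linarith),
    intervalIntegral.integral_of_le hle, ← integral_Icc_eq_integral_Ioc]
  congr 1
  · congr 1; ring
  · refine setIntegral_congr_fun measurableSet_Icc fun r hr => ?_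
    exact Set.indicator_of_mem (show r ∈ Set.Ici 0 from
      (mul_nonneg (by linarith [hε.2]) h0.le).trans hr.1) _

lemma IsSpatialKernel.ae_tendsto_spaceAvg (hf : IsSpatialKernel f μ) {A : Set (Sp d)}
    (hA : Bornology.IsBounded A) : ∀ᵐ y : Sp d,
    Filter.Tendsto (fun ε => spaceAvg f A ε y) (nhdsWithin 0 (Set.Ioi 0))
      (nhds (spacePot f A y)) := by
  have hgi : LocallyIntegrable (spacePot f A) volume := by
    rw [locallyIntegrable_iff]
    intro K hK
    exact hf.integrableOn_spacePot hK.isBounded hA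
  filter_upwards [IsUnifLocDoublingMeasure.ae_tendsto_average (μ := volume) hgi 1] with y hy
  have := hy (fun _ => y) (fun ε : ℝ => ε) Filter.tendsto_id (by
    filter_upwards [self_mem_nhdsWithin] with ε hε
    rw [one_mul]
    exact Metric.mem_closedBall_self (le_of_lt hε))
  refine this.congr fun ε => ?_
  rw [setAverage_eq, spaceAvg_eq_integral, smul_eq_mul, measureReal_def, measureReal_def,
    Measure.addHaar_closedBall_center]

/-- The average of the potential of `1_{[0,T] × A}` at a point. -/
def potAvg (H : ℝ) (f : Sp d → ℝ) (a : Rect d) (ε : ℝ) (z : ℝ × Sp d) : ℝ :=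
  timeAvg H a.time ε z.1 * spaceAvg f a.set ε z.2

/-- The uniform distribution on scalings of time and translations in space. -/
def unifMove (d : ℕ) (ε : ℝ) : Measure (ℝ × Sp d) := (unifTime ε).prod (unifSpace d ε)

lemma isProbabilityMeasure_unifMove (d : ℕ) {ε : ℝ} (hε : 0 < ε) :
    IsProbabilityMeasure (unifMove d ε) := by
  have := isProbabilityMeasure_unifTime hε
  have := isProbabilityMeasure_unifSpace d hε
  unfold unifMove
  infer_instance

/-- Scaling in time and translation in space. -/
def move (θ z : ℝ × Sp d) : ℝ × Sp d := (θ.1 * z.1, z.2 + θ.2)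

lemma measurable_move : Measurable fun p : (ℝ × Sp d) × (ℝ × Sp d) => move p.1 p.2 := by
  unfold move; fun_prop

/-- Rewrites the two separate averages as a single average over random moves, so that norm bounds
for one move pass to the average. -/
lemma potAvg_eq (a : Rect d) {ε : ℝ} (hε : 0 < ε) (z : ℝ × Sp d) :
    potAvg H f a ε z = ∫ θ, pot H f a (move θ z) ∂unifMove d ε := by
  have := isProbabilityMeasure_unifTime hε
  have := isProbabilityMeasure_unifSpace d hε
  simp only [potAvg, timeAvg, spaceAvg, pot_eq, move, unifMove]
  exact (integral_prod_mul (fun r => timePot H a.time (r * z.1))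
    fun k => spacePot f a.set (z.2 + k)).symm

lemma ae_unifMove {ε : ℝ} : ∀ᵐ θ ∂unifMove d ε, θ.1 ∈ Set.Icc (1 - ε) 1 := by
  have h : ∀ᵐ r ∂unifTime ε, r ∈ Set.Icc (1 - ε) 1 := ae_cond_mem measurableSet_Icc
  have : SFinite (unifSpace d ε) := by unfold unifSpace ProbabilityTheory.cond; infer_instance
  exact Measure.quasiMeasurePreserving_fst.ae h

lemma IsSpatialKernel.ae_tendsto_potAvg (hf : IsSpatialKernel f μ) (hH : 1 / 2 ≤ H) (a : Rect d) :
    ∀ᵐ z : ℝ × Sp d, 0 < z.1 →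
      Filter.Tendsto (fun ε => potAvg H f a ε z) (nhdsWithin 0 (Set.Ioi 0))
        (nhds (pot H f a z)) := by
  have h1 := Measure.quasiMeasurePreserving_fst (μ := (volume : Measure ℝ))
    (ν := (volume : Measure (Sp d))) |>.ae (ae_tendsto_timeAvg hH a.time)
  have h2 := Measure.quasiMeasurePreserving_snd (μ := (volume : Measure ℝ))
    (ν := (volume : Measure (Sp d))) |>.ae (hf.ae_tendsto_spaceAvg a.bounded)
  filter_upwards [h1, h2] with z h1 h2 h0
  rw [pot_eq]
  exact (h1 h0).mul h2

end Average

/-! ### Uniform bounds under scaling in time and translation in space -/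

section Move

variable {d : ℕ} {H : ℝ} {f : Sp d → ℝ} {μ : Measure (Sp d)}

/-- The rectangle whose potential is the potential of `a` after scaling in time and translation
in space. -/
def Rect.move (θ : ℝ × Sp d) (a : Rect d) : Rect d where
  -- The absolute value keeps the time nonnegative for every `θ`; the lemmas below use positive
  -- scalings.
  time := a.time / |θ.1|
  time_nonneg := div_nonneg a.time_nonneg (abs_nonneg _)
  set := shift (-θ.2) a.set
  measurableSet := a.measurableSet.preimage (measurable_id.sub measurable_const)
  bounded := (IsometryEquiv.subRight (-θ.2)).isometry.antilipschitz.isBounded_preimage a.bounded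

/-- Homogeneity of the time potential and translation covariance of the space potential: moving the
point amounts, up to a scalar, to moving the rectangle. Scaling, unlike translation in time, keeps
intervals anchored at zero. -/
lemma pot_move (hH : 1 / 2 ≤ H) {θ : ℝ × Sp d} (hθ : 0 < θ.1) (a : Rect d) (z : ℝ × Sp d) :
    pot H f a (StochHeat.move θ z) = θ.1 ^ (2 * H - 1) * pot H f (a.move θ) z := by
  rw [pot_eq, pot_eq]
  simp only [Rect.move, StochHeat.move, spacePot_shift, abs_of_pos hθ, sub_neg_eq_add]
  rw [← mul_assoc, ← timePot_mul hH hθ, mul_div_cancel₀ _ hθ.ne']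

lemma IsSpatialKernel.inner_ind_move (hf : IsSpatialKernel f μ) (hH : 1 / 2 ≤ H) (hH1 : H < 1)
    {θ : ℝ × Sp d} (hθ : 0 < θ.1) (a b : Rect d) :
    inner ℝ (ind H f (a.move θ)) (ind H f (b.move θ)) =
      θ.1⁻¹ ^ (2 * H) * inner ℝ (ind H f a) (ind H f b) := by
  rw [hf.inner_ind hH hH1, hf.inner_ind hH hH1]
  simp only [Rect.move, spaceCov_shift, abs_of_pos hθ]
  rw [← mul_assoc, ← fbmCov_mul (inv_nonneg.2 hθ.le), div_eq_inv_mul, div_eq_inv_mul]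

/-- Linear combinations of indicator functions of products of rectangles. -/
abbrev combo (H : ℝ) (f : Sp d → ℝ) {n : ℕ} (c : (Fin n → Rect d) →₀ ℝ) : TensorPow (HP H f) n :=
  Finsupp.linearCombination ℝ (fun a : Fin n → Rect d => tens fun i => ind H f (a i)) c

lemma denseRange_combo (n : ℕ) :
    DenseRange (combo H f : ((Fin n → Rect d) →₀ ℝ) → TensorPow (HP H f) n) := by
  have h1 : (LinearMap.range (Finsupp.linearCombination ℝ
      (fun a : Fin n → Rect d => tens fun i => ind H f (a i)))).topologicalClosure = ⊤ := by
    rw [Submodule.topologicalClosure_eq_top_iff, Submodule.eq_bot_iff]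
    intro v hv
    refine ext_inner_tens_gen fun a => ?_
    rw [inner_zero_right]
    refine (Submodule.mem_orthogonal _ v).1 hv _ ⟨Finsupp.single a 1, ?_⟩
    simp [ind]
  rw [DenseRange, dense_iff_closure_eq]
  exact (Submodule.topologicalClosure_coe _).symm.trans
    (congrArg (fun S : Submodule ℝ (TensorPow (HP H f) n) => (S : Set (TensorPow (HP H f) n))) h1)

/-- By self-similarity the whole Gram matrix is multiplied by one constant, the product of the
`θ_i^{-2H}`. Each factor is at most `2^{2H} ≤ 4` as `θ_i ≥ 1/2`, which gives `2^n` for the norm. -/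
lemma IsSpatialKernel.norm_combo_move_le (hf : IsSpatialKernel f μ) (hH : 1 / 2 ≤ H) (hH1 : H < 1)
    {n : ℕ} {θ : Fin n → ℝ × Sp d} (hθ : ∀ i, 1 / 2 ≤ (θ i).1) (c : (Fin n → Rect d) →₀ ℝ) :
    ‖Finsupp.linearCombination ℝ (fun a : Fin n → Rect d =>
      tens fun i => ind H f ((a i).move (θ i))) c‖ ≤ 2 ^ n * ‖combo H f c‖ := by
  have hpos : ∀ i, 0 < (θ i).1 := fun i => by linarith [hθ i]
  have h1 : ‖Finsupp.linearCombination ℝ (fun a : Fin n → Rect d =>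
      tens fun i => ind H f ((a i).move (θ i))) c‖ ^ 2 =
      (∏ i, (θ i).1⁻¹ ^ (2 * H)) * ‖combo H f c‖ ^ 2 := by
    rw [norm_sq_linearCombination, norm_sq_linearCombination, Finset.mul_sum]
    refine Finset.sum_congr rfl fun a _ => ?_
    rw [Finset.mul_sum]
    refine Finset.sum_congr rfl fun b _ => ?_
    simp only [inner_tens, hf.inner_ind_move hH hH1 (hpos _), Finset.prod_mul_distrib]
    ring
  have h2 : ∏ i, (θ i).1⁻¹ ^ (2 * H) ≤ ∏ _i : Fin n, (4 : ℝ) := by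
    refine Finset.prod_le_prod (fun i _ => ?_) fun i _ => ?_
    · exact Real.rpow_nonneg (inv_nonneg.2 (hpos i).le) _
    · calc (θ i).1⁻¹ ^ (2 * H) ≤ 2 ^ (2 * H) := by
            refine Real.rpow_le_rpow (inv_nonneg.2 (hpos i).le) ?_ (by linarith)
            rw [inv_le_comm₀ (hpos i) two_pos]
            linarith [hθ i]
        _ ≤ 2 ^ (2 : ℝ) := Real.rpow_le_rpow_of_exponent_le one_le_two (by linarith)
        _ = 4 := by norm_num
  refine le_of_sq_le_sq ?_ (by positivity)
  rw [h1, mul_pow, ← pow_mul, mul_comm n, pow_mul]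
  norm_num at h2 ⊢
  gcongr

lemma ae_pi_apply {X : Type*} [MeasurableSpace X] {ν : Measure X} [SigmaFinite ν] {n : ℕ}
    {p : X → Prop} (h : ∀ᵐ x ∂ν, p x) (i : Fin n) : ∀ᵐ z ∂Measure.pi fun _ : Fin n => ν, p (z i) :=
  (Measure.quasiMeasurePreserving_eval (fun _ : Fin n => ν) i).ae h

/-- The integral of a chaos kernel against the moved potentials. -/
def movedIntegral (H : ℝ) (f : Sp d → ℝ) (u₀ : Sp d → ℝ) {n : ℕ} (t : ℝ) (x : Sp d)
    (a : Fin n → Rect d) (θ : Fin n → ℝ × Sp d) : ℝ :=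
  ∫ z, chaosKernel u₀ n t x z * ∏ i, pot H f (a i) (move (θ i) (z i))

/-- The moved integral is, up to the factor `∏ θ_i^{2H-1} ≤ 1`, the pairing of `G` with moved
rectangles, so Cauchy–Schwarz and the norm bound for moves apply. -/
lemma IsSpatialKernel.abs_sum_movedIntegral_le (hf : IsSpatialKernel f μ) (hH : 1 / 2 ≤ H)
    (hH1 : H < 1) (u₀ : Sp d →ᵇ ℝ) {n : ℕ} {t : ℝ} {x : Sp d} {G : TensorPow (HP H f) n}
    (hG : Represents H f (chaosKernel u₀ n t x) G)
    {θ : Fin n → ℝ × Sp d} (hθ : ∀ i, (θ i).1 ∈ Set.Icc (1 / 2) 1) (c : (Fin n → Rect d) →₀ ℝ) :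
    |∑ a ∈ c.support, c a * movedIntegral H f u₀ t x a θ| ≤ 2 ^ n * ‖combo H f c‖ * ‖G‖ := by
  have hpos : ∀ i, 0 < (θ i).1 := fun i => by linarith [(hθ i).1]
  rw [hf.represents_chaosKernel_iff hH] at hG
  have h1 : ∀ a, movedIntegral H f u₀ t x a θ = (∏ i, (θ i).1 ^ (2 * H - 1)) *
      inner ℝ (tens fun i => ind H f ((a i).move (θ i))) G := by
    intro a
    rw [hG fun i => (a i).move (θ i), movedIntegral, ← integral_const_mul]
    refine integral_congr_ae (Filter.Eventually.of_forall fun z => ?_)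
    simp only [pot_move hH (hpos _), Finset.prod_mul_distrib]
    ring
  have h2 : ∑ a ∈ c.support, c a * movedIntegral H f u₀ t x a θ =
      (∏ i, (θ i).1 ^ (2 * H - 1)) * inner ℝ (Finsupp.linearCombination ℝ
        (fun a : Fin n → Rect d => tens fun i => ind H f ((a i).move (θ i))) c) G := by
    rw [Finsupp.linearCombination_apply, Finsupp.sum, sum_inner, Finset.mul_sum]
    refine Finset.sum_congr rfl fun a _ => ?_
    rw [real_inner_smul_left, h1]
    ring
  rw [h2, abs_mul]
  have h3 : |∏ i, (θ i).1 ^ (2 * H - 1)| ≤ 1 := by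
    rw [abs_of_nonneg (Finset.prod_nonneg fun i _ => Real.rpow_nonneg (hpos i).le _)]
    exact Finset.prod_le_one (fun i _ => Real.rpow_nonneg (hpos i).le _) fun i _ =>
      Real.rpow_le_one (hpos i).le (hθ i).2 (by linarith)
  calc _ ≤ 1 * (‖Finsupp.linearCombination ℝ (fun a : Fin n → Rect d =>
        tens fun i => ind H f ((a i).move (θ i))) c‖ * ‖G‖) := by
        gcongr
        exact abs_real_inner_le_norm _ _
    _ ≤ _ := by
        rw [one_mul]
        gcongr
        exact hf.norm_combo_move_le hH hH1 (fun i => (hθ i).1) c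

/-- Contractions by factors in `[1-ε,1]` map `(0,t)` into `[0,t]`, where the potentials are bounded.
-/
lemma IsSpatialKernel.integrable_move (hf : IsSpatialKernel f μ) (hH : 1 / 2 ≤ H)
    (u₀ : Sp d →ᵇ ℝ) {n : ℕ} (t : ℝ) (x : Sp d) (a : Fin n → Rect d) {ε : ℝ} (hε : 0 < ε)
    (hε1 : ε ≤ 1) :
    Integrable (fun p : (Fin n → ℝ × Sp d) × (Fin n → ℝ × Sp d) =>
      chaosKernel u₀ n t x p.1 * ∏ i, pot H f (a i) (move (p.2 i) (p.1 i)))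
      (volume.prod (Measure.pi fun _ => unifMove d ε)) := by
  have := isProbabilityMeasure_unifMove d hε
  obtain ⟨C, hC, h⟩ := hf.exists_prod_pot_le hH a t
  refine (((integrable_chaosKernel u₀ n t x).comp_fst
    (Measure.pi fun _ => unifMove d ε)).norm.const_mul C).mono' ?_ ?_
  · refine Measurable.aestronglyMeasurable ?_
    refine ((measurable_chaosKernel u₀ n t x).comp measurable_fst).mul
      (Finset.measurable_fun_prod _ fun i _ => (hf.measurable_pot hH (a i)).comp ?_)
    have h1 : Measurable fun p : (Fin n → ℝ × Sp d) × (Fin n → ℝ × Sp d) => (p.2 i, p.1 i) :=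
      ((measurable_pi_apply i).comp measurable_snd).prodMk
        ((measurable_pi_apply i).comp measurable_fst)
    exact measurable_move.comp h1
  · have h1 : ∀ᵐ θ ∂(Measure.pi fun _ : Fin n => unifMove d ε), ∀ i,
        (θ i).1 ∈ Set.Icc (1 - ε) 1 := by
      rw [Filter.eventually_all]
      exact fun i => ae_pi_apply ae_unifMove i
    filter_upwards [Measure.quasiMeasurePreserving_snd.ae h1] with p hp
    refine abs_chaosKernel_mul_le u₀ fun hz => h _ fun i => ?_
    have h2 := hp i
    have h3 := hz i
    constructor
    · exact mul_nonneg (by linarith [h2.1]) h3.1.le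
    · exact (mul_le_of_le_one_left h3.1.le h2.2).trans h3.2.le

lemma IsSpatialKernel.integral_potAvg (hf : IsSpatialKernel f μ) (hH : 1 / 2 ≤ H)
    (u₀ : Sp d →ᵇ ℝ) {n : ℕ} (t : ℝ) (x : Sp d) (a : Fin n → Rect d) {ε : ℝ} (hε : 0 < ε)
    (hε1 : ε ≤ 1) :
    ∫ z, chaosKernel u₀ n t x z * ∏ i, potAvg H f (a i) ε (z i) =
      ∫ θ, movedIntegral H f u₀ t x a θ ∂(Measure.pi fun _ => unifMove d ε) := by
  have := isProbabilityMeasure_unifMove d hε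
  have hi := hf.integrable_move hH u₀ t x a hε hε1
  refine Eq.trans ?_ (integral_integral_swap hi)
  refine integral_congr_ae (Filter.Eventually.of_forall fun z => ?_)
  simp only [integral_const_mul]
  congr 1
  rw [integral_fintype_prod_eq_prod (fun i θ => pot H f (a i) (move θ (z i)))]
  exact Finset.prod_congr rfl fun i _ => potAvg_eq (a i) hε (z i)

/-- The integral of a chaos kernel against averaged potentials, as a linear functional. -/
def avgFunctional (H : ℝ) (f : Sp d → ℝ) (u₀ : Sp d → ℝ) (n : ℕ) (t : ℝ) (x : Sp d) (ε : ℝ) :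
    ((Fin n → Rect d) →₀ ℝ) →ₗ[ℝ] ℝ :=
  Finsupp.linearCombination ℝ fun a =>
    ∫ z, chaosKernel u₀ n t x z * ∏ i, potAvg H f (a i) ε (z i)

/-- An average over moves of functionals with a common bound. The point is that the bound does not
depend on `ε`. -/
lemma IsSpatialKernel.abs_avgFunctional_le (hf : IsSpatialKernel f μ) (hH : 1 / 2 ≤ H)
    (hH1 : H < 1) (u₀ : Sp d →ᵇ ℝ) {n : ℕ} {t : ℝ} {x : Sp d} {G : TensorPow (HP H f) n}
    (hG : Represents H f (chaosKernel u₀ n t x) G) {ε : ℝ} (hε : 0 < ε) (hε1 : ε ≤ 1 / 2)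
    (c : (Fin n → Rect d) →₀ ℝ) :
    |avgFunctional H f u₀ n t x ε c| ≤ 2 ^ n * ‖combo H f c‖ * ‖G‖ := by
  have := isProbabilityMeasure_unifMove d hε
  have hε1' : ε ≤ 1 := by linarith
  have e : avgFunctional H f u₀ n t x ε c = ∫ θ, ∑ a ∈ c.support,
      c a * movedIntegral H f u₀ t x a θ ∂(Measure.pi fun _ => unifMove d ε) := by
    have hi : ∀ a ∈ c.support, Integrable (fun θ => c a * movedIntegral H f u₀ t x a θ)
        (Measure.pi fun _ => unifMove d ε) := fun a _ =>
      ((hf.integrable_move hH u₀ t x a hε hε1').integral_prod_right).const_mul (c a)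
    rw [integral_finsetSum _ hi]
    simp only [avgFunctional, Finsupp.linearCombination_apply, Finsupp.sum, smul_eq_mul,
      hf.integral_potAvg hH u₀ t x _ hε hε1', integral_const_mul]
  rw [e, ← Real.norm_eq_abs]
  refine (norm_integral_le_of_norm_le_const (C := 2 ^ n * ‖combo H f c‖ * ‖G‖) ?_).trans_eq
    (by simp)
  have h1 : ∀ᵐ θ ∂(Measure.pi fun _ : Fin n => unifMove d ε), ∀ i,
      (θ i).1 ∈ Set.Icc (1 - ε) 1 := by
    rw [Filter.eventually_all]
    exact fun i => ae_pi_apply ae_unifMove i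
  filter_upwards [h1] with θ hθ
  exact hf.abs_sum_movedIntegral_le hH hH1 u₀ hG
    (fun i => ⟨by linarith [(hθ i).1], (hθ i).2⟩) c

lemma IsSpatialKernel.abs_potAvg_le (hf : IsSpatialKernel f μ) (hH : 1 / 2 ≤ H) (a : Rect d)
    (t : ℝ) : ∃ C, 0 ≤ C ∧ ∀ ε : ℝ, 0 < ε → ε ≤ 1 → ∀ z : ℝ × Sp d, z.1 ∈ Set.Icc 0 t →
      |potAvg H f a ε z| ≤ C := by
  obtain ⟨C, hC, h⟩ := hf.exists_pot_le hH a t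
  refine ⟨C, hC, fun ε hε hε1 z hz => ?_⟩
  have := isProbabilityMeasure_unifMove d hε
  rw [potAvg_eq a hε, ← Real.norm_eq_abs]
  refine (norm_integral_le_of_norm_le_const (C := C) ?_).trans_eq (by simp)
  filter_upwards [ae_unifMove] with θ hθ
  refine h _ ⟨mul_nonneg (by linarith [hθ.1]) hz.1, ?_⟩
  exact (mul_le_of_le_one_left hz.1 hθ.2).trans hz.2

lemma IsSpatialKernel.measurable_potAvg (hf : IsSpatialKernel f μ) (hH : 1 / 2 ≤ H) (a : Rect d)
    {ε : ℝ} (hε : 0 < ε) : Measurable (potAvg H f a ε) := by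
  have := isProbabilityMeasure_unifMove d hε
  have e : potAvg H f a ε = fun z => ∫ θ, pot H f a (move θ z) ∂unifMove d ε :=
    funext fun z => potAvg_eq a hε z
  rw [e]
  have : Measurable fun p : (ℝ × Sp d) × (ℝ × Sp d) => pot H f a (move p.2 p.1) :=
    (hf.measurable_pot hH a).comp (measurable_move.comp measurable_swap)
  exact this.stronglyMeasurable.integral_prod_right.measurable

/-- Dominated convergence: the averages inherit the bounds of the potentials and converge almost
everywhere at positive times; at other times the chaos kernel vanishes. -/
lemma IsSpatialKernel.tendsto_avgFunctional (hf : IsSpatialKernel f μ) (hH : 1 / 2 ≤ H)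
    (u₀ : Sp d →ᵇ ℝ) {n : ℕ} {t : ℝ} {x : Sp d} {G : TensorPow (HP H f) n}
    (hG : Represents H f (chaosKernel u₀ n t x) G) (c : (Fin n → Rect d) →₀ ℝ) :
    Filter.Tendsto (fun ε => avgFunctional H f u₀ n t x ε c) (nhdsWithin 0 (Set.Ioi 0))
      (nhds (inner ℝ (combo H f c) G)) := by
  rw [hf.represents_chaosKernel_iff hH] at hG
  simp only [avgFunctional, Finsupp.linearCombination_apply, Finsupp.sum, sum_inner,
    real_inner_smul_left, smul_eq_mul]
  refine tendsto_finsetSum _ fun a _ => Filter.Tendsto.const_mul _ ?_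
  rw [hG]
  choose C hC h using fun i => hf.abs_potAvg_le hH (a i) t
  refine tendsto_integral_filter_of_dominated_convergence
    (fun z => (∏ i, C i) * |chaosKernel u₀ n t x z|) ?_ ?_ ?_ ?_
  · filter_upwards [self_mem_nhdsWithin] with ε hε
    exact ((measurable_chaosKernel u₀ n t x).mul (Finset.measurable_fun_prod _ fun i _ =>
      (hf.measurable_potAvg hH (a i) hε).comp (measurable_pi_apply i))).aestronglyMeasurable
  · filter_upwards [Ioo_mem_nhdsGT (zero_lt_one' ℝ)] with ε hε
    refine Filter.Eventually.of_forall fun z => ?_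
    refine abs_chaosKernel_mul_le u₀ fun hz => ?_
    rw [Finset.abs_prod]
    exact Finset.prod_le_prod (fun i _ => abs_nonneg _) fun i _ =>
      h i ε hε.1 hε.2.le _ ⟨(hz i).1.le, (hz i).2.le⟩
  · exact (integrable_chaosKernel u₀ n t x).norm.const_mul _
  · have h1 : ∀ᵐ z : Fin n → ℝ × Sp d, ∀ i, 0 < (z i).1 →
        Filter.Tendsto (fun ε => potAvg H f (a i) ε (z i)) (nhdsWithin 0 (Set.Ioi 0))
          (nhds (pot H f (a i) (z i))) := by
      rw [Filter.eventually_all]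
      exact fun i => ae_pi_apply (hf.ae_tendsto_potAvg hH (a i)) i
    filter_upwards [h1] with z hz
    by_cases hp : ∀ i, 0 < (z i).1
    · exact (tendsto_finsetProd _ fun i _ => hz i (hp i)).const_mul _
    · push Not at hp
      obtain ⟨i, hi⟩ := hp
      rw [chaosKernel_eq_zero u₀ (i := i) fun h => hi.not_gt h.1]
      simp

end Move

/-- Multilinearity, one slot at a time: in each slot the vanishing vectors form a subspace. -/
lemma inner_tens_eq_zero_of_mem_span {V : Type*} [NormedAddCommGroup V] [InnerProductSpace ℝ V]
    {n : ℕ} {S : Set V} {v : TensorPow V n}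
    (h0 : ∀ h : Fin n → V, (∀ i, h i ∈ S) → inner ℝ (tens h) v = 0) (h : Fin n → V)
    (hh : ∀ i, h i ∈ Submodule.span ℝ S) : inner ℝ (tens h) v = 0 := by
  classical
  have key : ∀ s : Finset (Fin n), ∀ h : Fin n → V, (∀ i ∈ s, h i ∈ Submodule.span ℝ S) →
      (∀ i ∉ s, h i ∈ S) → inner ℝ (tens h) v = 0 := by
    intro s
    induction s using Finset.induction_on with
    | empty => exact fun h _ hS => h0 h fun i => hS i (by simp)
    | insert i s hi ih =>
      intro h hs hS
      set L : V →ₗ[ℝ] ℝ := (innerₗ (TensorPow V n)).flip v ∘ₗ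
        (tensMultilinear V n).toLinearMap h i with hL
      have e : ∀ x, L x = inner ℝ (tens (Function.update h i x)) v := fun x => rfl
      have h1 : Submodule.span ℝ S ≤ LinearMap.ker L := by
        rw [Submodule.span_le]
        intro x hx
        change L x = 0
        rw [e]
        refine ih _ (fun j hj => ?_) fun j hj => ?_
        · rw [Function.update_of_ne (fun h : j = i => hi (h ▸ hj))]
          exact hs j (by simp [hj])
        · by_cases hji : j = i
          · subst hji; simpa using hx
          · rw [Function.update_of_ne hji]
            exact hS j (by simp [hj, hji])
      have h2 : L (h i) = 0 := h1 (hs i (by simp))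
      rwa [e, Function.update_eq_self] at h2
  exact key Finset.univ h (fun i _ => hh i) (by simp)

/-! ### Normalized increments and orthogonality to the future -/

section Bump

variable {d : ℕ} {H : ℝ} {f : Sp d → ℝ} {μ : Measure (Sp d)}

/-- The product of `[0,s]` and the ball of radius `ε` at `y`. -/
def ballRect (s : ℝ) (y : Sp d) (ε : ℝ) : Rect d where
  time := max s 0
  time_nonneg := le_max_right _ _
  set := Metric.closedBall y ε
  measurableSet := measurableSet_closedBall
  bounded := Metric.isBounded_closedBall

/-- A normalized indicator function of `[(1-ε)s,s] × B(y,ε)`. -/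
def bump (H : ℝ) (f : Sp d → ℝ) (ε : ℝ) (z : ℝ × Sp d) : HP H f :=
  ((ε * z.1)⁻¹ * (volume.real (Metric.closedBall (0 : Sp d) ε))⁻¹) •
    (ind H f (ballRect z.1 z.2 ε) - ind H f (ballRect ((1 - ε) * z.1) z.2 ε))

/-- After averaging, evaluation of a potential at `z` is realized by an actual vector of `HP`, built
from rectangles that end no later than the time of `z`. -/
lemma IsSpatialKernel.inner_ind_bump (hf : IsSpatialKernel f μ) (hH : 1 / 2 ≤ H) (hH1 : H < 1)
    (a : Rect d) {ε : ℝ} (hε : 0 < ε) (hε1 : ε ≤ 1) {z : ℝ × Sp d} (hz : 0 < z.1) :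
    inner ℝ (ind H f a) (bump H f ε z) = potAvg H f a ε z := by
  rw [bump, real_inner_smul_right, inner_sub_right, hf.inner_ind hH hH1, hf.inner_ind hH hH1,
    potAvg, timeAvg_eq hH a.time_nonneg hε hε1 hz, hf.spaceAvg_eq a.bounded]
  simp only [ballRect, max_eq_left hz.le,
    max_eq_left (mul_nonneg (sub_nonneg.2 hε1) hz.le)]
  ring

lemma IsSpatialKernel.norm_ind_ballRect (hf : IsSpatialKernel f μ) (hH : 1 / 2 ≤ H) (hH1 : H < 1)
    {s : ℝ} (hs : 0 ≤ s) (y : Sp d) (ε : ℝ) :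
    ‖ind H f (ballRect s y ε)‖ = s ^ H * ‖ind H f (ballRect 1 (0 : Sp d) ε)‖ := by
  refine (sq_eq_sq₀ (norm_nonneg _) (by positivity)).1 ?_
  rw [mul_pow, ← real_inner_self_eq_norm_sq, ← real_inner_self_eq_norm_sq, hf.inner_ind hH hH1,
    hf.inner_ind hH hH1]
  have h1 : Metric.closedBall y ε = shift y (Metric.closedBall (0 : Sp d) ε) := by
    ext x; simp [shift, dist_eq_norm]
  simp only [ballRect, max_eq_left hs, max_eq_left zero_le_one, h1, spaceCov_shift]
  have h2 := fbmCov_mul (H := H) hs 1 1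
  rw [mul_one] at h2
  rw [h2, ← Real.rpow_natCast (s ^ H), ← Real.rpow_mul hs]
  push_cast
  rw [mul_comm H 2]
  ring

/-- By self-similarity each rectangle has norm of order `s^H`, and the normalization contributes
`s⁻¹`. The triangle inequality is enough: `C` may depend on `ε`, and only integrability of `s^{H-1}`
at zero is used later. -/
lemma IsSpatialKernel.norm_bump_le (hf : IsSpatialKernel f μ) (hH : 1 / 2 ≤ H) (hH1 : H < 1)
    {ε : ℝ} (hε : 0 < ε) (hε1 : ε ≤ 1) : ∃ C, 0 ≤ C ∧ ∀ z : ℝ × Sp d, 0 < z.1 →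
      ‖bump H f ε z‖ ≤ C * z.1 ^ (H - 1) := by
  set N := ‖ind H f (ballRect 1 (0 : Sp d) ε)‖ with hN
  set B := (volume.real (Metric.closedBall (0 : Sp d) ε))⁻¹ with hB
  have hB0 : 0 ≤ B := inv_nonneg.2 measureReal_nonneg
  refine ⟨ε⁻¹ * B * (2 * N), by positivity, fun z hz => ?_⟩
  have h0 : 0 ≤ (1 - ε) * z.1 := mul_nonneg (sub_nonneg.2 hε1) hz.le
  rw [bump, norm_smul, Real.norm_of_nonneg (by positivity)]
  have h1 : ‖ind H f (ballRect z.1 z.2 ε) - ind H f (ballRect ((1 - ε) * z.1) z.2 ε)‖ ≤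
      z.1 ^ H * (2 * N) := by
    refine (norm_sub_le _ _).trans ?_
    rw [hf.norm_ind_ballRect hH hH1 hz.le, hf.norm_ind_ballRect hH hH1 h0, ← hN]
    have : ((1 - ε) * z.1) ^ H ≤ z.1 ^ H :=
      Real.rpow_le_rpow h0 (mul_le_of_le_one_left hz.le (by linarith)) (by linarith)
    nlinarith [norm_nonneg (ind H f (ballRect 1 (0 : Sp d) ε)),
      mul_le_mul_of_nonneg_right this (norm_nonneg (ind H f (ballRect 1 (0 : Sp d) ε)))]
  calc _ ≤ (ε * z.1)⁻¹ * B * (z.1 ^ H * (2 * N)) := by gcongr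
    _ = _ := by
      rw [Real.rpow_sub_one hz.ne']
      field_simp

lemma bump_mem_span (ε : ℝ) (hε : 0 ≤ ε) {t : ℝ} {z : ℝ × Sp d} (hz : z.1 ∈ Set.Icc 0 t) :
    bump H f ε z ∈ Submodule.span ℝ {h : HP H f | ∃ a : Rect d, a.time ≤ t ∧ h = ind H f a} := by
  refine Submodule.smul_mem _ _ (Submodule.sub_mem _ (Submodule.subset_span ?_)
    (Submodule.subset_span ?_))
  · exact ⟨_, max_le hz.2 (hz.1.trans hz.2), rfl⟩
  · refine ⟨_, max_le ?_ (hz.1.trans hz.2), rfl⟩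
    nlinarith [hz.1, hz.2]

/-- Against vectors orthogonal to the past, the averaged chaos kernel is small. -/
lemma IsSpatialKernel.exists_abs_avgFunctional_le (hf : IsSpatialKernel f μ) (hH : 1 / 2 ≤ H)
    (hH1 : H < 1) (u₀ : Sp d →ᵇ ℝ) {n : ℕ} {t : ℝ} (x : Sp d) {v : TensorPow (HP H f) n}
    (hv : ∀ a : Fin n → Rect d, (∀ i, (a i).time ≤ t) →
      inner ℝ (tens fun i => ind H f (a i)) v = 0) {ε : ℝ} (hε : 0 < ε) (hε1 : ε ≤ 1) :
    ∃ C, 0 ≤ C ∧ ∀ c : (Fin n → Rect d) →₀ ℝ,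
      |avgFunctional H f u₀ n t x ε c| ≤ C * ‖combo H f c - v‖ := by
  obtain ⟨C, hC, hbump⟩ := hf.norm_bump_le hH hH1 hε hε1
  -- A majorant for the norms of the increments, integrable on `(0,t)` because `H - 1 > -1`.
  set w : ℝ → ℝ≥0∞ := fun s => ‖C * s ^ (H - 1)‖ₑ with hw
  have hwm : Measurable w := by
    have : Measurable fun s : ℝ => C * s ^ (H - 1) := by fun_prop
    exact this.enorm
  have hwi : ∫⁻ s in Set.Ioo 0 t, w s < ∞ := by
    rcases le_or_gt t 0 with ht | ht
    · simp [Set.Ioo_eq_empty_of_le ht]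
    · have h1 : IntervalIntegrable (fun s : ℝ => C * s ^ (H - 1)) volume 0 t :=
        (intervalIntegral.intervalIntegrable_rpow' (by linarith)).const_mul C
      rw [intervalIntegrable_iff_integrableOn_Ioo_of_le ht.le] at h1
      exact h1.2
  set D := ‖u₀‖ₑ * (∫⁻ s in Set.Ioo 0 t, w s) ^ n with hD
  have hDt : D ≠ ∞ := by finiteness
  refine ⟨D.toReal, ENNReal.toReal_nonneg, fun c => ?_⟩
  have hint : ∀ a : Fin n → Rect d, Integrable fun z =>
      chaosKernel u₀ n t x z * ∏ i, potAvg H f (a i) ε (z i) := by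
    intro a
    choose C hC h using fun i => hf.abs_potAvg_le hH (a i) t
    refine ((integrable_chaosKernel u₀ n t x).norm.const_mul (∏ i, C i)).mono'
      ((measurable_chaosKernel u₀ n t x).mul (Finset.measurable_fun_prod _ fun i _ =>
        (hf.measurable_potAvg hH (a i) hε).comp (measurable_pi_apply i))).aestronglyMeasurable
      (Filter.Eventually.of_forall fun z => ?_)
    refine abs_chaosKernel_mul_le u₀ fun hz => ?_
    rw [Finset.abs_prod]
    exact Finset.prod_le_prod (fun i _ => abs_nonneg _) fun i _ =>
      h i ε hε hε1 _ ⟨(hz i).1.le, (hz i).2.le⟩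
  have e : avgFunctional H f u₀ n t x ε c = ∫ z, chaosKernel u₀ n t x z *
      ∑ a ∈ c.support, c a * ∏ i, potAvg H f (a i) ε (z i) := by
    simp only [avgFunctional, Finsupp.linearCombination_apply, Finsupp.sum, smul_eq_mul]
    simp only [← integral_const_mul]
    rw [← integral_finsetSum _ fun a _ => (hint a).const_mul (c a)]
    refine integral_congr_ae (Filter.Eventually.of_forall fun z => ?_)
    simp only [Finset.mul_sum]
    exact Finset.sum_congr rfl fun a _ => by ring
  have hpt : ∀ z : Fin n → ℝ × Sp d, ‖chaosKernel u₀ n t x z *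
      ∑ a ∈ c.support, c a * ∏ i, potAvg H f (a i) ε (z i)‖ₑ ≤
      (‖chaosKernel u₀ n t x z‖ₑ * ∏ i, w (z i).1) * ‖combo H f c - v‖ₑ := by
    intro z
    by_cases hz : ∀ i, (z i).1 ∈ Set.Ioo 0 t
    · have h1 : ∑ a ∈ c.support, c a * ∏ i, potAvg H f (a i) ε (z i) =
          inner ℝ (tens fun i => bump H f ε (z i)) (combo H f c - v) := by
        have h2 : inner ℝ (tens fun i => bump H f ε (z i)) v = 0 := by
          refine inner_tens_eq_zero_of_mem_span (S := {h : HP H f | ∃ a : Rect d,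
            a.time ≤ t ∧ h = ind H f a}) (fun h hh => ?_) _ fun i =>
              bump_mem_span ε hε.le ⟨(hz i).1.le, (hz i).2.le⟩
          choose a ha using hh
          obtain rfl : h = fun i => ind H f (a i) := funext fun i => (ha i).2
          exact hv a fun i => (ha i).1
        rw [inner_sub_right, h2, sub_zero, combo, Finsupp.linearCombination_apply, Finsupp.sum,
          inner_sum]
        refine Finset.sum_congr rfl fun a _ => ?_
        rw [real_inner_smul_right, real_inner_comm, inner_tens]
        congr 1
        exact Finset.prod_congr rfl fun i _ =>
          (hf.inner_ind_bump hH hH1 (a i) hε hε1 (hz i).1).symm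
      rw [enorm_mul, mul_assoc, h1]
      gcongr
      have h3 : ‖(inner ℝ (tens fun i => bump H f ε (z i)) (combo H f c - v) : ℝ)‖ ≤
          ‖(∏ i, C * (z i).1 ^ (H - 1)) * ‖combo H f c - v‖‖ := by
        refine (norm_inner_le_norm _ _).trans ?_
        rw [norm_tens, norm_mul, norm_norm]
        gcongr
        rw [norm_prod]
        refine Finset.prod_le_prod (fun i _ => norm_nonneg _) fun i _ => ?_
        exact (hbump _ (hz i).1).trans (Real.le_norm_self _)
      refine (enorm_le_iff_norm_le.2 h3).trans_eq ?_
      rw [enorm_mul, enorm_norm, enorm_eq_nnnorm, nnnorm_prod, ENNReal.ofNNReal_finsetProd]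
      rfl
    · push Not at hz
      obtain ⟨i, hi⟩ := hz
      rw [chaosKernel_eq_zero u₀ (i := i) hi]
      simp
  have hfin : ‖avgFunctional H f u₀ n t x ε c‖ₑ ≤ D * ‖combo H f c - v‖ₑ := by
    rw [e]
    refine (enorm_integral_le_lintegral_enorm _).trans ((lintegral_mono hpt).trans ?_)
    rw [lintegral_mul_const' _ _ (by finiteness)]
    gcongr
    exact lintegral_chaosKernel_mul_le u₀ n t x hwm
  have := ENNReal.toReal_mono (by finiteness) hfin
  simpa [ENNReal.toReal_mul] using this

/-- A chaos kernel at time `t` is orthogonal to everything that is orthogonal to the products of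
rectangles up to time `t`. -/
lemma IsSpatialKernel.inner_eq_zero_of_represents (hf : IsSpatialKernel f μ) (hH : 1 / 2 ≤ H)
    (hH1 : H < 1) (u₀ : Sp d →ᵇ ℝ) {n : ℕ} {t : ℝ} {x : Sp d} {v G : TensorPow (HP H f) n}
    (hG : Represents H f (chaosKernel u₀ n t x) G)
    (hv : ∀ a : Fin n → Rect d, (∀ i, (a i).time ≤ t) →
      inner ℝ (tens fun i => ind H f (a i)) v = 0) : inner ℝ v G = 0 := by
  have h1 : ∀ ε : ℝ, 0 < ε → ε ≤ 1 / 2 → ∀ c : (Fin n → Rect d) →₀ ℝ,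
      |avgFunctional H f u₀ n t x ε c| ≤ 2 ^ n * ‖combo H f c - v‖ * ‖G‖ := by
    intro ε hε hε1 c
    obtain ⟨C, hC, h⟩ := hf.exists_abs_avgFunctional_le hH hH1 u₀ x hv hε (by linarith)
    -- With `m` close to `w`, the part `c - m` takes the bound uniform in `ε` and the part `m` the
    -- bound relative to `v`. For `w = v` the constant `C`, which depends on `ε`, disappears.
    have h2 : ∀ w : TensorPow (HP H f) n, |avgFunctional H f u₀ n t x ε c| ≤
        2 ^ n * ‖combo H f c - w‖ * ‖G‖ + C * ‖w - v‖ := by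
      intro w
      refine (denseRange_combo n).induction_on (p := fun w => |avgFunctional H f u₀ n t x ε c| ≤
        2 ^ n * ‖combo H f c - w‖ * ‖G‖ + C * ‖w - v‖) w
        (isClosed_le continuous_const (by fun_prop)) fun m => ?_
      have e : avgFunctional H f u₀ n t x ε c =
          avgFunctional H f u₀ n t x ε (c - m) + avgFunctional H f u₀ n t x ε m := by
        rw [← map_add, sub_add_cancel]
      rw [e]
      refine (abs_add_le _ _).trans (add_le_add ?_ (h m))
      have := hf.abs_avgFunctional_le hH hH1 u₀ hG hε hε1 (c - m)
      rwa [combo, map_sub (Finsupp.linearCombination ℝ _)] at this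
    simpa using h2 v
  -- The bound no longer involves `C`, so `ε` can tend to zero.
  have h2 : ∀ c : (Fin n → Rect d) →₀ ℝ,
      |(inner ℝ (combo H f c) G : ℝ)| ≤ 2 ^ n * ‖combo H f c - v‖ * ‖G‖ := by
    intro c
    refine le_of_tendsto (hf.tendsto_avgFunctional hH u₀ hG c).abs ?_
    filter_upwards [Ioc_mem_nhdsGT (show (0 : ℝ) < 1 / 2 by norm_num)] with ε hε
    exact h1 ε hε.1 hε.2 c
  -- Density of the combinations of rectangles extends the bound to all vectors, in particular to
  -- `v` itself, where it vanishes.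
  have h3 : |(inner ℝ v G : ℝ)| ≤ 2 ^ n * ‖v - v‖ * ‖G‖ :=
    (denseRange_combo n).induction_on (p := fun w =>
      |(inner ℝ w G : ℝ)| ≤ 2 ^ n * ‖w - v‖ * ‖G‖) v
      (isClosed_le (by fun_prop) (by fun_prop)) h2
  simpa using h3

end Bump

/-! ### Measurability with respect to the noise up to time `t` -/

section Measurability

/-- Linearity of `W` is a consequence of its covariance: the difference of the two sides is
orthogonal to every `W k`, hence to itself. It holds only almost surely, which is why measurability
below is up to null sets. -/
lemma IsIsonormal.sum_smul_ae_eq {V : Type*} [NormedAddCommGroup V] [InnerProductSpace ℝ V]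
    {Ω : Type*} [MeasurableSpace Ω] {P : Measure Ω} [IsProbabilityMeasure P] {W : V → Ω → ℝ}
    (hW : IsIsonormal P W) {ι : Type*} (s : Finset ι) (c : ι → ℝ) (h : ι → V) :
    W (∑ i ∈ s, c i • h i) =ᵐ[P] fun ω => ∑ i ∈ s, c i * W (h i) ω := by
  have hm : ∀ h, MemLp (W h) 2 P := fun h => by simpa using hW.memLp h 2
  have hin : ∀ g h, inner ℝ (toL2 P (W g)) (toL2 P (W h)) = inner ℝ g h := fun g h => by
    rw [inner_toL2 (hm g) (hm h), hW.covariance]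
  set D := toL2 P (W (∑ i ∈ s, c i • h i)) - ∑ i ∈ s, c i • toL2 P (W (h i)) with hD
  have h1 : ∀ k, inner ℝ D (toL2 P (W k)) = 0 := by
    intro k
    simp only [hD, inner_sub_left, sum_inner, real_inner_smul_left, hin, sub_self]
  have h2 : D = 0 := by
    have h3 : inner ℝ D (toL2 P (W (∑ i ∈ s, c i • h i)) - ∑ i ∈ s, c i • toL2 P (W (h i))) = 0 := by
      rw [inner_sub_right, h1, inner_sum]
      simp [real_inner_smul_right, h1]
    rwa [← hD, inner_self_eq_zero] at h3
  have hS : MemLp (fun ω => ∑ i ∈ s, c i * W (h i) ω) 2 P :=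
    memLp_finsetSum _ fun i _ => (hm (h i)).const_mul (c i)
  have h3 : ∑ i ∈ s, c i • toL2 P (W (h i)) = toL2 P fun ω => ∑ i ∈ s, c i * W (h i) ω := by
    refine Lp.ext ?_
    refine (Lp.coeFn_finsetSum _ _).trans ?_
    have h4 : ∀ᵐ ω ∂P, ∀ i ∈ s, (c i • toL2 P (W (h i)) : Lp ℝ 2 P) ω = c i * W (h i) ω := by
      rw [Filter.eventually_all_finset]
      intro i _
      filter_upwards [Lp.coeFn_smul (c i) (toL2 P (W (h i))), toL2_ae_eq (hm (h i))] with ω h5 h6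
      rw [h5, Pi.smul_apply, h6, smul_eq_mul]
    filter_upwards [h4, toL2_ae_eq hS] with ω h5 h6
    rw [h6, Finset.sum_apply]
    exact Finset.sum_congr rfl h5
  have h4 := sub_eq_zero.1 h2
  rw [h3] at h4
  have h5 := toL2_ae_eq (hm (∑ i ∈ s, c i • h i))
  rw [h4] at h5
  exact h5.symm.trans (toL2_ae_eq hS)

variable {d : ℕ} {H : ℝ} {f : Sp d → ℝ} {μ : Measure (Sp d)}

lemma noiseFiltration_le {Ω : Type*} [mΩ : MeasurableSpace Ω] {P : Measure Ω}
    {W : HP H f → Ω → ℝ} (hW : IsIsonormal P W) (t : ℝ) : noiseFiltration H f W t ≤ mΩ :=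
  iSup₂_le fun a _ => (hW.measurable (ind H f a)).comap_le

lemma measurable_noiseFiltration {Ω : Type*} (W : HP H f → Ω → ℝ) {t : ℝ} {a : Rect d} (ha : a.time ≤ t) :
    Measurable[noiseFiltration H f W t] (W (ind H f a)) :=
  Measurable.of_comap_le (le_iSup₂_of_le a ha le_rfl)

variable {Ω : Type*} [mΩ : MeasurableSpace Ω] {P : Measure Ω} [IsProbabilityMeasure P]
  {W : HP H f → Ω → ℝ}

lemma aestronglyMeasurable_wienerElem (hW : IsIsonormal P W) {n : ℕ} {t : ℝ} {a : Fin n → Rect d}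
    (ha : ∀ i, (a i).time ≤ t) :
    AEStronglyMeasurable[noiseFiltration H f W t] (wienerElem W fun i => ind H f (a i)) P := by
  have h1 : ∀ c : Fin n → ℝ, AEStronglyMeasurable[noiseFiltration H f W t]
      (W (∑ i, c i • ind H f (a i))) P := by
    intro c
    refine AEStronglyMeasurable.congr ?_ (hW.sum_smul_ae_eq Finset.univ c _).symm
    refine (Finset.stronglyMeasurable_fun_sum _ fun i _ => ?_).aestronglyMeasurable
    exact ((measurable_noiseFiltration W (ha i)).stronglyMeasurable).const_mul (c i)
  have h2 : wienerElem W (fun i => ind H f (a i)) = fun ω => ((2 : ℝ) ^ n * (n ! : ℝ))⁻¹ *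
      ∑ ε : Fin n → ℤˣ, (∏ i, ((ε i : ℤ) : ℝ)) *
        (scaledHermite n ‖∑ i, ((ε i : ℤ) : ℝ) • ind H f (a i)‖).eval
          (W (∑ i, ((ε i : ℤ) : ℝ) • ind H f (a i)) ω) := by
    ext ω
    simp only [wienerElem, wienerDiag_eq]
  rw [h2]
  have h3 : ∀ ε : Fin n → ℤˣ, AEStronglyMeasurable[noiseFiltration H f W t]
      (fun ω => (∏ i, ((ε i : ℤ) : ℝ)) *
        (scaledHermite n ‖∑ i, ((ε i : ℤ) : ℝ) • ind H f (a i)‖).eval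
          (W (∑ i, ((ε i : ℤ) : ℝ) • ind H f (a i)) ω)) P := fun ε =>
    ((Polynomial.continuous _).comp_aestronglyMeasurable (h1 _)).const_mul _
  refine AEStronglyMeasurable.const_mul ?_ _
  generalize (Finset.univ : Finset (Fin n → ℤˣ)) = S
  classical
  induction S using Finset.induction_on with
  | empty => simpa using stronglyMeasurable_const.aestronglyMeasurable
  | insert ε S hε ih =>
    simp only [Finset.sum_insert hε]
    exact (h3 ε).add ih

/-- The multiple Wiener integral of a chaos kernel at time `t` is measurable with respect to the
noise up to time `t`. -/
lemma IsSpatialKernel.aestronglyMeasurable_wienerIntL (hf : IsSpatialKernel f μ) (hH : 1 / 2 ≤ H)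
    (hH1 : H < 1) (hW : IsIsonormal P W) (u₀ : Sp d →ᵇ ℝ) {n : ℕ} {t : ℝ} {x : Sp d}
    {G : TensorPow (HP H f) n} (hG : Represents H f (chaosKernel u₀ n t x) G) :
    AEStronglyMeasurable[noiseFiltration H f W t] (IsIsonormal.wienerIntL P W n G) P := by
  set K : Submodule ℝ (TensorPow (HP H f) n) :=
    (lpMeas ℝ ℝ (noiseFiltration H f W t) 2 P).comap
      (IsIsonormal.wienerIntL P W n : TensorPow (HP H f) n →ₗ[ℝ] Lp ℝ 2 P) with hK
  have hmem : ∀ F, F ∈ K ↔ AEStronglyMeasurable[noiseFiltration H f W t]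
      (IsIsonormal.wienerIntL P W n F) P := fun F => 
    mem_lpMeas_iff_aestronglyMeasurable (𝕜 := ℝ) (F := ℝ)
  have hcl : IsClosed (K : Set (TensorPow (HP H f) n)) :=
    (isClosed_aestronglyMeasurable (F := ℝ) (p := 2) (μ := P) (noiseFiltration_le hW t)).preimage
      (IsIsonormal.wienerIntL P W n).continuous
  have : CompleteSpace K := hcl.completeSpace_coe
  -- `K` is closed, so it equals its double orthogonal complement. It contains the tensors of
  -- rectangles up to time `t`, so a `v` orthogonal to `K` meets the hypothesis of
  -- `inner_eq_zero_of_represents`.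
  rw [← hmem, ← K.orthogonal_orthogonal]
  refine (Submodule.mem_orthogonal _ _).2 fun v hv => ?_
  refine hf.inner_eq_zero_of_represents hH hH1 u₀ hG fun a ha => ?_
  refine (Submodule.mem_orthogonal _ _).1 hv _ ((hmem _).2 ?_)
  rw [hW.wienerIntL_tens]
  exact (aestronglyMeasurable_wienerElem hW ha).congr (toL2_ae_eq (hW.memLp_wienerElem _)).symm

end Measurability

/-! ### Orthogonal series and the norm of a chaos expansion -/

section Orthogonal

variable {E : Type*} [NormedAddCommGroup E] [InnerProductSpace ℝ E]

lemma hasSum_norm_sq_of_orthogonal {x : ℕ → E} (hx : Pairwise fun i j => inner ℝ (x i) (x j) = 0)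
    {S : E} (hS : HasSum x S) : HasSum (fun n => ‖x n‖ ^ 2) (‖S‖ ^ 2) := by
  have h1 : ∀ n, inner ℝ S (x n) = ‖x n‖ ^ 2 := by
    intro n
    rw [real_inner_comm]
    have h2 := (innerSL ℝ (x n)).hasSum hS
    have h3 := hasSum_single (f := fun m => innerSL ℝ (x n) (x m)) n fun m hm => hx hm.symm
    exact (h2.unique h3).trans (real_inner_self_eq_norm_sq _)
  have h2 := (innerSL ℝ S).hasSum hS
  simp only [innerSL_apply_apply, h1] at h2
  rwa [real_inner_self_eq_norm_sq] at h2

lemma summable_of_orthogonal [CompleteSpace E] {x : ℕ → E}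
    (hx : Pairwise fun i j => inner ℝ (x i) (x j) = 0) (h : Summable fun n => ‖x n‖ ^ 2) :
    Summable x := by
  have hV : OrthogonalFamily ℝ (fun n => (Submodule.span ℝ {x n} : Submodule ℝ E))
      fun n => (Submodule.span ℝ {x n} : Submodule ℝ E).subtypeₗᵢ := by
    intro i j hij v w
    obtain ⟨a, ha⟩ := Submodule.mem_span_singleton.1 v.2
    obtain ⟨b, hb⟩ := Submodule.mem_span_singleton.1 w.2
    simp only [Submodule.coe_subtypeₗᵢ, Submodule.subtype_apply, ← ha, ← hb,
      real_inner_smul_left, real_inner_smul_right, hx hij, mul_zero]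
  have h1 := (hV.summable_iff_norm_sq_summable fun n =>
    ⟨x n, Submodule.mem_span_singleton_self (x n)⟩).2 (by simpa using h)
  simpa using h1

end Orthogonal

section ToL2

variable {Ω : Type*} [MeasurableSpace Ω] {P : Measure Ω}

lemma toL2_smul {X : Ω → ℝ} (hX : MemLp X 2 P) (c : ℝ) : toL2 P (c • X) = c • toL2 P X := by
  rw [toL2_of_memLp hX, toL2_of_memLp (hX.const_smul c), MemLp.toLp_const_smul]

lemma enorm_toL2_sq {X : Ω → ℝ} (hX : MemLp X 2 P) :
    ‖toL2 P X‖ₑ ^ 2 = ∫⁻ ω, ‖X ω‖ₑ ^ 2 ∂P := by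
  rw [toL2_of_memLp hX, Lp.enorm_def, eLpNorm_congr_ae hX.coeFn_toLp]
  have := eLpNorm_nnreal_pow_eq_lintegral (f := X) (μ := P) (p := 2) two_ne_zero
  simpa using this

end ToL2

section Chaos

variable {V : Type*} [NormedAddCommGroup V] [InnerProductSpace ℝ V]
  {Ω : Type*} [MeasurableSpace Ω] {P : Measure Ω} [IsProbabilityMeasure P] {W : V → Ω → ℝ}

namespace IsIsonormal

lemma enorm_wienerIntL_sq (hW : IsIsonormal P W) {n : ℕ} {G : TensorPow V n}
    (hG : IsSymmTensor G) : ‖wienerIntL P W n G‖ₑ ^ 2 = (n ! : ℝ≥0∞) * ‖G‖ₑ ^ 2 := by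
  have := congrArg ENNReal.ofReal (hW.norm_sq_wienerIntL hG)
  rwa [ENNReal.ofReal_mul (by positivity), ENNReal.ofReal_pow (norm_nonneg _),
    ENNReal.ofReal_pow (norm_nonneg _), ofReal_norm, ofReal_norm, ENNReal.ofReal_natCast] at this

lemma pairwise_wienerIntL (hW : IsIsonormal P W) (K : ∀ n, TensorPow V n) :
    Pairwise fun i j => inner ℝ (wienerIntL P W i (K i)) (wienerIntL P W j (K j)) = 0 :=
  fun _ _ hij => hW.inner_wienerIntL_of_ne hij _ _

lemma enorm_sq_eq_tsum (hW : IsIsonormal P W) {K : ∀ n, TensorPow V n}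
    (hK : ∀ n, IsSymmTensor (K n)) {X : Lp ℝ 2 P}
    (h : HasSum (fun n => wienerIntL P W n (K n)) X) :
    ‖X‖ₑ ^ 2 = ∑' n, (n ! : ℝ≥0∞) * ‖K n‖ₑ ^ 2 := by
  have h1 := hasSum_norm_sq_of_orthogonal (hW.pairwise_wienerIntL K) h
  have h2 := congrArg ENNReal.ofReal h1.tsum_eq
  rw [ENNReal.ofReal_tsum_of_nonneg (fun n => by positivity) h1.summable,
    ENNReal.ofReal_pow (norm_nonneg _), ofReal_norm] at h2
  rw [← h2]
  refine tsum_congr fun n => ?_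
  rw [ENNReal.ofReal_pow (norm_nonneg _), ofReal_norm, hW.enorm_wienerIntL_sq (hK n)]

lemma summable_wienerIntL (hW : IsIsonormal P W) {K : ∀ n, TensorPow V n}
    (hK : ∀ n, IsSymmTensor (K n)) (h : ∑' n, (n ! : ℝ≥0∞) * ‖K n‖ₑ ^ 2 ≠ ∞) :
    Summable fun n => wienerIntL P W n (K n) := by
  refine summable_of_orthogonal (hW.pairwise_wienerIntL K) ?_
  refine (ENNReal.summable_toReal h).congr fun n => ?_
  rw [← hW.enorm_wienerIntL_sq (hK n)]
  simp

end IsIsonormal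

end Chaos

/-! ### The equation in terms of chaos kernels -/

section Main

variable {d : ℕ} {H : ℝ} {f : Sp d → ℝ} {μ : Measure (Sp d)}

lemma integral_pi_fin_zero {X : Type*} [MeasureSpace X] [SigmaFinite (volume : Measure X)] (c : ℝ) :
    ∫ _z : Fin 0 → X, c = c := by
  have : (volume : Measure (Fin 0 → X)) Set.univ = 1 := by
    rw [volume_pi, Measure.pi_univ]; simp
  simp [measureReal_def, this]

lemma IsSpatialKernel.represents_chaosKernel_zero_iff (hf : IsSpatialKernel f μ) (hH : 1 / 2 ≤ H)
    (u₀ : Sp d →ᵇ ℝ) {t : ℝ} {x : Sp d} {G : TensorPow (HP H f) 0} :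
    Represents H f (chaosKernel u₀ 0 t x) G ↔ inner ℝ (tens ![]) G = heatSemigroup t u₀ x := by
  rw [hf.represents_chaosKernel_iff hH]
  simp only [chaosKernel_index_zero, Finset.univ_eq_empty, Finset.prod_empty, mul_one,
    integral_pi_fin_zero]
  have : ∀ a : Fin 0 → Rect d, (fun i => ind H f (a i)) = ![] := fun a => Subsingleton.elim _ _
  simp only [this, forall_const]

variable {Ω : Type*} [mΩ : MeasurableSpace Ω] {P : Measure Ω} [IsProbabilityMeasure P]
  {W : HP H f → Ω → ℝ}

/-- The chaos expansion of a solution is given by the chaos kernels. -/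
lemma IsMildSolution.exists_expansion (hf : IsSpatialKernel f μ) (hH : 1 / 2 ≤ H)
    (hW : IsIsonormal P W) {u₀ : Sp d →ᵇ ℝ} {u : ℝ → Sp d → Ω → ℝ}
    (hu : IsMildSolution H f P W u₀ u) {t : ℝ} (x : Sp d) (ht : 0 ≤ t) :
    ∃ K : ∀ n, TensorPow (HP H f) n, (∀ n, Represents H f (chaosKernel u₀ n t x) (K n)) ∧
      HasSum (fun n => IsIsonormal.wienerIntL P W n (K n)) (toL2 P (u t x)) := by
  -- The equation is first read as giving some expansion of each `u_{t,x}`, with higher kernels that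
  -- symmetrize kernels `g` of the integrand. Nothing yet relates `g` to the expansions at other
  -- points.
  have h1 : ∀ (t : ℝ) (x : Sp d), 0 ≤ t → ∃ K : ∀ n, TensorPow (HP H f) n,
      HasSum (fun n => IsIsonormal.wienerIntL P W n (K n)) (toL2 P (u t x)) ∧
      inner ℝ (tens ![]) (K 0) = heatSemigroup t u₀ x ∧
      ∃ g : ∀ n : ℕ, ℝ → Sp d → TensorPow (HP H f) n,
        (∀ s y, 0 ≤ s → (∀ n, IsSymmTensor (g n s y)) ∧
          HasSum (fun n => IsIsonormal.wienerIntL P W n (g n s y))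
            (toL2 P (mildIntegrand u t x s y))) ∧
        ∀ n, IsSymmetrization H f (g n) (K (n + 1)) := by
    intro t x ht
    obtain ⟨Z, ⟨g, G, hg, hG, hZ⟩, he⟩ := hu.equation t x ht
    simp only [hW.wienerInt_eq] at hg hZ
    let K : ∀ n, TensorPow (HP H f) n := fun n =>
      match n with
      | 0 => heatSemigroup t u₀ x • tens ![]
      | n + 1 => G n
    have hK0 : inner ℝ (tens ![]) (K 0) = heatSemigroup t u₀ x := by
      change inner ℝ (tens ![]) (heatSemigroup t u₀ x • tens (V := HP H f) ![]) = _
      rw [real_inner_smul_right, inner_tens]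
      simp
    refine ⟨K, ?_, hK0, g, fun s y hs => (hg s y hs).2, hG⟩
    have h2 : toL2 P (u t x) = IsIsonormal.wienerIntL P W 0 (K 0) + Z := by
      rw [hW.wienerIntL_zero, hK0]
      refine Lp.ext ?_
      filter_upwards [toL2_ae_eq (hu.squareIntegrable t x ht), he, Lp.coeFn_add
        (toL2 P fun _ : Ω => heatSemigroup t u₀ x) Z,
        toL2_ae_eq (memLp_const (μ := P) (p := 2) (heatSemigroup t u₀ x))] with ω h1 h2 h3 h4
      rw [h1, h2, h3, Pi.add_apply, h4]
    rw [h2]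
    have h3 := (hasSum_nat_add_iff (f := fun n => IsIsonormal.wienerIntL P W n (K n)) 1).1 hZ
    simpa [add_comm] using h3
  choose! K hK hK0 g hg hsymm using h1
  have h2 : ∀ n (t : ℝ) (x : Sp d), 0 ≤ t → Represents H f (chaosKernel u₀ n t x) (K t x n) := by
    intro n
    induction n with
    | zero => exact fun t x ht => (hf.represents_chaosKernel_zero_iff hH u₀).2 (hK0 t x ht)
    | succ n ih =>
      intro t x ht
      refine (hf.isSymmetrization_iff hH u₀ (k := fun s y => K s y n) (fun s y hs => ih s y hs)
        (fun s y hs => ?_)).1 (hsymm t x ht n)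
      obtain ⟨h3, h4⟩ := hg t x ht s y hs
      -- A second expansion of the integrand, from that of `u_{s,y}`. Uniqueness at order `n`
      -- identifies it with `g`; the induction hypothesis supplies the symmetry of `K s y n`, which
      -- is not part of the definition of the Skorohod integral.
      have h5 : HasSum (fun n => IsIsonormal.wienerIntL P W n (mildWeight t x s y • K s y n))
          (toL2 P (mildIntegrand u t x s y)) := by
        rw [mildIntegrand_eq, toL2_smul (hu.squareIntegrable s y hs)]
        simpa using (hK s y hs).const_smul (mildWeight t x s y)
      exact hW.chaos_unique h4 (G := fun n => mildWeight t x s y • K s y n) h5 n (h3 n)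
        ((hf.isSymmTensor_of_represents hH u₀ (ih s y hs)).smul _)
  exact ⟨K t x, fun n => h2 n t x ht, hK t x ht⟩

/-- If the series of norms converges, there is a solution. -/
lemma IsSpatialKernel.exists_isMildSolution (hf : IsSpatialKernel f μ) (hH : 1 / 2 ≤ H)
    (hH1 : H < 1) (hW : IsIsonormal P W) (u₀ : Sp d →ᵇ ℝ)
    (h : ∀ (t : ℝ) (x : Sp d), 0 ≤ t →
      ∑' n : ℕ, (n ! : ℝ≥0∞) * tensorNormSq H f (chaosKernel u₀ n t x) < ∞) :
    ∃ u : ℝ → Sp d → Ω → ℝ, IsMildSolution H f P W u₀ u := by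
  have h1 : ∀ (t : ℝ) (x : Sp d), 0 ≤ t → ∃ (K : ∀ n, TensorPow (HP H f) n) (v : Ω → ℝ),
      (∀ n, Represents H f (chaosKernel u₀ n t x) (K n)) ∧
      Measurable[noiseFiltration H f W t] v ∧ MemLp v 2 P ∧
      HasSum (fun n => IsIsonormal.wienerIntL P W n (K n)) (toL2 P v) := by
    intro t x ht
    have h2 : ∀ n, Represents H f (chaosKernel u₀ n t x)
        (toTensor H f (chaosKernel u₀ n t x)) := by
      intro n
      refine exists_represents_of_tensorNormSq_ne_top fun h3 => ?_
      have h4 := ENNReal.ne_top_of_tsum_ne_top (h t x ht).ne n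
      rw [h3, ENNReal.mul_top (by positivity)] at h4
      exact h4 rfl
    have hs : Summable fun n => IsIsonormal.wienerIntL P W n
        (toTensor H f (chaosKernel u₀ n t x)) := by
      refine hW.summable_wienerIntL (fun n => hf.isSymmTensor_of_represents hH u₀ (h2 n)) ?_
      have h3 := (h t x ht).ne
      simpa only [(h2 _).tensorNormSq_eq] using h3
    set X := ∑' n, IsIsonormal.wienerIntL P W n (toTensor H f (chaosKernel u₀ n t x)) with hX
    have hXm : AEStronglyMeasurable[noiseFiltration H f W t] X P := by
      have hcl := isClosed_aestronglyMeasurable (F := ℝ) (p := 2) (μ := P)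
        (noiseFiltration_le hW t)
      refine hcl.mem_of_tendsto hs.hasSum (Filter.Eventually.of_forall fun s => ?_)
      refine mem_lpMeas_iff_aestronglyMeasurable (𝕜 := ℝ).1 (Submodule.sum_mem _ fun n _ => ?_)
      exact mem_lpMeas_iff_aestronglyMeasurable.2
        (hf.aestronglyMeasurable_wienerIntL hH hH1 hW u₀ (h2 n))
    -- The limit is measurable for the noise only up to null sets, while adaptedness is exact, so
    -- the solution is defined by a measurable modification.
    have hv : MemLp (hXm.mk X) 2 P := (memLp_congr_ae hXm.ae_eq_mk).1 (Lp.memLp X)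
    refine ⟨_, hXm.mk X, h2, hXm.stronglyMeasurable_mk.measurable, hv, ?_⟩
    have h3 : toL2 P (hXm.mk X) = X := Lp.ext ((toL2_ae_eq hv).trans hXm.ae_eq_mk.symm)
    rw [h3]
    exact hs.hasSum
  choose! K v hK hvm hv hsum using h1
  refine ⟨v, hvm, hv, fun t x ht => ?_⟩
  have hs := (hasSum_nat_add_iff' (f := fun n => IsIsonormal.wienerIntL P W n (K t x n)) 1).2
    (hsum t x ht)
  -- The Skorohod integral is the expansion without its zeroth term, which is the heat semigroup.
  refine ⟨toL2 P (v t x) - ∑ i ∈ Finset.range 1, IsIsonormal.wienerIntL P W i (K t x i),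
    ⟨fun n s y => mildWeight t x s y • K s y n, fun n => K t x (n + 1),
    fun s y hs => ⟨?_, fun n => ?_, ?_⟩, fun n => ?_, ?_⟩, ?_⟩
  · rw [mildIntegrand_eq]
    exact (hv s y hs).const_smul _
  · exact (hf.isSymmTensor_of_represents hH u₀ (hK s y hs n)).smul _
  · rw [mildIntegrand_eq, toL2_smul (hv s y hs)]
    simpa [hW.wienerInt_eq] using (hsum s y hs).const_smul (mildWeight t x s y)
  · exact (hf.isSymmetrization_iff hH u₀ (k := fun s y => K s y n) (fun s y hs => hK s y hs n)
      fun s y hs => rfl).2 (hK t x ht (n + 1))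
  · simpa only [hW.wienerInt_eq] using hs
  · have h0 : IsIsonormal.wienerIntL P W 0 (K t x 0) = toL2 P fun _ => heatSemigroup t u₀ x := by
      rw [hW.wienerIntL_zero, (hf.represents_chaosKernel_zero_iff hH u₀).1 (hK t x ht 0)]
    rw [Finset.sum_range_one, h0]
    filter_upwards [toL2_ae_eq (hv t x ht), Lp.coeFn_sub (toL2 P (v t x))
      (toL2 P fun _ : Ω => heatSemigroup t u₀ x),
      toL2_ae_eq (memLp_const (μ := P) (p := 2) (heatSemigroup t u₀ x))] with ω h1 h2 h3
    rw [h2, Pi.sub_apply, h1, h3]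
    ring

end Main

end StochHeat

end

theorem proposition3 {d : ℕ} (hd : 0 < d) {H : ℝ} (hH : 1 / 2 ≤ H) (hH1 : H < 1)
    {f : Sp d → ℝ} {μ : Measure (Sp d)} (hf : IsSpatialKernel f μ)
    (u₀ : Sp d →ᵇ ℝ)
    {Ω : Type*} [MeasurableSpace Ω] (P : Measure Ω) [IsProbabilityMeasure P]
    (W : HP H f → Ω → ℝ) (hW : IsIsonormal P W) :
    ((∃ u : ℝ → Sp d → Ω → ℝ, IsMildSolution H f P W u₀ u) ↔
      ∀ (t : ℝ) (x : Sp d), 0 ≤ t →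
        ∑' n : ℕ, (n ! : ℝ≥0∞) * tensorNormSq H f (chaosKernel u₀ n t x) < ∞) ∧
    (∀ u v : ℝ → Sp d → Ω → ℝ, IsMildSolution H f P W u₀ u → IsMildSolution H f P W u₀ v →
      ∀ (t : ℝ) (x : Sp d), 0 ≤ t → u t x =ᵐ[P] v t x) ∧
    ∀ u : ℝ → Sp d → Ω → ℝ, IsMildSolution H f P W u₀ u →
      ∀ (t : ℝ) (x : Sp d), 0 ≤ t →
        HasSum (fun n => wienerInt P W n (toTensor H f (chaosKernel u₀ n t x)))
          (toL2 P (u t x)) ∧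
        ∫⁻ ω, ‖u t x ω‖ₑ ^ 2 ∂P =
          ∑' n : ℕ, (n ! : ℝ≥0∞) * tensorNormSq H f (chaosKernel u₀ n t x) := by
  have key : ∀ u : ℝ → Sp d → Ω → ℝ, IsMildSolution H f P W u₀ u →
      ∀ (t : ℝ) (x : Sp d), 0 ≤ t →
        HasSum (fun n => wienerInt P W n (toTensor H f (chaosKernel u₀ n t x)))
          (toL2 P (u t x)) ∧
        ∫⁻ ω, ‖u t x ω‖ₑ ^ 2 ∂P =
          ∑' n : ℕ, (n ! : ℝ≥0∞) * tensorNormSq H f (chaosKernel u₀ n t x) := by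
    intro u hu t x ht
    obtain ⟨K, hK, hsum⟩ := hu.exists_expansion hf hH hW x ht
    refine ⟨?_, ?_⟩
    · simpa only [hW.wienerInt_eq, (hK _).toTensor_eq] using hsum
    · rw [← enorm_toL2_sq (hu.squareIntegrable t x ht), hW.enorm_sq_eq_tsum
        (fun n => hf.isSymmTensor_of_represents hH u₀ (hK n)) hsum]
      simp only [(hK _).tensorNormSq_eq]
  refine ⟨⟨?_, hf.exists_isMildSolution hH hH1 hW u₀⟩, fun u v hu hv t x ht => ?_, key⟩
  · rintro ⟨u, hu⟩ t x ht
    -- The series is the second moment of a square-integrable variable.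
    rw [← (key u hu t x ht).2, ← enorm_toL2_sq (hu.squareIntegrable t x ht)]
    finiteness
  · have h := (key u hu t x ht).1.unique (key v hv t x ht).1
    have h1 := toL2_ae_eq (hu.squareIntegrable t x ht)
    rw [h] at h1
    exact h1.symm.trans (toL2_ae_eq (hv.squareIntegrable t x ht))
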